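/- **Setting.** Let $g,h:\mathbb R^d\to\mathbb R$ be convex and $r:\mathbb R^d\to\mathbb R\cup\{\infty\}$ proper and lower semicontinuous. Consider $\min_x g(x)-h(x)+r(x)$. Let $L>0$, $\nu\in(0,1]$, and let $h$ be differentiable with $\|\nabla h(x)-\nabla h(y)\|\le L\|x-y\|^\nu$ for all $x,y$. "$L$-smooth" means differentiable with $L$-Lipschitz gradient. $\hat\partial r$ is the Fréchet subdifferential. For $\mu>0$ put $\mathrm{prox}_{\mu r}(x)=\mathrm{Argmin}_y\{\frac1{2\mu}\|y-x\|^2+r(y)\}$, $r_\mu(x)=\inf_y\{\frac1{2\mu}\|y-x\|^2+r(y)\}$ and $F_\mu=g-h+r_\mu$. One has $F_\mu=(g+\frac1{2\mu}\|\cdot\|^2)-(h+R_\mu)$ with $R_\mu$ convex and $\frac1\mu\mathrm{prox}_{\mu r}(x)\subseteq\partial R_\mu(x)$. We fix $x_1\in\mathbb R^d$ and assume that there are $\Delta,\bar\mu>0$ with $F_\mu(x_1)-\inf F_\mu\le\Delta$ for all $\mu\in(0,\bar\mu]$. Let $p=p_\mu$ be a measurable selection of $\mathrm{prox}_{\mu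 r}$. Conditions on $r$: (i) $r$ is real-valued and Lipschitz; (ii) $r$ is real-valued and bounded below; (iii) $F_{\mu}$ has bounded sublevel sets for some $\mu\in(0,1)$, $r$ is finite on some nonempty compact set, and $r$ is bounded below. **Algorithm SSDC.** For $k=1,\dots,K$, $x_{k+1}$ is the output of a solver started at $x_k$ for $$\min_x\ g(x)+\tfrac1{2\mu}\|x\|^2-\big(\nabla h(x_k)+\tfrac1\mu p(x_k)\big)^{\top}(x-x_k)+\tfrac{\gamma_k}2\|x-x_k\|^2 .$$ An index $\tau\in\{1,\dots,K\}$ is drawn independently of all samples with $P(\tau=k)=k^\alpha/\sum_{j=1}^Kj^\alpha$, where $\alpha\ge1$; the output is $x_\tau$, and $w_\tau=p(x_\tau)$. *SPG, $T_k$ iterations.* $g=\mathrm E_\xi[g(\cdot;\xi)]$ is $L$-smooth, $h=\mathrm E_\varsigma[h(\cdot;\varsigma)]$, with unbiased stochastic gradients $\nabla g(x;\xi)$ and stochastic subgradients $\partial h(x;\varsigma)$, $\xi,\varsigma$ independent, and $\mathrm E\|(\nabla g(x;\xi)-\partial h(x;\varsigma))-(\nabla g(x)-\nabla h(x))\|^2\le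 G^2$ for all $x$. With fresh i.i.d. samples and $y_1=x_k$, $\eta_t=3/(\gamma_k(t+1))$, $$y_{t+1}=\arg\min_y\ y^\top\big(\nabla g(y_t;\xi_t)-\partial h(x_k;\varsigma_t)-\tfrac1\mu p(x_k)\big)+\tfrac1{2\mu}\|y\|^2+\tfrac{\gamma_k}2\|y-x_k\|^2+\tfrac1{2\eta_t}\|y-y_t\|^2$$ for $1\le t\le T_k$, and $x_{k+1}=\sum_{t=2}^{T_k+1}t\,y_t/\sum_{t=2}^{T_k+1}t$. *SVRG, $S_k$ outer loops of $T_k$ inner steps.* $g=\frac1{n_1}\sum_{i\le n_1} g_i$ with each $g_i$ $L$-smooth, $h=\frac1{n_2}\sum_{j\le n_2} h_j$, $n=n_1+n_2$, $\eta=0.05/L$. Start from $\bar y=x_k$. Each outer loop sets $y_0=\bar y$, draws i.i.d. uniform indices $i_1,\dots,i_{T_k}$, computes, with $v_t=\nabla g_{i_t}(y_{t-1})-\nabla g_{i_t}(\bar y)+\nabla g(\bar y)-\nabla h(x_k)-\frac1\mu p(x_k)$, $$y_t=\arg\min_y\ v_t^\top y+\tfrac1{2\eta}\|y-y_{t-1}\|^2+\tfrac1{2\mu}\|y\|^2+\tfrac{\gamma_k}2\|y-x_k\|^2,$$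 and then replaces $\bar y$ by $\frac1{T_k}\sum_{t=1}^{T_k}y_t$; $x_{k+1}$ is the final $\bar y$. The gradient complexity is $\sum_{k=1}^K(n+T_k)S_k$. **Theorem.** Let $A>0$. In each of the following cases there are $C,\varepsilon_0>0$ such that for all $\varepsilon\in(0,\varepsilon_0]$ $$\mathrm E\|x_\tau-w_\tau\|\le C\varepsilon,\qquad \mathrm E\,\mathrm{dist}\big(\nabla h(w_\tau),\nabla g(w_\tau)+\hat\partial r(w_\tau)\big)\le C\varepsilon^\nu,$$ with the stated complexity. Here $C,\varepsilon_0$ may depend on $g,h,r,x_1,L,\nu,G,\Delta,\bar\mu,\alpha,A,c$, but not on $\varepsilon$, the stochastic oracle, the finite-sum decomposition or $n$. (a) SPG, (i): $\mu=\varepsilon$, $\gamma_k=3Lk^{1/3}$, $T_k=\lceil3Lk/\gamma_k+3\rceil$, $K=\lceil A/\varepsilon^{3(1+\nu)/2}\rceil$; $\sum_{k\le K}T_k\le CK^{5/3}$ and $\sum_{k\le K}T_k\le C/\varepsilon^{5(1+\nu)/2}$. (b) SPG, (ii): $\mu=\varepsilon^2$, $\gamma_k=3Lk^{1/2}$, $T_k=\lceil3Lk/\gamma_k+3\rceil$,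 $K=\lceil A/\varepsilon^{4(2+\nu)/3}\rceil$; $\sum_{k\le K}T_k\le CK^{3/2}$ and $\sum_{k\le K}T_k\le C/\varepsilon^{2(2+\nu)}$. (c) SVRG, (i), $c>0$: $\mu=\varepsilon$, $\gamma_k=ck^{1/3}$, any integers $T_k\ge\max(2,200L/\gamma_k)$, $S_k=\lceil\log_2k\rceil$, $K=\lceil A/\varepsilon^{3(1+\nu)/2}\rceil$; for the least such $T_k$ the gradient complexity is at most $C\,n\,\varepsilon^{-3(1+\nu)/2}(1+\log(1/\varepsilon))$. (d) SVRG, (ii) or (iii), $c>0$: $\mu=\varepsilon^2$, $\gamma_k=ck^{1/2}$, any integers $T_k\ge\max(2,200L/\gamma_k)$, $S_k=\lceil\log_2k\rceil$, $K=\lceil A/\varepsilon^{4(2+\nu)/3}\rceil$; for the least such $T_k$ the gradient complexity is at most $C\,n\,\varepsilon^{-4(2+\nu)/3}(1+\log(1/\varepsilon))$. -/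

import Mathlib

open MeasureTheory ProbabilityTheory

universe u₁ u₂ u₃ u₄

/-! ## Nonsmooth analysis on `ℝ^d` -/

/-- `ℝ^d` with the Euclidean norm. -/
abbrev RVec (d : ℕ) : Type := EuclideanSpace ℝ (Fin d)

/-- `f` is differentiable with `(L, ν)`-Hölder continuous gradient. -/
def HasHolderGradient {d : ℕ} (L ν : ℝ) (f : RVec d → ℝ) : Prop :=
  Differentiable ℝ f ∧ ∀ x y, ‖gradient f x - gradient f y‖ ≤ L * ‖x - y‖ ^ ν

/-- `f` is `L`-smooth: differentiable with `L`-Lipschitz continuous gradient. -/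
def IsLSmooth {d : ℕ} (L : ℝ) (f : RVec d → ℝ) : Prop :=
  Differentiable ℝ f ∧ ∀ x y, ‖gradient f x - gradient f y‖ ≤ L * ‖x - y‖

/-- Fréchet subdifferential of an extended-real-valued function at a point where it is finite:
`liminf_{y → x} (f y - f x - ⟪v, y - x⟫) / ‖y - x‖ ≥ 0`, written out with a `δ`. -/
def frechetSubdiff {d : ℕ} (f : RVec d → EReal) (x : RVec d) : Set (RVec d) :=
  {v | f x ≠ ⊤ ∧ f x ≠ ⊥ ∧ ∀ δ : ℝ, 0 < δ → ∀ᶠ y in nhds x,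
    f x + ((inner ℝ v (y - x) - δ * ‖y - x‖ : ℝ) : EReal) ≤ f y}

/-- Limiting subdifferential. -/
def limitingSubdiff {d : ℕ} (f : RVec d → EReal) (x : RVec d) : Set (RVec d) :=
  {v | ∃ (y : ℕ → RVec d) (u : ℕ → RVec d),
    Filter.Tendsto y Filter.atTop (nhds x) ∧
    Filter.Tendsto (fun n => f (y n)) Filter.atTop (nhds (f x)) ∧
    (∀ n, u n ∈ frechetSubdiff f (y n)) ∧
    Filter.Tendsto u Filter.atTop (nhds v)}

/-- `r : ℝ^d → ℝ ∪ {∞}` is proper and lower semicontinuous. -/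
def IsProperLSC {d : ℕ} (r : RVec d → EReal) : Prop :=
  LowerSemicontinuous r ∧ (∀ x, r x ≠ ⊥) ∧ ∃ x, r x ≠ ⊤

/-- `prox_{μ r}(x) = Argmin_y ‖y - x‖² / (2μ) + r y`, a set. -/
def proxSet {d : ℕ} (r : RVec d → EReal) (μ : ℝ) (x : RVec d) : Set (RVec d) :=
  {y | ∀ z, ((1 / (2 * μ) * ‖y - x‖ ^ 2 : ℝ) : EReal) + r y ≤
    ((1 / (2 * μ) * ‖z - x‖ ^ 2 : ℝ) : EReal) + r z}

/-- A Borel measurable choice `p x ∈ prox_{μ r}(x)`. -/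
def IsProxSelection {d : ℕ} (r : RVec d → EReal) (μ : ℝ) (p : RVec d → RVec d) : Prop :=
  Measurable p ∧ ∀ x, p x ∈ proxSet r μ x

/-- Moreau envelope `r_μ`. -/
noncomputable def moreauEnv {d : ℕ} (r : RVec d → EReal) (μ : ℝ) (x : RVec d) : EReal :=
  ⨅ y, ((1 / (2 * μ) * ‖y - x‖ ^ 2 : ℝ) : EReal) + r y

/-- The smoothed objective `F_μ = g - h + r_μ`. -/
noncomputable def smoothedObj {d : ℕ} (g h : RVec d → ℝ) (r : RVec d → EReal) (μ : ℝ)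
    (x : RVec d) : EReal :=
  ((g x - h x : ℝ) : EReal) + moreauEnv r μ x

/-! ## The three alternative conditions on `r` -/

/-- `r` is (finite-valued and) Lipschitz continuous. -/
def RegLipschitz {d : ℕ} (r : RVec d → EReal) : Prop :=
  ∃ (ρ : RVec d → ℝ) (M : NNReal), LipschitzWith M ρ ∧ ∀ x, r x = (ρ x : EReal)

/-- `r` is bounded below by a real number. -/
def RegBddBelow {d : ℕ} (r : RVec d → EReal) : Prop := ∃ b : ℝ, ∀ x, (b : EReal) ≤ r x

/-- `r` is lower bounded and finite-valued on `ℝ^d`. -/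
def RegFinite {d : ℕ} (r : RVec d → EReal) : Prop := RegBddBelow r ∧ ∀ x, r x ≠ ⊤

/-- `g - h + r_μ` is level bounded for some `μ < 1`, `r` is finite-valued on some (nonempty)
compact set, and `r` is lower bounded. -/
def RegLevelBdd {d : ℕ} (g h : RVec d → ℝ) (r : RVec d → EReal) : Prop :=
  (∃ μ : ℝ, 0 < μ ∧ μ < 1 ∧
    ∀ a : ℝ, Bornology.IsBounded {x | smoothedObj g h r μ x ≤ (a : EReal)}) ∧
  (∃ S : Set (RVec d), IsCompact S ∧ S.Nonempty ∧ ∀ x ∈ S, r x ≠ ⊤) ∧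
  RegBddBelow r

/-! ## The stochastic oracle -/

/-- `g = E_ξ[g(·; ξ)]`, `h = E_ς[h(·; ς)]`, unbiased stochastic gradients `∇g(x; ξ)` and
stochastic subgradients `dh x ς ∈ ∂h(x; ς)`, and the variance of `∇g(x; ξ) - ∂h(x; ς)`
(`ξ` and `ς` independent) is at most `G²`. -/
structure IsStochOracle {d : ℕ} {Ξ Z : Type*} [MeasurableSpace Ξ] [MeasurableSpace Z]
    (g h : RVec d → ℝ) (pξ : Measure Ξ) (pς : Measure Z)
    (gS : Ξ → RVec d → ℝ) (hS : Z → RVec d → ℝ) (dh : RVec d → Z → RVec d) (G : ℝ) : Prop where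
  prob_g : IsProbabilityMeasure pξ
  prob_h : IsProbabilityMeasure pς
  mean_g : ∀ x, Integrable (fun ξ => gS ξ x) pξ ∧ ∫ ξ, gS ξ x ∂pξ = g x
  mean_h : ∀ x, Integrable (fun ς => hS ς x) pς ∧ ∫ ς, hS ς x ∂pς = h x
  diff_g : ∀ ξ, Differentiable ℝ (gS ξ)
  subgrad_h : ∀ x ς, dh x ς ∈ limitingSubdiff (fun y => ((hS ς y : ℝ) : EReal)) x
  meas_g : Measurable (fun q : RVec d × Ξ => gradient (gS q.2) q.1)
  meas_h : Measurable (fun q : RVec d × Z => dh q.1 q.2)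
  unbiased_g : ∀ x, Integrable (fun ξ => gradient (gS ξ) x) pξ ∧
    ∫ ξ, gradient (gS ξ) x ∂pξ = gradient g x
  unbiased_h : ∀ x, Integrable (fun ς => dh x ς) pς ∧ ∫ ς, dh x ς ∂pς = gradient h x
  variance : ∀ x, ∫⁻ q, ‖(gradient (gS q.1) x - dh x q.2) - (gradient g x - gradient h x)‖ₑ ^ 2
    ∂(pξ.prod pς) ≤ ENNReal.ofReal (G ^ 2)

/-! ## The algorithms -/

/-- The objective of one proximal step, for the simple term `‖x‖² / (2μ)`. -/
noncomputable def stepObj {d : ℕ} (μ γ η : ℝ) (x₁ y v x : RVec d) : ℝ :=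
  inner ℝ v x + 1 / (2 * μ) * ‖x‖ ^ 2 + γ / 2 * ‖x - x₁‖ ^ 2 + 1 / (2 * η) * ‖x - y‖ ^ 2

/-- The unique minimizer of `stepObj μ γ η x₁ y v` (see `proxStep_unique_min`). -/
noncomputable def proxStep {d : ℕ} (μ γ η : ℝ) (x₁ y v : RVec d) : RVec d :=
  (μ⁻¹ + γ + η⁻¹)⁻¹ • (γ • x₁ + η⁻¹ • y - v)

theorem proxStep_unique_min {d : ℕ} {μ γ η : ℝ} (hμ : 0 < μ) (hγ : 0 < γ) (hη : 0 < η)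
    (x₁ y v x : RVec d) (hx : x ≠ proxStep μ γ η x₁ y v) :
    stepObj μ γ η x₁ y v (proxStep μ γ η x₁ y v) < stepObj μ γ η x₁ y v x := by
  set z := proxStep μ γ η x₁ y v with hz
  have hM : 0 < μ⁻¹ + γ + η⁻¹ := by positivity
  have hv : v = γ • x₁ + η⁻¹ • y - (μ⁻¹ + γ + η⁻¹) • z := by
    rw [hz, proxStep, smul_smul, mul_inv_cancel₀ hM.ne', one_smul]; abel
  have hpos : 0 < ‖x - z‖ ^ 2 := by
    have : 0 < ‖x - z‖ := norm_pos_iff.mpr (sub_ne_zero.mpr hx)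
    positivity
  have key : stepObj μ γ η x₁ y v x - stepObj μ γ η x₁ y v z
      = (μ⁻¹ + γ + η⁻¹) / 2 * ‖x - z‖ ^ 2 := by
    have h1 : 1 / (2 * μ) = μ⁻¹ / 2 := by rw [one_div, mul_inv]; ring
    have h2 : 1 / (2 * η) = η⁻¹ / 2 := by rw [one_div, mul_inv]; ring
    unfold stepObj
    rw [h1, h2, hv]
    simp only [inner_sub_left, inner_add_left, real_inner_smul_left,
      ← real_inner_self_eq_norm_sq, inner_sub_right, real_inner_comm x x₁, real_inner_comm x y,
      real_inner_comm z x₁, real_inner_comm z y, real_inner_comm x z]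
    ring
  have : 0 < (μ⁻¹ + γ + η⁻¹) / 2 * ‖x - z‖ ^ 2 := by positivity
  linarith

/-- Stagewise DC meta-algorithm: `x_{k+1} = A k x_k` for `k ≥ 1`; the value at `k ≥ 1` is `x_k`
(and the value at `0` is unused). -/
def ssdc {d : ℕ} (A : ℕ → RVec d → RVec d) (x₁ : RVec d) : ℕ → RVec d
  | 0 => x₁
  | 1 => x₁
  | k + 2 => A (k + 1) (ssdc A x₁ (k + 1))

/-- Inner iterates of SPG with step sizes `η_t = 3 / (γ (t + 1))`; `sg t x` is the stochastic
gradient computed at `x` in iteration `t ≥ 1`, and the value at `t ≥ 1` is `x_t`. -/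
noncomputable def spgIter {d : ℕ} (μ γ : ℝ) (sg : ℕ → RVec d → RVec d) (x₁ : RVec d) :
    ℕ → RVec d
  | 0 => x₁
  | 1 => x₁
  | t + 2 => proxStep μ γ (3 / (γ * (((t + 1 : ℕ) : ℝ) + 1))) x₁
      (spgIter μ γ sg x₁ (t + 1)) (sg (t + 1) (spgIter μ γ sg x₁ (t + 1)))

/-- SPG (smooth option) run for `T` iterations, with its weighted average as output. -/
noncomputable def spg {d : ℕ} (μ γ : ℝ) (T : ℕ) (sg : ℕ → RVec d → RVec d) (x₁ : RVec d) :
    RVec d :=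
  (∑ t ∈ Finset.Icc 2 (T + 1), (t : ℝ))⁻¹ •
    ∑ t ∈ Finset.Icc 2 (T + 1), (t : ℝ) • spgIter μ γ sg x₁ t

/-- SSDC-SPG for `g + ‖·‖² / (2μ) - (h + R_μ)`: in iteration `t` of stage `k` the sample
`s (k, t) = (ξ, ς)` is drawn, and `μ⁻¹ • p x_k` is the subgradient of `R_μ` at `x_k`. -/
noncomputable def ssdcSPG {d : ℕ} {Ξ Z : Type*} (gS : Ξ → RVec d → ℝ) (dh : RVec d → Z → RVec d)
    (μ : ℝ) (p : RVec d → RVec d) (γ : ℕ → ℝ) (T : ℕ → ℕ) (x₁ : RVec d) (s : ℕ × ℕ → Ξ × Z) :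
    ℕ → RVec d :=
  ssdc (fun k xk => spg μ (γ k) (T k)
    (fun t x => gradient (gS (s (k, t)).1) x - (dh xk (s (k, t)).2 + μ⁻¹ • p xk)) xk) x₁

/-- Inner loop of SVRG: reference point `xref`, reference gradient `gref`, component indices
`i t` (`t ≥ 1`); the value at `t` is `x_t`. -/
noncomputable def svrgInner {d n : ℕ} (gc : Fin n → RVec d → ℝ) (μ γ η : ℝ)
    (x₁ xref gref : RVec d) (i : ℕ → Fin n) : ℕ → RVec d
  | 0 => xref
  | t + 1 => proxStep μ γ η x₁ (svrgInner gc μ γ η x₁ xref gref i t)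
      (gradient (gc (i (t + 1))) (svrgInner gc μ γ η x₁ xref gref i t)
        - gradient (gc (i (t + 1))) xref + gref)

/-- SVRG: the value at `s` is the reference point after `s` outer loops; `q` is the subgradient
at `x₁` of the subtracted convex function, and `i s t` are the component indices. -/
noncomputable def svrg {d n : ℕ} (g : RVec d → ℝ) (gc : Fin n → RVec d → ℝ) (μ γ η : ℝ) (T : ℕ)
    (q x₁ : RVec d) (i : ℕ → ℕ → Fin n) : ℕ → RVec d
  | 0 => x₁
  | s + 1 => (T : ℝ)⁻¹ • ∑ t ∈ Finset.Icc 1 T,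
      svrgInner gc μ γ η x₁ (svrg g gc μ γ η T q x₁ i s)
        (gradient g (svrg g gc μ γ η T q x₁ i s) - q) (i (s + 1)) t

/-- SSDC-SVRG for `g + ‖·‖² / (2μ) - (h + R_μ)`: stage `k` runs SVRG with `S k` outer loops of
`T k` inner iterations, and draws the component index `i (k, s, t)`. -/
noncomputable def ssdcSVRG {d n : ℕ} (g h : RVec d → ℝ) (gc : Fin n → RVec d → ℝ)
    (μ : ℝ) (p : RVec d → RVec d) (γ : ℕ → ℝ) (η : ℝ) (T S : ℕ → ℕ) (x₁ : RVec d)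
    (i : ℕ × ℕ × ℕ → Fin n) : ℕ → RVec d :=
  ssdc (fun k xk => svrg g gc μ (γ k) η (T k) (gradient h xk + μ⁻¹ • p xk) xk
    (fun s t => i (k, s, t)) (S k)) x₁

/-- Number of component gradients used by SSDC-SVRG in `K` stages: with `n` components in total,
each outer loop of stage `k` costs `n + T k`. -/
def svrgGradCount (n : ℕ) (T S : ℕ → ℕ) (K : ℕ) : ℕ :=
  ∑ k ∈ Finset.Icc 1 K, (n + T k) * S k

/-- SPG inner iteration numbers `3 L k / γ_k + 3`, rounded up. -/
noncomputable def spgT (L : ℝ) (γ : ℕ → ℝ) (k : ℕ) : ℕ := ⌈3 * L * k / γ k + 3⌉₊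

/-- SVRG outer loop numbers `⌈log₂ k⌉`. -/
noncomputable def svrgS (k : ℕ) : ℕ := ⌈Real.logb 2 k⌉₊

/-! ## Randomness and the quality of the output -/

/-- The samples `s i` are i.i.d. with law `q`, and `τ` is an independent random stage with
`P(τ = k) = k^α / ∑_{j=1}^K j^α` on `{1, …, K}`. -/
structure IsRandomRun {Ω S ι : Type*} [MeasurableSpace Ω] [MeasurableSpace S]
    (P : Measure Ω) (q : Measure S) (s : ι → Ω → S) (K : ℕ) (α : ℝ) (τ : Ω → ℕ) : Prop where
  prob : IsProbabilityMeasure P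
  meas : ∀ i, Measurable (s i)
  law : ∀ i, P.map (s i) = q
  indep : iIndepFun s P
  meas_stage : Measurable τ
  law_stage : ∀ k ∈ Finset.Icc 1 K, P {ω | τ ω = k} =
    ENNReal.ofReal ((k : ℝ) ^ α / ∑ j ∈ Finset.Icc 1 K, (j : ℝ) ^ α)
  indep_stage : IndepFun τ (fun ω i => s i ω) P

/-- Expectation of a `[0, ∞]`-valued function, as an upper integral; for measurable functions it
is the usual one (see `upperExp_eq`). -/
noncomputable def upperExp {Ω : Type*} [MeasurableSpace Ω] (P : Measure Ω)
    (f : Ω → ENNReal) : ENNReal :=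
  ⨅ (φ : Ω → ENNReal) (_ : Measurable φ) (_ : ∀ ω, f ω ≤ φ ω), ∫⁻ ω, φ ω ∂P

theorem upperExp_eq {Ω : Type*} [MeasurableSpace Ω] (P : Measure Ω) {f : Ω → ENNReal}
    (hf : Measurable f) : upperExp P f = ∫⁻ ω, f ω ∂P :=
  le_antisymm (iInf_le_of_le f (iInf_le_of_le hf (iInf_le_of_le (fun _ => le_rfl) le_rfl)))
    (le_iInf fun _ => le_iInf fun _ => le_iInf fun h => lintegral_mono h)

/-- `dist(∇h(w), ∇g(w) + ∂̂r(w))`, equal to `∞` if the Fréchet subdifferential is empty. -/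
noncomputable def critDist {d : ℕ} (g h : RVec d → ℝ) (r : RVec d → EReal) (w : RVec d) :
    ENNReal :=
  Metric.infEDist (gradient h w) ((fun v => gradient g w + v) '' frechetSubdiff r w)

/-- With `w = p x` for the random output `x`: `E ‖x - w‖ ≤ C ε` and
`E dist(∇h(w), ∇g(w) + ∂̂r(w)) ≤ C ε^ν`. -/
def IsNearlyCritical {d : ℕ} {Ω : Type*} [MeasurableSpace Ω] (P : Measure Ω)
    (g h : RVec d → ℝ) (r : RVec d → EReal) (p : RVec d → RVec d) (ν C ε : ℝ)
    (x : Ω → RVec d) : Prop :=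
  upperExp P (fun ω => ‖x ω - p (x ω)‖ₑ) ≤ ENNReal.ofReal (C * ε) ∧
  upperExp P (fun ω => critDist g h r (p (x ω))) ≤ ENNReal.ofReal (C * ε ^ ν)

/-- Guarantee for SSDC-SPG with `γ_k = 3 L k^β`, `T_k = 3 L k / γ_k + 3`, `μ = ε^m` and
`K = ⌈A / ε^e⌉` stages: the output is nearly critical, and the total number of iterations is
at most `C K^{2-β}` and at most `C / ε^ē`. The constant `C` and the range of `ε` depend neither
on the oracle nor on `ε`. -/
def SPGGuarantee {d : ℕ} (g h : RVec d → ℝ) (r : RVec d → EReal)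
    (L ν G α A : ℝ) (x₁ : RVec d) (β : ℝ) (m : ℕ) (e ebar : ℝ) : Prop :=
  ∃ C ε₀ : ℝ, 0 < C ∧ 0 < ε₀ ∧
    ∀ (Ξ : Type u₁) (Z : Type u₂) [MeasurableSpace Ξ] [MeasurableSpace Z]
      (pξ : Measure Ξ) (pς : Measure Z)
      (gS : Ξ → RVec d → ℝ) (hS : Z → RVec d → ℝ) (dh : RVec d → Z → RVec d),
      IsStochOracle g h pξ pς gS hS dh G →
    ∀ ε : ℝ, 0 < ε → ε ≤ ε₀ →
    ∀ (μ : ℝ) (γ : ℕ → ℝ) (T : ℕ → ℕ) (K : ℕ),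
      μ = ε ^ m → (∀ k, γ k = 3 * L * (k : ℝ) ^ β) → (∀ k, T k = spgT L γ k) →
      K = ⌈A / ε ^ e⌉₊ →
      (∀ (p : RVec d → RVec d), IsProxSelection r μ p →
        ∀ (Ω : Type u₃) [MeasurableSpace Ω] (P : Measure Ω) (s : ℕ × ℕ → Ω → Ξ × Z) (τ : Ω → ℕ),
          IsRandomRun P (pξ.prod pς) s K α τ →
          IsNearlyCritical P g h r p ν C ε
            (fun ω => ssdcSPG gS dh μ p γ T x₁ (fun q => s q ω) (τ ω))) ∧
      ((∑ k ∈ Finset.Icc 1 K, T k : ℕ) : ℝ) ≤ C * (K : ℝ) ^ (2 - β) ∧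
      ((∑ k ∈ Finset.Icc 1 K, T k : ℕ) : ℝ) ≤ C / ε ^ ebar

/-- Guarantee for SSDC-SVRG with `γ_k = c k^β`, step size `0.05 / L`,
`T_k ≥ max (2, 200 L / γ_k)`, `S_k = ⌈log₂ k⌉`, `μ = ε^m` and `K = ⌈A / ε^e⌉` stages: the output
is nearly critical and, when `T_k` is the least admissible integer, the total number of component
gradients is at most `C n / ε^e · (1 + log (1/ε))`, where `n = n₁ + n₂`. The constant `C` and the
range of `ε` depend neither on `n₁`, `n₂`, the components, nor on `ε`. -/
def SVRGGuarantee {d : ℕ} (g h : RVec d → ℝ) (r : RVec d → EReal)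
    (L ν α c A : ℝ) (x₁ : RVec d) (β : ℝ) (m : ℕ) (e : ℝ) : Prop :=
  ∃ C ε₀ : ℝ, 0 < C ∧ 0 < ε₀ ∧
    ∀ (n₁ n₂ : ℕ) (gc : Fin n₁ → RVec d → ℝ) (hc : Fin n₂ → RVec d → ℝ),
      0 < n₁ → 0 < n₂ →
      (∀ x, g x = (1 / (n₁ : ℝ)) * ∑ i, gc i x) → (∀ x, h x = (1 / (n₂ : ℝ)) * ∑ j, hc j x) →
      (∀ i, IsLSmooth L (gc i)) →
    ∀ ε : ℝ, 0 < ε → ε ≤ ε₀ →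
    ∀ (μ : ℝ) (γ : ℕ → ℝ) (T : ℕ → ℕ) (K : ℕ),
      μ = ε ^ m → (∀ k, γ k = c * (k : ℝ) ^ β) →
      (∀ k ∈ Finset.Icc 1 K, max 2 (200 * L / γ k) ≤ T k) →
      K = ⌈A / ε ^ e⌉₊ →
      (∀ (p : RVec d → RVec d), IsProxSelection r μ p →
        ∀ (Ω : Type u₄) [MeasurableSpace Ω] (P : Measure Ω) (i : ℕ × ℕ × ℕ → Ω → Fin n₁)
          (τ : Ω → ℕ),
          IsRandomRun P (uniformOn Set.univ) i K α τ →
          IsNearlyCritical P g h r p ν C ε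
            (fun ω => ssdcSVRG g h gc μ p γ (0.05 / L) T svrgS x₁ (fun q => i q ω) (τ ω))) ∧
      ((∀ k ∈ Finset.Icc 1 K, T k = ⌈max 2 (200 * L / γ k)⌉₊) →
        (svrgGradCount (n₁ + n₂) T svrgS K : ℝ) ≤
          C * ((n₁ + n₂ : ℕ) : ℝ) / ε ^ e * (1 + Real.log (1 / ε)))

/-! ## Smooth and convex functions -/

/-! Put U(x) = ∇g(x) − ∇h(x) + (x − p(x))/μ (`proxResidual`) and m = 1/μ + γ_k. Using p(x) as a
competitor in the envelope at y, smoothness of g and convexity of h give F_μ(y) ≤ F_μ(x) + ⟨U(x), y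
− x⟩ + (L + 1/(2μ))‖y − x‖². When 1/μ is a large multiple of L, the step z = x − U(x)/m therefore
lowers F_μ by ‖U(x)‖²/(4m), and a point y near z does so up to m‖y − z‖² (`descent_step`).

The exact minimizer of a stage subproblem is never needed. If g is linearized at x_k, the minimizer
is exactly z, and the solver outputs are compared with z directly; the curvature of g is a small
perturbation because 1/μ dominates L. For SVRG the comparison is pathwise: whatever indices are
drawn, every step lands within (24L/m)‖x_k − z‖ of z (`norm_svrgInner_sub_le`). For SPG it is in
mean square: E‖x_{k+1} − z‖² is at most a constant times (L² E‖U(x_k)/m‖² + G²/T_k)/m²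
(`meanSqLE_spg_sub`). The bound used for single iterates only has a factor 1/γ_k²; the factor 1/m²
comes from the weighted average, by summing the error recursion (`spgPotential`).

Both solvers thus satisfy E gap(x_{k+1}) + E‖U(x_k)‖²/(8m) ≤ E gap(x_k) + err_k, where gap is F_μ
minus its lower bound. For SPG err_k is of order G²μ/T_k, with bounded sum because T_k ≥ k^{1−β} and
μK^β is bounded; for SVRG only the first, empty stage contributes. Telescoping bounds E gap(x_k)
uniformly and ∑ E‖U(x_k)‖² by a multiple of 1/μ. Since P(τ = k) ≤ (α+1)/K, the output has E‖U(x_τ)‖²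
of order 1/(Kμ), hence of order ε^{2ν} by the choice of K (`isNearlyCritical_of_descent`).

Finally (x − p(x))/μ is a Fréchet subgradient of r at w = p(x), so the criticality distance at w is
at most ‖U(x)‖ + L‖x − w‖^ν + L‖x − w‖. The displacement ‖x − w‖ is O(μ) when r is Lipschitz, and
its square is O(μ)(gap(x) + 1) when r is bounded below, which explains μ = ε and μ = ε²
respectively. -/

theorem hasDerivAt_comp_line {d : ℕ} {f : RVec d → ℝ} (hf : Differentiable ℝ f)
    (x v : RVec d) (t : ℝ) :
    HasDerivAt (fun s : ℝ => f (x + s • v)) (inner ℝ (gradient f (x + t • v)) v) t := by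
  have h1 : HasDerivAt (fun s : ℝ => x + s • v) v t := by
    simpa using ((hasDerivAt_id t).smul_const v).const_add x
  have h2 := (hf (x + t • v)).hasGradientAt.hasFDerivAt
  have h3 := h2.comp_hasDerivAt t h1
  rw [InnerProductSpace.toDual_apply_apply] at h3
  exact h3

theorem IsLSmooth.le_quadratic {d : ℕ} {L : ℝ} {g : RVec d → ℝ} (hg : IsLSmooth L g)
    (x y : RVec d) :
    g y ≤ g x + inner ℝ (gradient g x) (y - x) + L * ‖y - x‖ ^ 2 := by
  obtain ⟨t, ht, hslope⟩ := exists_hasDerivAt_eq_slope (fun s : ℝ => g (x + s • (y - x)))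
    (fun s => inner ℝ (gradient g (x + s • (y - x))) (y - x)) (zero_lt_one)
    (fun s _ => (hasDerivAt_comp_line hg.1 x (y - x) s).continuousAt.continuousWithinAt)
    (fun s _ => hasDerivAt_comp_line hg.1 x (y - x) s)
  simp only [one_smul, zero_smul, add_zero, add_sub_cancel, sub_zero, div_one] at hslope
  have h1 : inner ℝ (gradient g (x + t • (y - x)) - gradient g x) (y - x)
      ≤ L * ‖y - x‖ ^ 2 := by
    refine (real_inner_le_norm _ _).trans ?_
    have h2 := hg.2 (x + t • (y - x)) x
    have h3 : ‖x + t • (y - x) - x‖ ≤ ‖y - x‖ := by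
      rw [add_sub_cancel_left, norm_smul, Real.norm_of_nonneg ht.1.le]
      exact mul_le_of_le_one_left (norm_nonneg _) ht.2.le
    have h4 : L * ‖x + t • (y - x) - x‖ ≤ L * ‖y - x‖ := by
      -- No sign of L is assumed; for negative L the Lipschitz bound forces x + t(y − x) = x, hence
      -- y = x.
      by_cases hL : 0 ≤ L
      · gcongr
      · have h5 : 0 ≤ L * ‖x + t • (y - x) - x‖ := (norm_nonneg _).trans h2
        have h6 : ‖x + t • (y - x) - x‖ = 0 := by
          by_contra hne
          have : 0 < ‖x + t • (y - x) - x‖ := lt_of_le_of_ne (norm_nonneg _) (Ne.symm hne)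
          nlinarith
        have h7 : ‖y - x‖ = 0 := by
          rw [add_sub_cancel_left, norm_smul, Real.norm_of_nonneg ht.1.le] at h6
          exact (mul_eq_zero.mp h6).resolve_left ht.1.ne'
        rw [h6, h7]
    nlinarith [norm_nonneg (y - x), norm_nonneg (gradient g (x + t • (y - x)) - gradient g x)]
  rw [inner_sub_left, hslope] at h1
  linarith

theorem ConvexOn.gradient_le {d : ℕ} {h : RVec d → ℝ} (hh : ConvexOn ℝ Set.univ h)
    (hd : Differentiable ℝ h) (x y : RVec d) :
    h x + inner ℝ (gradient h x) (y - x) ≤ h y := by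
  have hc : ConvexOn ℝ Set.univ (fun s : ℝ => h (x + s • (y - x))) := by
    refine ⟨convex_univ, fun a _ b _ p q hp hq hpq => ?_⟩
    have := hh.2 (Set.mem_univ (x + a • (y - x))) (Set.mem_univ (x + b • (y - x))) hp hq hpq
    have e : p • (x + a • (y - x)) + q • (x + b • (y - x))
        = x + (p • a + q • b) • (y - x) := by
      obtain rfl : q = 1 - p := by linarith
      simp only [smul_eq_mul]
      module
    rwa [e] at this
  have h0 := hasDerivAt_comp_line hd x (y - x) 0
  have := hc.le_slope_of_hasDerivAt (Set.mem_univ 0) (Set.mem_univ 1) zero_lt_one h0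
  simp only [slope_def_field, one_smul, zero_smul, add_zero, add_sub_cancel, sub_zero,
    div_one] at this
  linarith

theorem measurable_gradient {d : ℕ} (f : RVec d → ℝ) : Measurable (gradient f) :=
  (InnerProductSpace.toDual ℝ (RVec d)).symm.continuous.measurable.comp (measurable_fderiv ℝ f)

/-! ## The proximal map and the smoothed objective -/

/-- The value of the Moreau envelope at `x`, attained at `p x`. -/
noncomputable def proxVal {d : ℕ} (r : RVec d → EReal) (μ : ℝ) (p : RVec d → RVec d)
    (x : RVec d) : ℝ := 1 / (2 * μ) * ‖p x - x‖ ^ 2 + (r (p x)).toReal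

/-- The smoothed objective as a real function. -/
noncomputable def smoothVal {d : ℕ} (g h : RVec d → ℝ) (r : RVec d → EReal) (μ : ℝ)
    (p : RVec d → RVec d) (x : RVec d) : ℝ := g x - h x + proxVal r μ p x

/-- A supergradient of the smoothed objective. -/
noncomputable def proxResidual {d : ℕ} (g h : RVec d → ℝ) (μ : ℝ) (p : RVec d → RVec d)
    (x : RVec d) : RVec d := gradient g x - gradient h x + μ⁻¹ • (x - p x)

section Prox

variable {d : ℕ} {r : RVec d → EReal} {μ : ℝ} {p : RVec d → RVec d}

theorem IsProperLSC.prox_ne_top (hr : IsProperLSC r) (hp : IsProxSelection r μ p) (x : RVec d) :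
    r (p x) ≠ ⊤ := by
  obtain ⟨x₀, hx₀⟩ := hr.2.2
  intro htop
  have := hp.2 x x₀
  rw [htop, EReal.coe_add_top, top_le_iff] at this
  lift r x₀ to ℝ using ⟨hx₀, hr.2.1 x₀⟩ with a
  exact EReal.coe_ne_top _ this

theorem IsProperLSC.coe_prox (hr : IsProperLSC r) (hp : IsProxSelection r μ p) (x : RVec d) :
    (((r (p x)).toReal : ℝ) : EReal) = r (p x) :=
  EReal.coe_toReal (hr.prox_ne_top hp x) (hr.2.1 _)

theorem IsProperLSC.proxVal_le (hr : IsProperLSC r) (hp : IsProxSelection r μ p)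
    (x w : RVec d) : (proxVal r μ p x : EReal) ≤
      ((1 / (2 * μ) * ‖w - x‖ ^ 2 : ℝ) : EReal) + r w := by
  rw [proxVal, EReal.coe_add, hr.coe_prox hp]
  exact hp.2 x w

theorem IsProperLSC.proxVal_le_toReal (hr : IsProperLSC r) (hp : IsProxSelection r μ p)
    (x w : RVec d) (hw : r w ≠ ⊤) :
    proxVal r μ p x ≤ 1 / (2 * μ) * ‖w - x‖ ^ 2 + (r w).toReal := by
  have := hr.proxVal_le hp x w
  rw [← EReal.coe_toReal hw (hr.2.1 w)] at this
  exact_mod_cast this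

theorem IsProperLSC.moreauEnv_eq (hr : IsProperLSC r) (hp : IsProxSelection r μ p)
    (x : RVec d) : moreauEnv r μ x = (proxVal r μ p x : EReal) := by
  refine le_antisymm ((iInf_le _ (p x)).trans ?_) (le_iInf fun w => hr.proxVal_le hp x w)
  rw [proxVal, EReal.coe_add, hr.coe_prox hp]

theorem IsProperLSC.smoothedObj_eq (hr : IsProperLSC r) (hp : IsProxSelection r μ p)
    (g h : RVec d → ℝ) (x : RVec d) :
    smoothedObj g h r μ x = (smoothVal g h r μ p x : EReal) := by
  rw [smoothedObj, hr.moreauEnv_eq hp, smoothVal, EReal.coe_add]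

theorem IsProperLSC.measurable_smoothVal (hr : IsProperLSC r) (hp : IsProxSelection r μ p)
    {g h : RVec d → ℝ} (hg : Continuous g) (hh : Continuous h) :
    Measurable (smoothVal g h r μ p) := by
  have h1 : Measurable fun x => (r (p x)).toReal :=
    (hr.1.measurable.comp hp.1).ereal_toReal
  have h2 : Measurable fun x => 1 / (2 * μ) * ‖p x - x‖ ^ 2 :=
    ((hp.1.sub measurable_id).norm.pow_const 2).const_mul _
  exact (hg.measurable.sub hh.measurable).add (h2.add h1)

theorem IsProxSelection.measurable_proxResidual (hp : IsProxSelection r μ p) (g h : RVec d → ℝ) :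
    Measurable (proxResidual g h μ p) :=
  ((measurable_gradient g).sub (measurable_gradient h)).add
    ((measurable_id.sub hp.1).const_smul μ⁻¹)

theorem norm_sub_sq_expand {d : ℕ} (w x y : RVec d) :
    ‖w - y‖ ^ 2 = ‖w - x‖ ^ 2 + 2 * inner ℝ (x - w) (y - x) + ‖y - x‖ ^ 2 := by
  have : w - y = -((x - w) + (y - x)) := by abel
  rw [this, norm_neg, norm_add_sq_real, norm_sub_rev w x]

/-- The envelope at y is at most its value with the competitor p x, and expanding ‖p x − y‖² around
x produces the slope μ⁻¹(x − p x) and the curvature μ⁻¹/2. The concave part −h lies below its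
tangent, so it adds no curvature. -/
theorem IsProperLSC.smoothVal_le_quadratic (hr : IsProperLSC r) (hp : IsProxSelection r μ p)
    {g h : RVec d → ℝ} {L : ℝ} (hg : IsLSmooth L g)
    (hh : ConvexOn ℝ Set.univ h) (hd : Differentiable ℝ h) (x y : RVec d) :
    smoothVal g h r μ p y ≤ smoothVal g h r μ p x + inner ℝ (proxResidual g h μ p x) (y - x)
      + (L + μ⁻¹ / 2) * ‖y - x‖ ^ 2 := by
  have h1 := hg.le_quadratic x y
  have h2 := hh.gradient_le hd x y
  have h3 := hr.proxVal_le_toReal hp y (p x) (hr.prox_ne_top hp x)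
  rw [norm_sub_sq_expand (p x) x y] at h3
  have h4 : 1 / (2 * μ) = μ⁻¹ / 2 := by rw [one_div, mul_inv]; ring
  simp only [smoothVal, proxResidual, inner_add_left, inner_sub_left (gradient g x),
    real_inner_smul_left]
  have h5 : proxVal r μ p x = 1 / (2 * μ) * ‖p x - x‖ ^ 2 + (r (p x)).toReal := rfl
  rw [h4] at h3 h5
  nlinarith

/-- Optimality of p x bounds r below by an affine function of slope μ⁻¹(x − p x) minus ‖y − p
x‖²/(2μ). Within radius 2μδ this quadratic loss is at most δ‖y − p x‖. -/
theorem IsProperLSC.smul_mem_frechetSubdiff (hr : IsProperLSC r) (hp : IsProxSelection r μ p)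
    (hμ : 0 < μ) (x : RVec d) : μ⁻¹ • (x - p x) ∈ frechetSubdiff r (p x) := by
  refine ⟨hr.prox_ne_top hp x, hr.2.1 _, fun δ hδ => ?_⟩
  filter_upwards [Metric.ball_mem_nhds (p x) (show 0 < 2 * μ * δ by positivity)] with y hy
  by_cases hy' : r y = ⊤
  · rw [hy']; exact le_top
  have h1 := hr.proxVal_le_toReal hp x y hy'
  rw [← hr.coe_prox hp, ← EReal.coe_toReal hy' (hr.2.1 y)]
  rw [Metric.mem_ball, dist_eq_norm] at hy
  norm_cast
  have h4 : 1 / (2 * μ) = μ⁻¹ / 2 := by rw [one_div, mul_inv]; ring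
  rw [proxVal, norm_sub_rev y x, norm_sub_rev (p x) x, norm_sub_sq_expand x (p x) y, h4] at h1
  rw [real_inner_smul_left]
  have h5 : inner ℝ (p x - x) (y - p x) = -inner ℝ (x - p x) (y - p x) := by
    rw [← inner_neg_left, neg_sub]
  rw [h5] at h1
  have h6 : μ⁻¹ / 2 * ‖y - p x‖ ^ 2 ≤ δ * ‖y - p x‖ := by
    have : μ⁻¹ / 2 * ‖y - p x‖ ≤ δ := by
      rw [div_mul_eq_mul_div, div_le_iff₀ two_pos, inv_mul_le_iff₀ hμ]
      linarith
    nlinarith [norm_nonneg (y - p x)]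
  nlinarith

/-- The optimality defect at `p x`. -/
noncomputable def proxDefect {d : ℕ} (g h : RVec d → ℝ) (μ : ℝ) (p : RVec d → RVec d)
    (x : RVec d) : RVec d := gradient h (p x) - (gradient g (p x) + μ⁻¹ • (x - p x))

theorem IsProxSelection.measurable_proxDefect (hp : IsProxSelection r μ p)
    (g h : RVec d → ℝ) : Measurable (proxDefect g h μ p) :=
  ((measurable_gradient h).comp hp.1).sub (((measurable_gradient g).comp hp.1).add
    ((measurable_id.sub hp.1).const_smul μ⁻¹))

theorem IsProperLSC.critDist_le (hr : IsProperLSC r) (hp : IsProxSelection r μ p)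
    (hμ : 0 < μ) (g h : RVec d → ℝ) (x : RVec d) :
    critDist g h r (p x) ≤ ‖proxDefect g h μ p x‖ₑ := by
  refine (Metric.infEDist_le_edist_of_mem
    (Set.mem_image_of_mem _ (hr.smul_mem_frechetSubdiff hp hμ x))).trans_eq ?_
  rw [edist_eq_enorm_sub]; rfl

/-- The defect at p x is minus the residual at x, up to moving both gradients from x to p x. -/
theorem norm_proxDefect_le {g h : RVec d → ℝ} {L ν : ℝ} (hg : IsLSmooth L g)
    (hh : HasHolderGradient L ν h) (x : RVec d) :
    ‖proxDefect g h μ p x‖ ≤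
      ‖proxResidual g h μ p x‖ + L * ‖x - p x‖ ^ ν + L * ‖x - p x‖ := by
  have e : proxDefect g h μ p x = (gradient g x - gradient g (p x))
      - (gradient h x - gradient h (p x)) - proxResidual g h μ p x := by
    simp only [proxDefect, proxResidual]; abel
  rw [e]
  have h1 := hg.2 x (p x)
  have h2 := hh.2 x (p x)
  have h3 := norm_sub_le (gradient g x - gradient g (p x) - (gradient h x - gradient h (p x)))
    (proxResidual g h μ p x)
  have h4 := norm_sub_le (gradient g x - gradient g (p x)) (gradient h x - gradient h (p x))
  linarith

/-- Comparing p x with the competitor x gives ‖x − p x‖²/(2μ) ≤ ρ(x) − ρ(p x) ≤ M‖x − p x‖. -/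
theorem IsProperLSC.norm_sub_prox_le_of_lipschitz (hr : IsProperLSC r)
    (hp : IsProxSelection r μ p) (hμ : 0 < μ) {ρ : RVec d → ℝ} {M : NNReal}
    (hρ : LipschitzWith M ρ) (hrρ : ∀ x, r x = (ρ x : EReal)) (x : RVec d) :
    ‖x - p x‖ ≤ 2 * M * μ := by
  have h1 := hr.proxVal_le_toReal hp x x (by simp [hrρ])
  simp only [proxVal, hrρ, EReal.toReal_coe, sub_self, norm_zero, norm_sub_rev (p x) x] at h1
  have h2 := hρ.dist_le_mul x (p x)
  rw [Real.dist_eq, dist_eq_norm] at h2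
  have h3 := (le_abs_self _).trans h2
  have h4 : 1 / (2 * μ) * ‖x - p x‖ ^ 2 ≤ M * ‖x - p x‖ := by linarith
  rw [div_mul_eq_mul_div, one_mul, div_le_iff₀ (by positivity)] at h4
  by_contra! hlt
  have hpos : 0 < ‖x - p x‖ := lt_of_le_of_lt (by positivity) hlt
  nlinarith

end Prox

/-- One step of descent: `y` is close to the gradient step `x - m⁻¹ U`. -/
theorem descent_step {d : ℕ} {M m a b : ℝ} (hm : 0 < m) (hM : M ≤ 9 / 16 * m)
    (x y U : RVec d) (h : b ≤ a + inner ℝ U (y - x) + M * ‖y - x‖ ^ 2) :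
    b + 1 / (4 * m) * ‖U‖ ^ 2 ≤ a + m * ‖y - (x - m⁻¹ • U)‖ ^ 2 := by
  set e := y - (x - m⁻¹ • U) with he
  have h1 : y - x = e - m⁻¹ • U := by rw [he]; abel
  have h2 : b ≤ a + inner ℝ U (y - x) + 9 / 16 * m * ‖y - x‖ ^ 2 := by
    nlinarith [sq_nonneg ‖y - x‖]
  rw [h1, inner_sub_right, real_inner_smul_right, real_inner_self_eq_norm_sq,
    norm_sub_sq_real, real_inner_smul_right, norm_smul, Real.norm_of_nonneg (by positivity),
    real_inner_comm] at h2
  have h3 := abs_real_inner_le_norm e U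
  have h4 := neg_abs_le (inner ℝ e U)
  have h5 : 1 / (4 * m) = m⁻¹ / 4 := by rw [one_div, mul_inv]; ring
  -- With M = 9m/16 the expansion leaves −(7/16)m⁻¹‖U‖² − (1/8)⟨e, U⟩ + (9/16)m‖e‖². Young's
  -- inequality on the small cross term costs 1/16 of each square, leaving −3/8 and 5/8, which is
  -- more than enough.
  have h6 : ‖e‖ * ‖U‖ ≤ (m * ‖e‖ ^ 2 + m⁻¹ * ‖U‖ ^ 2) / 2 := by
    have h7 : 0 ≤ m⁻¹ * (m * ‖e‖ - ‖U‖) ^ 2 := by positivity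
    have h8 : m⁻¹ * (m * ‖e‖ - ‖U‖) ^ 2
        = (m⁻¹ * m) * (m * ‖e‖ ^ 2) - 2 * (m⁻¹ * m) * (‖e‖ * ‖U‖) + m⁻¹ * ‖U‖ ^ 2 := by ring
    rw [inv_mul_cancel₀ hm.ne'] at h8
    linarith
  have h9 : 9 / 16 * m * (‖e‖ ^ 2 - 2 * (m⁻¹ * inner ℝ e U) + (m⁻¹ * ‖U‖) ^ 2)
      = 9 / 16 * m * ‖e‖ ^ 2 - 9 / 8 * (m * m⁻¹) * inner ℝ e U
        + 9 / 16 * (m * m⁻¹) * (m⁻¹ * ‖U‖ ^ 2) := by ring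
  rw [h9, mul_inv_cancel₀ hm.ne'] at h2
  rw [h5]
  have h10 : 0 ≤ m * ‖e‖ ^ 2 := by positivity
  have h11 : 0 ≤ m⁻¹ * ‖U‖ ^ 2 := by positivity
  nlinarith

/-! ## Proximal steps around the reference point `x - m⁻¹ U` -/

section Steps

variable {d : ℕ}

/-- The condition on z says that z minimizes the stage model with linear term c and no proximity to
y. Subtracting the two optimality conditions gives an exact recursion for the distance to z, driven
only by the error v − c of the linear term. -/
theorem proxStep_sub {μ γ η : ℝ} (hμ : 0 < μ) (hγ : 0 < γ) (hη : 0 < η) {x y v z c : RVec d}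
    (hz : (μ⁻¹ + γ) • z = γ • x - c) :
    (μ⁻¹ + γ + η⁻¹) • (proxStep μ γ η x y v - z) = η⁻¹ • (y - z) - (v - c) := by
  have hM : 0 < μ⁻¹ + γ + η⁻¹ := by positivity
  rw [smul_sub, proxStep, smul_smul, mul_inv_cancel₀ hM.ne', one_smul, add_smul _ η⁻¹, hz]
  module

/-- The gradient step is the minimizer of the stage model with g linearized at x, so `proxStep_sub`
applies with it as reference point. -/
theorem smul_gradient_step {g h : RVec d → ℝ} {μ γ : ℝ} (hμ : 0 < μ) (hγ : 0 < γ)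
    (p : RVec d → RVec d) (x : RVec d) :
    (μ⁻¹ + γ) • (x - (μ⁻¹ + γ)⁻¹ • proxResidual g h μ p x)
      = γ • x - (gradient g x - (gradient h x + μ⁻¹ • p x)) := by
  have hM : 0 < μ⁻¹ + γ := by positivity
  rw [smul_sub, smul_smul, mul_inv_cancel₀ hM.ne', one_smul, proxResidual]
  module

theorem IsLSmooth.average {n : ℕ} {L : ℝ} (hn : 0 < n) {g : RVec d → ℝ}
    {gc : Fin n → RVec d → ℝ} (hg : ∀ x, g x = (1 / (n : ℝ)) * ∑ i, gc i x)
    (hs : ∀ i, IsLSmooth L (gc i)) : IsLSmooth L g := by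
  have hn' : (0 : ℝ) < n := by exact_mod_cast hn
  have hgrad : ∀ x, HasGradientAt g ((1 / (n : ℝ)) • ∑ i, gradient (gc i) x) x := by
    intro x
    have h1 : HasFDerivAt (fun x => (1 / (n : ℝ)) * ∑ i, gc i x)
        ((1 / (n : ℝ)) • ∑ i, fderiv ℝ (gc i) x) x :=
      (HasFDerivAt.fun_sum fun i _ => ((hs i).1 x).hasFDerivAt).const_mul _
    have h2 : InnerProductSpace.toDual ℝ (RVec d) ((1 / (n : ℝ)) • ∑ i, gradient (gc i) x)
        = (1 / (n : ℝ)) • ∑ i, fderiv ℝ (gc i) x := by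
      rw [map_smulₛₗ, map_sum]
      simp [gradient]
    rw [hasGradientAt_iff_hasFDerivAt, funext hg, h2]
    exact h1
  refine ⟨fun x => (hgrad x).differentiableAt, fun x y => ?_⟩
  rw [(hgrad x).gradient, (hgrad y).gradient, ← smul_sub, ← Finset.sum_sub_distrib, norm_smul,
    Real.norm_of_nonneg (by positivity), one_div, inv_mul_le_iff₀ hn']
  refine (norm_sum_le_of_le _ fun i _ => (hs i).2 x y).trans_eq ?_
  simp

variable {n : ℕ} {g h : RVec d → ℝ} {gc : Fin n → RVec d → ℝ} {L μ γ u : ℝ}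
  {x z q : RVec d}

/-- If the iterate, the reference point and x are all within u of z, the gradient difference of the
drawn component and the full gradient difference are each at most 2Lu. With η⁻¹ = 20L the recursion
gives (m + 20L)‖y' − z‖ ≤ (20 + 4)Lu, for any index drawn. As 24L ≤ m, the ball of radius u is never
left. -/
theorem norm_svrgInner_sub_le (hL : 0 < L) (hμ : 0 < μ) (hγ : 0 < γ)
    (hm : 24 * L ≤ μ⁻¹ + γ) (hg : IsLSmooth L g) (hs : ∀ i, IsLSmooth L (gc i))
    (hz : (μ⁻¹ + γ) • z = γ • x - (gradient g x - q)) (hx : ‖x - z‖ ≤ u)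
    {xref : RVec d} (hxref : ‖xref - z‖ ≤ u) (i : ℕ → Fin n) (t : ℕ) :
    ‖svrgInner gc μ γ (0.05 / L) x xref (gradient g xref - q) i t - z‖ ≤ u ∧
    ‖svrgInner gc μ γ (0.05 / L) x xref (gradient g xref - q) i (t + 1) - z‖
      ≤ 24 * L / (μ⁻¹ + γ) * u := by
  have hu : 0 ≤ u := (norm_nonneg _).trans hx
  have hμ' : 0 < μ⁻¹ := inv_pos.mpr hμ
  have hm0 : 0 < μ⁻¹ + γ := by positivity
  have key : ∀ t, ‖svrgInner gc μ γ (0.05 / L) x xref (gradient g xref - q) i t - z‖ ≤ u →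
      ‖svrgInner gc μ γ (0.05 / L) x xref (gradient g xref - q) i (t + 1) - z‖
        ≤ 24 * L / (μ⁻¹ + γ) * u := by
    intro t ht
    have h1 := proxStep_sub hμ hγ (show 0 < 0.05 / L by positivity)
      (y := svrgInner gc μ γ (0.05 / L) x xref (gradient g xref - q) i t)
      (v := gradient (gc (i (t + 1)))
          (svrgInner gc μ γ (0.05 / L) x xref (gradient g xref - q) i t)
        - gradient (gc (i (t + 1))) xref + (gradient g xref - q)) hz
    have hη : (0.05 / L)⁻¹ = 20 * L := by rw [inv_div]; norm_num; ring
    rw [svrgInner]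
    set y := svrgInner gc μ γ (0.05 / L) x xref (gradient g xref - q) i t
    set y' := proxStep μ γ (0.05 / L) x y (gradient (gc (i (t + 1))) y
        - gradient (gc (i (t + 1))) xref + (gradient g xref - q))
    rw [hη] at h1
    have h2 : ‖(μ⁻¹ + γ + 20 * L) • (y' - z)‖ = (μ⁻¹ + γ + 20 * L) * ‖y' - z‖ := by
      rw [norm_smul, Real.norm_of_nonneg (by positivity)]
    have h3 : ‖(20 * L) • (y - z)‖ = 20 * L * ‖y - z‖ := by
      rw [norm_smul, Real.norm_of_nonneg (by positivity)]
    have h4 : gradient (gc (i (t + 1))) y - gradient (gc (i (t + 1))) xref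
        + (gradient g xref - q) - (gradient g x - q)
        = (gradient (gc (i (t + 1))) y - gradient (gc (i (t + 1))) xref)
          + (gradient g xref - gradient g x) := by abel
    have h5 : ‖y - xref‖ ≤ 2 * u := by
      have := norm_sub_le (y - z) (xref - z)
      rw [sub_sub_sub_cancel_right] at this; linarith
    have h6 : ‖xref - x‖ ≤ 2 * u := by
      have := norm_sub_le (xref - z) (x - z)
      rw [sub_sub_sub_cancel_right] at this; linarith
    have h7 : ‖(gradient (gc (i (t + 1))) y - gradient (gc (i (t + 1))) xref)
          + (gradient g xref - gradient g x)‖ ≤ 4 * L * u := by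
      refine (norm_add_le _ _).trans ?_
      have h8 := (hs (i (t + 1))).2 y xref
      have h9 := hg.2 xref x
      nlinarith
    rw [h4] at h1
    have h10 : (μ⁻¹ + γ + 20 * L) * ‖y' - z‖ ≤ 24 * L * u := by
      rw [← h2, h1]
      refine (norm_sub_le _ _).trans ?_
      rw [h3]
      nlinarith
    rw [div_mul_eq_mul_div, le_div_iff₀ hm0]
    nlinarith [norm_nonneg (y' - z), mul_nonneg hL.le (norm_nonneg (y' - z))]
  have hle : 24 * L / (μ⁻¹ + γ) * u ≤ u :=
    mul_le_of_le_one_left hu ((div_le_one hm0).mpr hm)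
  have all : ∀ t, ‖svrgInner gc μ γ (0.05 / L) x xref (gradient g xref - q) i t - z‖ ≤ u := by
    intro t
    induction t with
    | zero => exact hxref
    | succ t ih => exact (key t ih).trans hle
  exact ⟨all t, key t (all t)⟩

/-- Averaging stays in the ball around z, so the inner bound carries over to every outer loop. One
loop already gives the factor 24L/m. -/
theorem norm_svrg_sub_le (hL : 0 < L) (hμ : 0 < μ) (hγ : 0 < γ)
    (hm : 24 * L ≤ μ⁻¹ + γ) (hg : IsLSmooth L g) (hs : ∀ i, IsLSmooth L (gc i))
    (hz : (μ⁻¹ + γ) • z = γ • x - (gradient g x - q)) (hx : ‖x - z‖ ≤ u) {T : ℕ} (hT : 0 < T)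
    (i : ℕ → ℕ → Fin n) (s : ℕ) :
    ‖svrg g gc μ γ (0.05 / L) T q x i s - z‖ ≤ u ∧
    ‖svrg g gc μ γ (0.05 / L) T q x i (s + 1) - z‖ ≤ 24 * L / (μ⁻¹ + γ) * u := by
  have hu : 0 ≤ u := (norm_nonneg _).trans hx
  have hm0 : 0 < μ⁻¹ + γ := by positivity
  have key : ∀ s, ‖svrg g gc μ γ (0.05 / L) T q x i s - z‖ ≤ u →
      ‖svrg g gc μ γ (0.05 / L) T q x i (s + 1) - z‖ ≤ 24 * L / (μ⁻¹ + γ) * u := by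
    intro s hsu
    have hT' : (0 : ℝ) < T := by exact_mod_cast hT
    rw [svrg]
    set y := svrgInner gc μ γ (0.05 / L) x (svrg g gc μ γ (0.05 / L) T q x i s)
      (gradient g (svrg g gc μ γ (0.05 / L) T q x i s) - q) (i (s + 1)) with hy
    have e : (T : ℝ)⁻¹ • ∑ t ∈ Finset.Icc 1 T, y t - z
        = (T : ℝ)⁻¹ • ∑ t ∈ Finset.Icc 1 T, (y t - z) := by
      rw [Finset.sum_sub_distrib, smul_sub, Finset.sum_const, Nat.card_Icc,
        Nat.add_sub_cancel, ← Nat.cast_smul_eq_nsmul ℝ, smul_smul, inv_mul_cancel₀ hT'.ne',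
        one_smul]
    rw [e, norm_smul, Real.norm_of_nonneg (by positivity), inv_mul_le_iff₀ hT']
    refine (norm_sum_le_of_le (f := fun t => y t - z)
      (n := fun _ => 24 * L / (μ⁻¹ + γ) * u) _ fun t ht => ?_).trans_eq (by simp)
    obtain ⟨k, rfl⟩ : ∃ k, t = k + 1 := ⟨t - 1, by have := (Finset.mem_Icc.mp ht).1; omega⟩
    exact (norm_svrgInner_sub_le hL hμ hγ hm hg hs hz hx hsu (i (s + 1)) k).2
  have all : ∀ s, ‖svrg g gc μ γ (0.05 / L) T q x i s - z‖ ≤ u := by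
    intro s
    induction s with
    | zero => exact hx
    | succ s ih =>
      exact (key s ih).trans (mul_le_of_le_one_left hu ((div_le_one hm0).mpr hm))
  exact ⟨all s, key s (all s)⟩

end Steps

/-! ## Mean-square bounds -/

/-- `E ‖X‖² ≤ c`. -/
def MeanSqLE {Ω : Type*} {mΩ : MeasurableSpace Ω} {d : ℕ} (P : Measure Ω) (X : Ω → RVec d)
    (c : ℝ) : Prop := ∫⁻ ω, ‖X ω‖ₑ ^ 2 ∂P ≤ ENNReal.ofReal c

section MeanSq

variable {Ω : Type*} {mΩ : MeasurableSpace Ω} {d : ℕ} {P : Measure Ω}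

theorem enorm_sq_eq_ofReal (x : RVec d) : ‖x‖ₑ ^ 2 = ENNReal.ofReal (‖x‖ ^ 2) := by
  rw [ENNReal.ofReal_pow (norm_nonneg _), ofReal_norm]

theorem MeanSqLE.mono {X : Ω → RVec d} {c c' : ℝ} (h : MeanSqLE P X c) (hc : c ≤ c') :
    MeanSqLE P X c' := h.trans (ENNReal.ofReal_le_ofReal hc)

theorem MeanSqLE.of_le_add {X Y Z : Ω → RVec d} {a b y z : ℝ} (ha : 0 ≤ a) (hb : 0 ≤ b)
    (hy : 0 ≤ y) (hz : 0 ≤ z) (hYm : Measurable Y) (hY : MeanSqLE P Y y) (hZ : MeanSqLE P Z z)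
    (h : ∀ ω, ‖X ω‖ ^ 2 ≤ a * ‖Y ω‖ ^ 2 + b * ‖Z ω‖ ^ 2) : MeanSqLE P X (a * y + b * z) := by
  unfold MeanSqLE at *
  calc ∫⁻ ω, ‖X ω‖ₑ ^ 2 ∂P
      ≤ ∫⁻ ω, (ENNReal.ofReal a * ‖Y ω‖ₑ ^ 2 + ENNReal.ofReal b * ‖Z ω‖ₑ ^ 2) ∂P := by
        refine lintegral_mono fun ω => ?_
        simp only [enorm_sq_eq_ofReal]
        rw [← ENNReal.ofReal_mul ha, ← ENNReal.ofReal_mul hb,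
          ← ENNReal.ofReal_add (by positivity) (by positivity)]
        exact ENNReal.ofReal_le_ofReal (h ω)
    _ = ENNReal.ofReal a * ∫⁻ ω, ‖Y ω‖ₑ ^ 2 ∂P + ENNReal.ofReal b * ∫⁻ ω, ‖Z ω‖ₑ ^ 2 ∂P := by
        rw [lintegral_add_left ((hYm.enorm.pow_const 2).const_mul _),
          lintegral_const_mul _ (hYm.enorm.pow_const 2),
          lintegral_const_mul' _ _ ENNReal.ofReal_ne_top]
    _ ≤ ENNReal.ofReal (a * y + b * z) := by
        rw [ENNReal.ofReal_add (by positivity) (by positivity), ENNReal.ofReal_mul ha,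
          ENNReal.ofReal_mul hb]
        gcongr

theorem MeanSqLE.of_le_mul {X Y : Ω → RVec d} {a y : ℝ} (ha : 0 ≤ a)
    (hY : MeanSqLE P Y y) (h : ∀ ω, ‖X ω‖ ^ 2 ≤ a * ‖Y ω‖ ^ 2) : MeanSqLE P X (a * y) := by
  unfold MeanSqLE at *
  calc ∫⁻ ω, ‖X ω‖ₑ ^ 2 ∂P ≤ ∫⁻ ω, ENNReal.ofReal a * ‖Y ω‖ₑ ^ 2 ∂P := by
        refine lintegral_mono fun ω => ?_
        simp only [enorm_sq_eq_ofReal]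
        rw [← ENNReal.ofReal_mul ha]
        exact ENNReal.ofReal_le_ofReal (h ω)
    _ ≤ _ := by
        rw [lintegral_const_mul' _ _ ENNReal.ofReal_ne_top, ENNReal.ofReal_mul ha]
        gcongr

/-- A centred perturbation with second moment at most `σ2` increases the second moment by at
most `σ2`. -/
theorem lintegral_enorm_add_sq_le {S : Type*} [MeasurableSpace S] {q : Measure S}
    [IsProbabilityMeasure q] {f : S → RVec d} (hf : Integrable f q) (hf0 : ∫ s, f s ∂q = 0)
    {σ2 : ℝ} (hσ2 : MeanSqLE q f σ2) (a : RVec d) :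
    ∫⁻ s, ‖a + f s‖ₑ ^ 2 ∂q ≤ ‖a‖ₑ ^ 2 + ENNReal.ofReal σ2 := by
  have hfin : ∫⁻ s, ‖f s‖ₑ ^ 2 ∂q < ⊤ := lt_of_le_of_lt hσ2 ENNReal.ofReal_lt_top
  have hsq : Integrable (fun s => ‖f s‖ ^ 2) q := by
    refine ⟨hf.1.norm.pow 2, ?_⟩
    rw [HasFiniteIntegral]
    refine lt_of_le_of_lt (lintegral_mono fun s => ?_) hfin
    rw [enorm_pow, enorm_norm]
  have hin : Integrable (fun s => inner ℝ a (f s)) q := hf.const_inner a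
  have hexp : ∀ s, ‖a + f s‖ ^ 2 = ‖a‖ ^ 2 + 2 * inner ℝ a (f s) + ‖f s‖ ^ 2 :=
    fun s => norm_add_sq_real _ _
  have hint : Integrable (fun s => ‖a + f s‖ ^ 2) q := by
    simp only [hexp]
    exact ((integrable_const _).add (hin.const_mul 2)).add hsq
  have e1 : ∫⁻ s, ‖a + f s‖ₑ ^ 2 ∂q = ENNReal.ofReal (∫ s, ‖a + f s‖ ^ 2 ∂q) := by
    rw [ofReal_integral_eq_lintegral_ofReal hint (ae_of_all _ fun s => by positivity)]
    simp only [enorm_sq_eq_ofReal]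
  have e2 : ∫⁻ s, ‖f s‖ₑ ^ 2 ∂q = ENNReal.ofReal (∫ s, ‖f s‖ ^ 2 ∂q) := by
    rw [ofReal_integral_eq_lintegral_ofReal hsq (ae_of_all _ fun s => by positivity)]
    simp only [enorm_sq_eq_ofReal]
  have e3 : ∫ s, ‖a + f s‖ ^ 2 ∂q = ‖a‖ ^ 2 + ∫ s, ‖f s‖ ^ 2 ∂q := by
    simp only [hexp]
    have h1 : Integrable (fun s => ‖a‖ ^ 2 + 2 * inner ℝ a (f s)) q :=
      (integrable_const _).add (hin.const_mul 2)
    rw [integral_add h1 hsq, integral_add (integrable_const _) (hin.const_mul 2),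
      integral_const_mul, integral_inner hf, hf0]
    simp
  rw [e1, e3, ENNReal.ofReal_add (by positivity) (by positivity), enorm_sq_eq_ofReal, ← e2]
  gcongr
  exact hσ2

theorem lintegral_comp_of_indep {β S : Type*} [MeasurableSpace β] [MeasurableSpace S]
    {Ω : Type*} {F mΩ : MeasurableSpace Ω} {P : Measure Ω}
    [IsProbabilityMeasure P] {q : Measure S} (hF : F ≤ mΩ)
    {Y : Ω → β} (hY : Measurable[F] Y) {s : Ω → S} (hs : Measurable s) (hq : P.map s = q)
    (hind : Indep F (MeasurableSpace.comap s inferInstance) P) {f : β × S → ENNReal}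
    (hf : Measurable f) :
    ∫⁻ ω, f (Y ω, s ω) ∂P = ∫⁻ ω, ∫⁻ t, f (Y ω, t) ∂q ∂P := by
  have hY' : Measurable Y := hY.mono hF le_rfl
  have hI : IndepFun Y s P := indep_of_indep_of_le_left hind hY.comap_le
  have hprob : IsProbabilityMeasure q := hq ▸ Measure.isProbabilityMeasure_map hs.aemeasurable
  have hmap := (indepFun_iff_map_prod_eq_prod_map_map hY'.aemeasurable hs.aemeasurable).mp hI
  rw [← lintegral_map hf (hY'.prodMk hs), hmap, hq, lintegral_prod _ hf.aemeasurable,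
    lintegral_map hf.lintegral_prod_right' hY']

/-- Independence allows X and Y to be frozen while the fresh sample is integrated out. For frozen
values the noise is centred, so the cross term vanishes and second moments add. -/
theorem MeanSqLE.add_noise {β S : Type*} [MeasurableSpace β] [MeasurableSpace S]
    {Ω : Type*} {F mΩ : MeasurableSpace Ω} {P : Measure Ω}
    [IsProbabilityMeasure P] {q : Measure S} (hF : F ≤ mΩ)
    {X : Ω → RVec d} {Y : Ω → β} (hX : Measurable[F] X) (hY : Measurable[F] Y)
    {s : Ω → S} (hs : Measurable s) (hq : P.map s = q)
    (hind : Indep F (MeasurableSpace.comap s inferInstance) P) {f : β × S → RVec d}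
    (hf : Measurable f) (hfi : ∀ b, Integrable (fun t => f (b, t)) q)
    (hf0 : ∀ b, ∫ t, f (b, t) ∂q = 0) {σ2 c : ℝ} (hσ : 0 ≤ σ2) (hc : 0 ≤ c)
    (hσ2 : ∀ b, MeanSqLE q (fun t => f (b, t)) σ2) (hXc : MeanSqLE P X c) :
    MeanSqLE P (fun ω => X ω + f (Y ω, s ω)) (c + σ2) := by
  have hprob : IsProbabilityMeasure q := hq ▸ Measure.isProbabilityMeasure_map hs.aemeasurable
  have hXY : Measurable[F] fun ω => (X ω, Y ω) := hX.prodMk hY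
  have h1 := lintegral_comp_of_indep hF hXY hs hq hind
    (f := fun w : (RVec d × β) × S => ‖w.1.1 + f (w.1.2, w.2)‖ₑ ^ 2)
    (((measurable_fst.fst.add
      (hf.comp (measurable_fst.snd.prodMk measurable_snd))).enorm).pow_const 2)
  unfold MeanSqLE
  rw [h1, ENNReal.ofReal_add hc hσ]
  calc _ ≤ ∫⁻ ω, (‖X ω‖ₑ ^ 2 + ENNReal.ofReal σ2) ∂P :=
        lintegral_mono fun ω =>
          lintegral_enorm_add_sq_le (hfi (Y ω)) (hf0 (Y ω)) (hσ2 (Y ω)) (X ω)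
    _ = ∫⁻ ω, ‖X ω‖ₑ ^ 2 ∂P + ENNReal.ofReal σ2 := by
        rw [lintegral_add_right _ measurable_const]; simp
    _ ≤ _ := by gcongr; exact hXc

end MeanSq

/-! ## The stochastic gradient noise -/

theorem enorm_integral_sq_le {S : Type*} [MeasurableSpace S] {q : Measure S}
    [IsProbabilityMeasure q] {d : ℕ} {f : S → RVec d} (hf : Integrable f q) :
    ‖∫ s, f s ∂q‖ₑ ^ 2 ≤ ∫⁻ s, ‖f s‖ₑ ^ 2 ∂q := by
  have h1 : eLpNorm f 1 q ≤ eLpNorm f 2 q :=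
    eLpNorm_le_eLpNorm_of_exponent_le (by norm_num) hf.1
  have h2 : eLpNorm f 2 q ^ 2 = ∫⁻ s, ‖f s‖ₑ ^ 2 ∂q := by
    have := eLpNorm_nnreal_pow_eq_lintegral (f := f) (μ := q) (p := 2) (by norm_num)
    norm_num at this
    exact_mod_cast this
  rw [← h2]
  gcongr
  refine (enorm_integral_le_lintegral_enorm f).trans ?_
  rw [← eLpNorm_one_eq_lintegral_enorm]
  exact h1

section Noise

variable {d : ℕ} {Ξ Z : Type*} [MeasurableSpace Ξ] [MeasurableSpace Z]
    {g h : RVec d → ℝ} {pξ : Measure Ξ} {pς : Measure Z}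
    {gS : Ξ → RVec d → ℝ} {hS : Z → RVec d → ℝ} {dh : RVec d → Z → RVec d} {G : ℝ}

/-- The error of the stochastic gradient with the `g`-part at `b.2` and the `h`-part at `b.1`. -/
noncomputable def gradNoise (g h : RVec d → ℝ) (gS : Ξ → RVec d → ℝ) (dh : RVec d → Z → RVec d)
    (w : (RVec d × RVec d) × (Ξ × Z)) : RVec d :=
  (gradient (gS w.2.1) w.1.2 - gradient g w.1.2) - (dh w.1.1 w.2.2 - gradient h w.1.1)

theorem IsStochOracle.measurable_gradNoise (ho : IsStochOracle g h pξ pς gS hS dh G) :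
    Measurable (gradNoise g h gS dh) := by
  have h1 : Measurable fun w : (RVec d × RVec d) × (Ξ × Z) => gradient (gS w.2.1) w.1.2 :=
    ho.meas_g.comp (measurable_fst.snd.prodMk measurable_snd.fst)
  have h2 : Measurable fun w : (RVec d × RVec d) × (Ξ × Z) => dh w.1.1 w.2.2 :=
    ho.meas_h.comp (measurable_fst.fst.prodMk measurable_snd.snd)
  exact (h1.sub ((measurable_gradient g).comp measurable_fst.snd)).sub
    (h2.sub ((measurable_gradient h).comp measurable_fst.fst))

theorem IsStochOracle.integrable_gradNoise (ho : IsStochOracle g h pξ pς gS hS dh G)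
    (b : RVec d × RVec d) : Integrable (fun w => gradNoise g h gS dh (b, w)) (pξ.prod pς) ∧
      ∫ w, gradNoise g h gS dh (b, w) ∂(pξ.prod pς) = 0 := by
  have := ho.prob_g
  have := ho.prob_h
  have h1 : Integrable (fun ξ => gradient (gS ξ) b.2 - gradient g b.2) pξ :=
    (ho.unbiased_g b.2).1.sub (integrable_const _)
  have h2 : Integrable (fun ς => dh b.1 ς - gradient h b.1) pς :=
    (ho.unbiased_h b.1).1.sub (integrable_const _)
  have h1' : Integrable (fun w : Ξ × Z => gradient (gS w.1) b.2 - gradient g b.2) (pξ.prod pς) :=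
    h1.comp_fst pς
  have h2' : Integrable (fun w : Ξ × Z => dh b.1 w.2 - gradient h b.1) (pξ.prod pς) :=
    h2.comp_snd pξ
  refine ⟨h1'.sub h2', ?_⟩
  simp only [gradNoise]
  rw [integral_sub h1' h2', integral_fun_fst (fun ξ => gradient (gS ξ) b.2 - gradient g b.2),
    integral_fun_snd (fun ς => dh b.1 ς - gradient h b.1),
    integral_sub (ho.unbiased_g b.2).1 (integrable_const _),
    integral_sub (ho.unbiased_h b.1).1 (integrable_const _), (ho.unbiased_g b.2).2,
    (ho.unbiased_h b.1).2]
  simp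

/-- The oracle only bounds the joint noise with both parts at one point. Integrating out one of the
independent samples removes the centred part that depends on it, and Jensen's inequality bounds the
remaining part by the joint second moment. -/
theorem IsStochOracle.meanSq_parts (ho : IsStochOracle g h pξ pς gS hS dh G) (x : RVec d) :
    MeanSqLE pξ (fun ξ => gradient (gS ξ) x - gradient g x) (G ^ 2) ∧
    MeanSqLE pς (fun ς => dh x ς - gradient h x) (G ^ 2) := by
  have := ho.prob_g
  have := ho.prob_h
  have h1 : Integrable (fun ξ => gradient (gS ξ) x - gradient g x) pξ :=
    (ho.unbiased_g x).1.sub (integrable_const _)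
  have h2 : Integrable (fun ς => dh x ς - gradient h x) pς :=
    (ho.unbiased_h x).1.sub (integrable_const _)
  have h10 : ∫ ξ, (gradient (gS ξ) x - gradient g x) ∂pξ = 0 := by
    rw [integral_sub (ho.unbiased_g x).1 (integrable_const _), (ho.unbiased_g x).2]; simp
  have h20 : ∫ ς, (dh x ς - gradient h x) ∂pς = 0 := by
    rw [integral_sub (ho.unbiased_h x).1 (integrable_const _), (ho.unbiased_h x).2]; simp
  have hm : Measurable fun w : Ξ × Z => ‖gradNoise g h gS dh ((x, x), w)‖ₑ ^ 2 :=
    (ho.measurable_gradNoise.comp measurable_prodMk_left).enorm.pow_const 2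
  have hv : ∫⁻ w, ‖gradNoise g h gS dh ((x, x), w)‖ₑ ^ 2 ∂(pξ.prod pς)
      ≤ ENNReal.ofReal (G ^ 2) := by
    refine le_trans (le_of_eq (lintegral_congr fun w => ?_)) (ho.variance x)
    simp only [gradNoise]; congr 2; abel
  constructor
  · refine le_trans (lintegral_mono fun ξ => ?_)
      ((lintegral_prod _ hm.aemeasurable).symm.trans_le hv)
    have h3 := enorm_integral_sq_le ((integrable_const (gradient (gS ξ) x - gradient g x)).sub h2)
    simp only [Pi.sub_apply] at h3
    rwa [integral_sub (integrable_const _) h2, h20, sub_zero, integral_const, probReal_univ,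
      one_smul] at h3
  · refine le_trans (lintegral_mono fun ς => ?_)
      ((lintegral_prod_symm _ hm.aemeasurable).symm.trans_le hv)
    have h3 := enorm_integral_sq_le (h1.sub (integrable_const (dh x ς - gradient h x)))
    simp only [Pi.sub_apply] at h3
    rwa [integral_sub h1 (integrable_const _), h10, zero_sub, integral_const, probReal_univ,
      one_smul, enorm_neg] at h3

/-- SPG evaluates the two parts at different points, y_t and x_k, so the joint variance bound is not
directly applicable. The separate bounds combine through ‖a − b‖² ≤ 2‖a‖² + 2‖b‖². -/
theorem IsStochOracle.meanSq_gradNoise (ho : IsStochOracle g h pξ pς gS hS dh G)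
    (b : RVec d × RVec d) :
    MeanSqLE (pξ.prod pς) (fun w => gradNoise g h gS dh (b, w)) (4 * G ^ 2) := by
  have := ho.prob_g
  have := ho.prob_h
  have h1 : Measurable fun ξ => gradient (gS ξ) b.2 - gradient g b.2 :=
    (ho.meas_g.comp measurable_prodMk_left).sub_const _
  have h2 : Measurable fun ς => dh b.1 ς - gradient h b.1 :=
    (ho.meas_h.comp measurable_prodMk_left).sub_const _
  have h3 : MeanSqLE (pξ.prod pς)
      (fun w : Ξ × Z => gradient (gS w.1) b.2 - gradient g b.2) (G ^ 2) := by
    refine le_trans (le_of_eq ?_) (ho.meanSq_parts b.2).1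
    exact (measurePreserving_fst (μ := pξ) (ν := pς)).lintegral_comp (h1.enorm.pow_const 2)
  have h4 : MeanSqLE (pξ.prod pς)
      (fun w : Ξ × Z => dh b.1 w.2 - gradient h b.1) (G ^ 2) := by
    refine le_trans (le_of_eq ?_) (ho.meanSq_parts b.1).2
    exact (measurePreserving_snd (μ := pξ) (ν := pς)).lintegral_comp (h2.enorm.pow_const 2)
  refine (MeanSqLE.of_le_add two_pos.le two_pos.le (sq_nonneg G) (sq_nonneg G)
    (h1.comp measurable_fst) h3 h4 fun w => ?_).mono (by linarith)
  have h5 := norm_sub_le (gradient (gS w.1) b.2 - gradient g b.2) (dh b.1 w.2 - gradient h b.1)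
  simp only [gradNoise, Function.comp_apply]
  nlinarith [sq_nonneg (‖gradient (gS w.1) b.2 - gradient g b.2‖ - ‖dh b.1 w.2 - gradient h b.1‖),
    norm_nonneg ((gradient (gS w.1) b.2 - gradient g b.2) - (dh b.1 w.2 - gradient h b.1))]

theorem MeanSqLE.sub_smul_gradNoise (ho : IsStochOracle g h pξ pς gS hS dh G)
    {Ω : Type*} {F mΩ : MeasurableSpace Ω} {P : Measure Ω} [IsProbabilityMeasure P] (hF : F ≤ mΩ)
    {X x y : Ω → RVec d} (hX : Measurable[F] X) (hx : Measurable[F] x) (hy : Measurable[F] y)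
    {s : Ω → Ξ × Z} (hs : Measurable s) (hq : P.map s = pξ.prod pς)
    (hind : Indep F (MeasurableSpace.comap s inferInstance) P) {c : ℝ} (hc : 0 ≤ c)
    (hXc : MeanSqLE P X c) (k : ℝ) :
    MeanSqLE P (fun ω => X ω - k • gradNoise g h gS dh ((x ω, y ω), s ω))
      (c + k ^ 2 * (4 * G ^ 2)) := by
  have h1 := MeanSqLE.add_noise hF hX (hx.prodMk hy) hs hq hind
    (f := fun w => (-k) • gradNoise g h gS dh w) (ho.measurable_gradNoise.const_smul (-k))
    (fun b => (ho.integrable_gradNoise b).1.smul (-k))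
    (fun b => by rw [integral_smul, (ho.integrable_gradNoise b).2, smul_zero])
    (show 0 ≤ k ^ 2 * (4 * G ^ 2) by positivity) hc
    (fun b => (ho.meanSq_gradNoise b).of_le_mul (sq_nonneg k) fun w => by
      rw [norm_smul, mul_pow, Real.norm_eq_abs, sq_abs, neg_sq]) hXc
  simpa only [neg_smul, ← sub_eq_add_neg] using h1

end Noise

/-! ## One stage of SPG -/

/-- `F` is a filtration to which the samples `s` of one stage with starting point `x` are
adapted, and `s t` has law `q` and is independent of `F t`. -/
structure IsStageFiltration {Ω S : Type*} {mΩ : MeasurableSpace Ω} [MeasurableSpace S] {d : ℕ}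
    (P : Measure Ω) (q : Measure S) (F : ℕ → MeasurableSpace Ω) (x : Ω → RVec d)
    (s : ℕ → Ω → S) : Prop where
  le : ∀ t, F t ≤ mΩ
  mono : Monotone F
  meas_start : Measurable[F 1] x
  meas_sample : ∀ t, Measurable[F (t + 1)] (s t)
  law : ∀ t, P.map (s t) = q
  indep : ∀ t, Indep (F t) (MeasurableSpace.comap (s t) inferInstance) P

/-- The SPG iterates as functions of the sample point. -/
noncomputable def spgPath {d : ℕ} {Ω Ξ Z : Type*} (gS : Ξ → RVec d → ℝ)
    (dh : RVec d → Z → RVec d) (μ γ : ℝ) (p : RVec d → RVec d) (x : Ω → RVec d)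
    (s : ℕ → Ω → Ξ × Z) (t : ℕ) (ω : Ω) : RVec d :=
  spgIter μ γ (fun t y => gradient (gS (s t ω).1) y - (dh (x ω) (s t ω).2 + μ⁻¹ • p (x ω)))
    (x ω) t

theorem measurable_spgPath {d : ℕ} {Ω Ξ Z : Type*} [MeasurableSpace Ξ] [MeasurableSpace Z]
    {gS : Ξ → RVec d → ℝ} {dh : RVec d → Z → RVec d} {μ γ : ℝ} {p : RVec d → RVec d}
    (hg : Measurable (fun q : RVec d × Ξ => gradient (gS q.2) q.1))
    (hh : Measurable (fun q : RVec d × Z => dh q.1 q.2)) (hp : Measurable p)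
    {m : MeasurableSpace Ω} {x : Ω → RVec d} (hx : Measurable x) {s : ℕ → Ω → Ξ × Z} (t : ℕ)
    (hs : ∀ j < t, Measurable (s j)) : Measurable (spgPath gS dh μ γ p x s t) := by
  induction t using Nat.strong_induction_on with
  | _ t ih =>
    match t, ih, hs with
    | 0, _, _ => exact hx
    | 1, _, _ => exact hx
    | t + 2, ih, hs =>
      have h1 := ih (t + 1) (by omega) fun j hj => hs j (by omega)
      have h2 := hs (t + 1) (by omega)
      have h3 : Measurable fun ω =>
          gradient (gS (s (t + 1) ω).1) (spgPath gS dh μ γ p x s (t + 1) ω) :=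
        hg.comp (h1.prodMk h2.fst)
      have h4 : Measurable fun ω => dh (x ω) (s (t + 1) ω).2 := hh.comp (hx.prodMk h2.snd)
      exact (((hx.const_smul γ).add
        (h1.const_smul (3 / (γ * (((t + 1 : ℕ) : ℝ) + 1)))⁻¹)).sub
        (h3.sub (h4.add ((hp.comp hx).const_smul μ⁻¹)))).const_smul
        (μ⁻¹ + γ + (3 / (γ * (((t + 1 : ℕ) : ℝ) + 1)))⁻¹)⁻¹

section Stage

variable {d : ℕ} {Ω Ξ Z : Type*} {g h : RVec d → ℝ} {gS : Ξ → RVec d → ℝ}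
    {dh : RVec d → Z → RVec d} {L μ γ : ℝ} {p : RVec d → RVec d} {x : Ω → RVec d}
    {s : ℕ → Ω → Ξ × Z}

/-- The distance vector of the `t`-th SPG iterate to the exact gradient step. -/
noncomputable def spgErr (g h : RVec d → ℝ) (gS : Ξ → RVec d → ℝ)
    (dh : RVec d → Z → RVec d) (μ γ : ℝ) (p : RVec d → RVec d) (x : Ω → RVec d)
    (s : ℕ → Ω → Ξ × Z) (t : ℕ) (ω : Ω) : RVec d :=
  spgPath gS dh μ γ p x s t ω - (x ω - (μ⁻¹ + γ)⁻¹ • proxResidual g h μ p (x ω))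

theorem spgErr_one (ω : Ω) : spgErr g h gS dh μ γ p x s 1 ω
    = (μ⁻¹ + γ)⁻¹ • proxResidual g h μ p (x ω) := by
  simp [spgErr, spgPath, spgIter]

/-- This is `proxStep_sub` with η_t⁻¹ = γ(t+1)/3. The error of the linear term splits into the bias
from evaluating ∇g away from x and the centred noise. -/
theorem spgErr_succ (hμ : 0 < μ) (hγ : 0 < γ) {t : ℕ} (ht : 1 ≤ t) (ω : Ω) :
    (μ⁻¹ + γ + γ * (t + 1) / 3) • spgErr g h gS dh μ γ p x s (t + 1) ω
      = (γ * (t + 1) / 3) • spgErr g h gS dh μ γ p x s t ω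
        - (gradient g (spgPath gS dh μ γ p x s t ω) - gradient g (x ω))
        - gradNoise g h gS dh ((x ω, spgPath gS dh μ γ p x s t ω), s t ω) := by
  obtain ⟨k, rfl⟩ : ∃ k, t = k + 1 := ⟨t - 1, by omega⟩
  have hη : 0 < 3 / (γ * (((k + 1 : ℕ) : ℝ) + 1)) := by positivity
  have h1 := proxStep_sub hμ hγ hη (y := spgPath gS dh μ γ p x s (k + 1) ω)
    (v := gradient (gS (s (k + 1) ω).1) (spgPath gS dh μ γ p x s (k + 1) ω)
      - (dh (x ω) (s (k + 1) ω).2 + μ⁻¹ • p (x ω)))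
    (smul_gradient_step (g := g) (h := h) hμ hγ p (x ω))
  rw [inv_div] at h1
  refine h1.trans ?_
  simp only [spgErr, gradNoise]
  abel

theorem norm_gradient_spgPath_sub_le (hL : 0 ≤ L) (hg : IsLSmooth L g) (t : ℕ) (ω : Ω) :
    ‖gradient g (spgPath gS dh μ γ p x s t ω) - gradient g (x ω)‖
      ≤ L * (‖spgErr g h gS dh μ γ p x s t ω‖ + ‖spgErr g h gS dh μ γ p x s 1 ω‖) := by
  refine (hg.2 _ _).trans (mul_le_mul_of_nonneg_left ?_ hL)
  have : spgPath gS dh μ γ p x s t ω - x ω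
      = spgErr g h gS dh μ γ p x s t ω - spgErr g h gS dh μ γ p x s 1 ω := by
    rw [spgErr_one, spgErr]; abel
  rw [this]
  exact norm_sub_le _ _

variable {mΩ : MeasurableSpace Ω} [MeasurableSpace Ξ] [MeasurableSpace Z]
    {pξ : Measure Ξ} {pς : Measure Z} {hS : Z → RVec d → ℝ} {G u2 : ℝ} {P : Measure Ω}
    {F : ℕ → MeasurableSpace Ω}

theorem IsStageFiltration.measurable_spgPath (hF : IsStageFiltration P (pξ.prod pς) F x s)
    (ho : IsStochOracle g h pξ pς gS hS dh G) (hp : Measurable p) {t : ℕ} (ht : 1 ≤ t) :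
    Measurable[F t] (spgPath gS dh μ γ p x s t) :=
  _root_.measurable_spgPath ho.meas_g ho.meas_h hp (hF.meas_start.mono (hF.mono ht) le_rfl) t
    fun j hj => (hF.meas_sample j).mono (hF.mono (show j + 1 ≤ t from hj)) le_rfl

theorem IsStageFiltration.measurable_spgErr (hF : IsStageFiltration P (pξ.prod pς) F x s)
    (ho : IsStochOracle g h pξ pς gS hS dh G) (hp : Measurable p) {t : ℕ} (ht : 1 ≤ t) :
    Measurable[F t] (spgErr g h gS dh μ γ p x s t) := by
  have hx : Measurable[F t] x := hF.meas_start.mono (hF.mono ht) le_rfl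
  have hr : Measurable (proxResidual g h μ p) :=
    ((measurable_gradient g).sub (measurable_gradient h)).add
      ((measurable_id.sub hp).const_smul μ⁻¹)
  exact (hF.measurable_spgPath ho hp ht).sub
    (hx.sub ((hr.comp hx).const_smul (μ⁻¹ + γ)⁻¹))

/-- The step sizes make the squared contraction factor close to ((t+3)/(t+5))², so (t+3)²
E‖e_{t+1}‖² grows only by a bounded bias and noise contribution per step. Here μ⁻¹ is dropped from
the denominator, which is why only γ⁻² appears. -/
theorem meanSqLE_spgErr [IsProbabilityMeasure P] (hF : IsStageFiltration P (pξ.prod pς) F x s)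
    (ho : IsStochOracle g h pξ pς gS hS dh G) (hp : Measurable p) (hμ : 0 < μ) (hL : 0 < L)
    (hγ : 3 * L ≤ γ) (hg : IsLSmooth L g) (hu2 : 0 ≤ u2)
    (hu : MeanSqLE P (spgErr g h gS dh μ γ p x s 1) u2) (T : ℕ) (t : ℕ) (ht : t ≤ T) :
    MeanSqLE P (spgErr g h gS dh μ γ p x s (t + 1))
      ((9 * u2 + 9 / γ ^ 2 * (t * ((T + 3) * L ^ 2 * u2 + 4 * G ^ 2))) / (t + 3) ^ 2) := by
  have hγ0 : 0 < γ := by linarith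
  have hμ' : 0 < μ⁻¹ := inv_pos.mpr hμ
  induction t with
  | zero => exact hu.mono (by norm_num)
  | succ t ih =>
    have ih := ih (by omega)
    set c := 9 * u2 + 9 / γ ^ 2 * (t * ((T + 3) * L ^ 2 * u2 + 4 * G ^ 2)) with hc
    have hc0 : 0 ≤ c := by positivity
    set b := γ * (((t + 1 : ℕ) : ℝ) + 1) / 3 with hb
    have hb0 : 0 < b := by positivity
    have htc : ((t + 1 : ℕ) : ℝ) = t + 1 := by push_cast; ring
    let D : Ω → RVec d := fun ω => b • spgErr g h gS dh μ γ p x s (t + 1) ω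
        - (gradient g (spgPath gS dh μ γ p x s (t + 1) ω) - gradient g (x ω))
    have hx : Measurable[F (t + 1)] x :=
      hF.meas_start.mono (hF.mono (by omega)) le_rfl
    have hy := hF.measurable_spgPath (μ := μ) (γ := γ) ho hp (show 1 ≤ t + 1 by omega)
    have he := hF.measurable_spgErr (μ := μ) (γ := γ) ho hp (show 1 ≤ t + 1 by omega)
    have hDm : Measurable[F (t + 1)] D :=
      (he.const_smul b).sub (((measurable_gradient g).comp hy).sub
        ((measurable_gradient g).comp hx))
    have hD : MeanSqLE P D ((t + 4) / (t + 3) * (γ * (t + 3) / 3) ^ 2 * (c / (t + 3) ^ 2)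
        + (t + 4) * L ^ 2 * u2) := by
      refine MeanSqLE.of_le_add (by positivity) (by positivity) (by positivity) hu2
        (he.mono (hF.le _) le_rfl) ih hu fun ω => ?_
      set e := ‖spgErr g h gS dh μ γ p x s (t + 1) ω‖ with hee
      set e1 := ‖spgErr g h gS dh μ γ p x s 1 ω‖
      have he0 : 0 ≤ e := norm_nonneg _
      have he1 : 0 ≤ e1 := norm_nonneg _
      have h1 : ‖D ω‖ ≤ γ * (t + 3) / 3 * e + L * e1 := by
        refine (norm_sub_le _ _).trans ?_
        have h2 := norm_gradient_spgPath_sub_le (h := h) (gS := gS) (dh := dh) (μ := μ) (γ := γ)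
          (p := p) (x := x) (s := s) hL.le hg (t + 1) ω
        rw [norm_smul, Real.norm_of_nonneg hb0.le, ← hee, hb, htc]
        nlinarith
      have h3 : ‖D ω‖ ^ 2 ≤ (γ * (t + 3) / 3 * e + L * e1) ^ 2 :=
        pow_le_pow_left₀ (norm_nonneg _) h1 2
      refine h3.trans ?_
      have ht3 : (0 : ℝ) < t + 3 := by positivity
      -- Young's inequality with weights 1 + 1/(t+3) and 1 + (t+3). The coefficient γ(t+3)/3 of e
      -- has absorbed one L, using 3L ≤ γ.
      have key : (t + 4) / (t + 3) * (γ * (t + 3) / 3) ^ 2 * e ^ 2 + (t + 4) * L ^ 2 * e1 ^ 2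
          - (γ * (t + 3) / 3 * e + L * e1) ^ 2
          = (t + 3) * (γ / 3 * e - L * e1) ^ 2 := by
        field_simp; ring
      nlinarith [mul_nonneg ht3.le (sq_nonneg (γ / 3 * e - L * e1))]
    have hN := hD.sub_smul_gradNoise ho (hF.le (t + 1)) hDm hx hy
      ((hF.meas_sample (t + 1)).mono (hF.le _) le_rfl) (hF.law _) (hF.indep _)
      (by positivity) 1
    have hE := hN.of_le_mul (X := spgErr g h gS dh μ γ p x s (t + 1 + 1))
      (a := 9 / (γ ^ 2 * (t + 5) ^ 2)) (by positivity) fun ω => by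
        have h1 := spgErr_succ (g := g) (h := h) (gS := gS) (dh := dh) (p := p) (x := x) (s := s)
          hμ hγ0 (show 1 ≤ t + 1 by omega) ω
        rw [one_smul]
        simp only [D]
        rw [← h1, norm_smul, Real.norm_of_nonneg (by positivity), ← hb, mul_pow, ← mul_assoc]
        refine le_mul_of_one_le_left (by positivity) ?_
        have h2 : γ * (t + 5) / 3 ≤ μ⁻¹ + γ + b := by rw [hb, htc]; linarith
        have h3 : (γ * (t + 5) / 3) ^ 2 ≤ (μ⁻¹ + γ + b) ^ 2 :=
          pow_le_pow_left₀ (by positivity) h2 2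
        rw [div_mul_eq_mul_div, le_div_iff₀ (by positivity)]
        nlinarith
    refine hE.mono ?_
    have htT : (t : ℝ) + 1 ≤ T := by exact_mod_cast ht
    have h4 : 9 / (γ ^ 2 * (t + 5) ^ 2) * ((t + 4) / (t + 3) * (γ * (t + 3) / 3) ^ 2
        * (c / (t + 3) ^ 2) + (t + 4) * L ^ 2 * u2 + 1 ^ 2 * (4 * G ^ 2))
        = (t + 4) / ((t + 3) * (t + 5) ^ 2) * c
          + 9 / γ ^ 2 * (((t + 4) * L ^ 2 * u2 + 4 * G ^ 2) / (t + 5) ^ 2) := by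
      field_simp; ring
    -- The claim is (t+4)³ ≤ (t+3)(t+5)²: the gain from the contraction pays for the Young weight.
    have h5 : ((t : ℝ) + 4) / ((t + 3) * (t + 5) ^ 2) ≤ 1 / (t + 4) ^ 2 := by
      rw [div_le_div_iff₀ (by positivity) (by positivity)]
      have : (0 : ℝ) ≤ t := by positivity
      nlinarith [mul_nonneg this this]
    have h6 : ((t + 4) * L ^ 2 * u2 + 4 * G ^ 2) / ((t : ℝ) + 5) ^ 2
        ≤ ((T + 3) * L ^ 2 * u2 + 4 * G ^ 2) / (t + 4) ^ 2 := by
      have : (0 : ℝ) ≤ t := by positivity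
      have : (t : ℝ) + 4 ≤ T + 3 := by linarith
      have : (t : ℝ) + 4 ≤ t + 5 := by linarith
      gcongr
    rw [h4]
    have h7 : (9 * u2 + 9 / γ ^ 2 * (((t + 1 : ℕ) : ℝ) * ((T + 3) * L ^ 2 * u2 + 4 * G ^ 2)))
          / (((t + 1 : ℕ) : ℝ) + 3) ^ 2
        = 1 / (t + 4) ^ 2 * c
          + 9 / γ ^ 2 * (((T + 3) * L ^ 2 * u2 + 4 * G ^ 2) / (t + 4) ^ 2) := by
      rw [hc, htc]
      have : (t : ℝ) + 1 + 3 = t + 4 := by ring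
      rw [this]; field_simp; ring
    rw [h7]
    gcongr

end Stage

/-! ### The weighted average of the SPG iterates -/

section Stage

variable {d : ℕ} {Ω Ξ Z : Type*} {g h : RVec d → ℝ} {gS : Ξ → RVec d → ℝ}
    {dh : RVec d → Z → RVec d} {L μ γ : ℝ} {p : RVec d → RVec d} {x : Ω → RVec d}
    {s : ℕ → Ω → Ξ × Z}

/-- The weighted sum of the SPG errors, corrected so that its increments do not involve
`μ⁻¹`. -/
noncomputable def spgPotential (g h : RVec d → ℝ) (gS : Ξ → RVec d → ℝ)
    (dh : RVec d → Z → RVec d) (μ γ : ℝ) (p : RVec d → RVec d) (x : Ω → RVec d)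
    (s : ℕ → Ω → Ξ × Z) (t : ℕ) (ω : Ω) : RVec d :=
  (μ⁻¹ + γ) • ∑ j ∈ Finset.Icc 2 (t + 1), (j : ℝ) • spgErr g h gS dh μ γ p x s j ω
    + (γ / 3 * (t + 1) ^ 2) • spgErr g h gS dh μ γ p x s (t + 1) ω

/-- The conditional mean of the increments of `spgPotential`. -/
noncomputable def spgDrift (g h : RVec d → ℝ) (gS : Ξ → RVec d → ℝ)
    (dh : RVec d → Z → RVec d) (μ γ : ℝ) (p : RVec d → RVec d) (x : Ω → RVec d)
    (s : ℕ → Ω → Ξ × Z) (t : ℕ) (ω : Ω) : RVec d :=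
  (γ / 3 * (2 * t + 3)) • spgErr g h gS dh μ γ p x s (t + 1) ω
    - ((t : ℝ) + 2) • (gradient g (spgPath gS dh μ γ p x s (t + 1) ω) - gradient g (x ω))

/-- Multiplying the recursion for e_{t+2} by t + 2 puts all of its μ⁻¹ part into the weighted sum.
What remains is the telescoping correction γ(t+2)²/3 · e_{t+2}, whose mismatch (t+2)² − (t+1)² = 2t
+ 3 goes into the drift. -/
theorem spgPotential_succ (hμ : 0 < μ) (hγ : 0 < γ) (t : ℕ) (ω : Ω) :
    spgPotential g h gS dh μ γ p x s (t + 1) ω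
      = spgPotential g h gS dh μ γ p x s t ω + spgDrift g h gS dh μ γ p x s t ω
        - ((t : ℝ) + 2) • gradNoise g h gS dh ((x ω, spgPath gS dh μ γ p x s (t + 1) ω),
            s (t + 1) ω) := by
  have h1 := spgErr_succ (g := g) (h := h) (gS := gS) (dh := dh) (p := p) (x := x) (s := s)
    hμ hγ (show 1 ≤ t + 1 by omega) ω
  have h2 := congrArg (fun v => ((t : ℝ) + 2) • v) h1
  simp only [spgPotential, spgDrift]
  rw [Finset.sum_Icc_succ_top (by omega : 2 ≤ t + 1 + 1)]
  push_cast at h2 ⊢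
  generalize ∑ j ∈ Finset.Icc 2 (t + 1), (j : ℝ) • spgErr g h gS dh μ γ p x s j ω = S at *
  generalize spgErr g h gS dh μ γ p x s (t + 1 + 1) ω = e' at *
  generalize spgErr g h gS dh μ γ p x s (t + 1) ω = e at *
  generalize gradNoise g h gS dh ((x ω, spgPath gS dh μ γ p x s (t + 1) ω), s (t + 1) ω) = n at *
  generalize gradient g (spgPath gS dh μ γ p x s (t + 1) ω) - gradient g (x ω) = D at *
  have h3 : (μ⁻¹ + γ) • (S + ((t : ℝ) + 1 + 1) • e') + (γ / 3 * ((t : ℝ) + 1 + 1) ^ 2) • e'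
      = (μ⁻¹ + γ) • S + ((t : ℝ) + 2) • ((μ⁻¹ + γ + γ * (t + 1 + 1) / 3) • e') := by module
  rw [h3, h2]
  module

theorem norm_spgDrift_sq_le (hL : 0 < L) (hγ : 3 * L ≤ γ) (hg : IsLSmooth L g) (t : ℕ) (ω : Ω) :
    ‖spgDrift g h gS dh μ γ p x s t ω‖ ^ 2
      ≤ 2 * γ ^ 2 * (t + 2) ^ 2 * ‖spgErr g h gS dh μ γ p x s (t + 1) ω‖ ^ 2
        + 2 * L ^ 2 * (t + 2) ^ 2 * ‖spgErr g h gS dh μ γ p x s 1 ω‖ ^ 2 := by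
  have h2 := norm_gradient_spgPath_sub_le (h := h) (gS := gS) (dh := dh) (μ := μ) (γ := γ)
    (p := p) (x := x) (s := s) hL.le hg (t + 1) ω
  set e := ‖spgErr g h gS dh μ γ p x s (t + 1) ω‖ with hee
  set e1 := ‖spgErr g h gS dh μ γ p x s 1 ω‖
  have he0 : 0 ≤ e := norm_nonneg _
  have he1 : 0 ≤ e1 := norm_nonneg _
  have hγ0 : 0 < γ := by linarith
  have ht : (0 : ℝ) ≤ t := by positivity
  have h1 : ‖spgDrift g h gS dh μ γ p x s t ω‖ ≤ γ * (t + 2) * e + L * (t + 2) * e1 := by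
    refine (norm_sub_le _ _).trans ?_
    rw [norm_smul, norm_smul, Real.norm_of_nonneg (by positivity),
      Real.norm_of_nonneg (by positivity), ← hee]
    have h3 : ((t : ℝ) + 2) * ‖gradient g (spgPath gS dh μ γ p x s (t + 1) ω) - gradient g (x ω)‖
        ≤ (t + 2) * (L * (e + e1)) := by gcongr
    have h4 : 0 ≤ (γ - 3 * L) * (t + 2) * e :=
      mul_nonneg (mul_nonneg (by linarith) (by linarith)) he0
    have h5 : 0 ≤ γ * e := by positivity
    nlinarith
  have h3 := pow_le_pow_left₀ (norm_nonneg _) h1 2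
  nlinarith [sq_nonneg (γ * (t + 2) * e - L * (t + 2) * e1)]

theorem spg_sub_eq {T : ℕ} (hT : 1 ≤ T) (ω : Ω) :
    ((μ⁻¹ + γ) * ∑ t ∈ Finset.Icc 2 (T + 1), (t : ℝ)) •
      (spg μ γ T (fun t y => gradient (gS (s t ω).1) y - (dh (x ω) (s t ω).2 + μ⁻¹ • p (x ω)))
        (x ω) - (x ω - (μ⁻¹ + γ)⁻¹ • proxResidual g h μ p (x ω)))
      = spgPotential g h gS dh μ γ p x s T ω
        - (γ / 3 * (T + 1) ^ 2) • spgErr g h gS dh μ γ p x s (T + 1) ω := by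
  have hW : (0 : ℝ) < ∑ t ∈ Finset.Icc 2 (T + 1), (t : ℝ) :=
    Finset.sum_pos (fun t ht => by have := (Finset.mem_Icc.mp ht).1; positivity)
      ⟨2, Finset.mem_Icc.mpr ⟨le_rfl, by omega⟩⟩
  rw [spgPotential, add_sub_cancel_right, mul_smul, smul_sub, spg, smul_smul,
    mul_inv_cancel₀ hW.ne', one_smul, Finset.sum_smul, ← Finset.sum_sub_distrib]
  refine congrArg _ (Finset.sum_congr rfl fun t _ => ?_)
  rw [← smul_sub]; rfl

theorem sum_Icc_two_ge (T : ℕ) : (T : ℝ) ^ 2 / 2 ≤ ∑ t ∈ Finset.Icc 2 (T + 1), (t : ℝ) := by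
  induction T with
  | zero => simp
  | succ T ih =>
    rw [Finset.sum_Icc_succ_top (by omega)]
    push_cast
    nlinarith

theorem one_add_inv_pow_le_three {T t : ℕ} (hT : 1 ≤ T) (ht : t ≤ T) :
    (1 + 1 / (T : ℝ)) ^ t ≤ 3 := by
  have hT' : (0 : ℝ) < T := by exact_mod_cast hT
  have h1 : (1 + 1 / (T : ℝ)) ^ t ≤ (1 + 1 / (T : ℝ)) ^ T :=
    pow_le_pow_right₀ (by simp) ht
  have h2 : (1 + 1 / (T : ℝ)) ^ T ≤ Real.exp (1 / T) ^ T :=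
    pow_le_pow_left₀ (by positivity) (by linarith [Real.add_one_le_exp (1 / (T : ℝ))]) T
  rw [← Real.exp_nat_mul, mul_one_div_cancel hT'.ne'] at h2
  linarith [Real.exp_one_lt_d9]

variable {mΩ : MeasurableSpace Ω} [MeasurableSpace Ξ] [MeasurableSpace Z]
    {pξ : Measure Ξ} {pς : Measure Z} {hS : Z → RVec d → ℝ} {G u2 : ℝ} {P : Measure Ω}
    {F : ℕ → MeasurableSpace Ω}

theorem IsStageFiltration.measurable_spgPotential (hF : IsStageFiltration P (pξ.prod pς) F x s)
    (ho : IsStochOracle g h pξ pς gS hS dh G) (hp : Measurable p) (t : ℕ) :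
    Measurable[F (t + 1)] (spgPotential g h gS dh μ γ p x s t) := by
  have h1 : Measurable[F (t + 1)] fun ω =>
      ∑ j ∈ Finset.Icc 2 (t + 1), (j : ℝ) • spgErr g h gS dh μ γ p x s j ω :=
    Finset.measurable_fun_sum _ fun j hj => by
      obtain ⟨h2, h3⟩ := Finset.mem_Icc.mp hj
      exact ((hF.measurable_spgErr ho hp (by omega)).mono (hF.mono h3) le_rfl).const_smul (j : ℝ)
  exact (h1.const_smul (μ⁻¹ + γ)).add
    ((hF.measurable_spgErr ho hp (by omega)).const_smul (γ / 3 * ((t : ℝ) + 1) ^ 2))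

theorem IsStageFiltration.measurable_spgDrift (hF : IsStageFiltration P (pξ.prod pς) F x s)
    (ho : IsStochOracle g h pξ pς gS hS dh G) (hp : Measurable p) (t : ℕ) :
    Measurable[F (t + 1)] (spgDrift g h gS dh μ γ p x s t) :=
  ((hF.measurable_spgErr ho hp (by omega)).const_smul (γ / 3 * (2 * (t : ℝ) + 3))).sub
    ((((measurable_gradient g).comp (hF.measurable_spgPath ho hp (by omega))).sub
      ((measurable_gradient g).comp
        (hF.meas_start.mono (hF.mono (by omega)) le_rfl))).const_smul ((t : ℝ) + 2))

/-- The drift is split off with Young weights 1 + 1/T and 1 + T, so T steps cost only the bounded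
factor (1 + 1/T)^T. The noise is centred given the past and simply adds its variance. The quantity f
bounds the combined contribution of one step. -/
theorem meanSqLE_spgPotential [IsProbabilityMeasure P]
    (hF : IsStageFiltration P (pξ.prod pς) F x s)
    (ho : IsStochOracle g h pξ pς gS hS dh G) (hp : Measurable p) (hμ : 0 < μ) (hL : 0 < L)
    (hγ : 3 * L ≤ γ) (hg : IsLSmooth L g) (hu2 : 0 ≤ u2)
    (hu : MeanSqLE P (spgErr g h gS dh μ γ p x s 1) u2) {T : ℕ} (hT : 1 ≤ T) {c : ℝ}
    (hc : c = 9 * u2 + 9 / γ ^ 2 * (T * ((T + 3) * L ^ 2 * u2 + 4 * G ^ 2)))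
    {f : ℝ} (hf : f = (1 + T) * (2 * γ ^ 2 * c + 2 * L ^ 2 * (T + 1) ^ 2 * u2)
      + (T + 1) ^ 2 * (4 * G ^ 2)) (t : ℕ) (ht : t ≤ T) :
    MeanSqLE P (spgPotential g h gS dh μ γ p x s t)
      ((1 + 1 / (T : ℝ)) ^ t * (γ ^ 2 / 9 * u2 + t * f)) := by
  have hγ0 : 0 < γ := by linarith
  have hT' : (0 : ℝ) < T := by exact_mod_cast hT
  have hc0 : 0 ≤ c := by rw [hc]; positivity
  have hf0 : 0 ≤ f := by rw [hf]; positivity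
  induction t with
  | zero =>
    refine (hu.of_le_mul (X := spgPotential g h gS dh μ γ p x s 0)
      (a := γ ^ 2 / 9) (by positivity) fun ω => le_of_eq ?_).mono (by simp)
    simp only [spgPotential, zero_add, Finset.Icc_eq_empty (by omega : ¬ 2 ≤ 1),
      Finset.sum_empty, smul_zero]
    rw [norm_smul, mul_pow, Real.norm_eq_abs, sq_abs]
    norm_num [div_pow]
  | succ t ih =>
    have ih := ih (by omega)
    have htT : (t : ℝ) + 1 ≤ T := by exact_mod_cast ht
    have hx : Measurable[F (t + 1)] x :=
      hF.meas_start.mono (hF.mono (by omega)) le_rfl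
    have hy := hF.measurable_spgPath (μ := μ) (γ := γ) ho hp (show 1 ≤ t + 1 by omega)
    have he := hF.measurable_spgErr (μ := μ) (γ := γ) ho hp (show 1 ≤ t + 1 by omega)
    have hQ := hF.measurable_spgPotential (μ := μ) (γ := γ) ho hp t
    have hD := hF.measurable_spgDrift (μ := μ) (γ := γ) ho hp t
    have hE := meanSqLE_spgErr hF ho hp hμ hL hγ hg hu2 hu T t (by omega)
    have hR : MeanSqLE P (spgDrift g h gS dh μ γ p x s t)
        (2 * γ ^ 2 * c + 2 * L ^ 2 * (T + 1) ^ 2 * u2) := by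
      refine (MeanSqLE.of_le_add (by positivity) (by positivity) (by positivity) hu2
        (he.mono (hF.le _) le_rfl) hE hu
        (norm_spgDrift_sq_le hL hγ hg t)).mono ?_
      have h1 : 9 * u2 + 9 / γ ^ 2 * (t * ((T + 3) * L ^ 2 * u2 + 4 * G ^ 2)) ≤ c := by
        rw [hc]
        gcongr
        linarith
      have h2 : ((t : ℝ) + 2) ^ 2 / (t + 3) ^ 2 ≤ 1 := by
        rw [div_le_one (by positivity)]; gcongr; norm_num
      have h3 : (0 : ℝ) ≤ 9 * u2 + 9 / γ ^ 2 * (t * ((T + 3) * L ^ 2 * u2 + 4 * G ^ 2)) := by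
        positivity
      have h4 : ∀ z : ℝ, 2 * γ ^ 2 * (t + 2) ^ 2 * (z / (t + 3) ^ 2)
          = 2 * γ ^ 2 * (((t : ℝ) + 2) ^ 2 / (t + 3) ^ 2 * z) := fun z => by ring
      rw [h4]
      have h5 : (t : ℝ) + 2 ≤ T + 1 := by linarith
      have h6 := (mul_le_of_le_one_left h3 h2).trans h1
      gcongr
    have hsum := MeanSqLE.of_le_add
      (X := fun ω => spgPotential g h gS dh μ γ p x s t ω + spgDrift g h gS dh μ γ p x s t ω)
      (a := 1 + 1 / (T : ℝ)) (b := 1 + T) (by positivity) (by positivity) (by positivity)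
      (by positivity) (hQ.mono (hF.le _) le_rfl) ih hR fun ω => by
        have h1 := norm_add_le (spgPotential g h gS dh μ γ p x s t ω)
          (spgDrift g h gS dh μ γ p x s t ω)
        set a := ‖spgPotential g h gS dh μ γ p x s t ω‖
        set b := ‖spgDrift g h gS dh μ γ p x s t ω‖
        have h2 := pow_le_pow_left₀ (norm_nonneg _) h1 2
        refine h2.trans ?_
        have key : (1 + 1 / (T : ℝ)) * a ^ 2 + (1 + T) * b ^ 2 - (a + b) ^ 2
            = 1 / T * (a - T * b) ^ 2 := by
          field_simp; ring
        have : 0 ≤ 1 / T * (a - T * b) ^ 2 := by positivity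
        linarith
    have hN := hsum.sub_smul_gradNoise ho (hF.le (t + 1)) (hQ.add hD) hx hy
      ((hF.meas_sample (t + 1)).mono (hF.le _) le_rfl) (hF.law _) (hF.indep _)
      (by positivity) ((t : ℝ) + 2)
    have heq : spgPotential g h gS dh μ γ p x s (t + 1) = fun ω =>
        spgPotential g h gS dh μ γ p x s t ω + spgDrift g h gS dh μ γ p x s t ω
        - ((t : ℝ) + 2) • gradNoise g h gS dh ((x ω, spgPath gS dh μ γ p x s (t + 1) ω),
            s (t + 1) ω) := funext fun ω => spgPotential_succ hμ hγ0 t ω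
    rw [heq]
    refine hN.mono ?_
    have h7 : ((t : ℝ) + 2) ^ 2 * (4 * G ^ 2) ≤ (T + 1) ^ 2 * (4 * G ^ 2) := by
      gcongr ?_ ^ 2 * _
      linarith
    have h8 : (1 + (T : ℝ)) * (2 * γ ^ 2 * c + 2 * L ^ 2 * (T + 1) ^ 2 * u2)
        + ((t : ℝ) + 2) ^ 2 * (4 * G ^ 2) ≤ f := by rw [hf]; linarith
    have h9 : f ≤ (1 + 1 / (T : ℝ)) ^ (t + 1) * f :=
      le_mul_of_one_le_left hf0 (one_le_pow₀ (by simp))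
    have h10 : (1 + 1 / (T : ℝ)) ^ (t + 1) * (γ ^ 2 / 9 * u2 + ((t + 1 : ℕ) : ℝ) * f)
        = (1 + 1 / (T : ℝ)) * ((1 + 1 / (T : ℝ)) ^ t * (γ ^ 2 / 9 * u2 + t * f))
          + (1 + 1 / (T : ℝ)) ^ (t + 1) * f := by
      push_cast; ring
    rw [h10]
    linarith

/-- Everything is measured against a = L²u2 and v = σ2/T: successively γ²c ≤ 99T²(a+v) and f ≤
416T³(a+v). The bound γ ≤ 3LT turns γ²u2 into a multiple of T²a. -/
theorem spg_error_constants {L γ T u2 σ2 c f : ℝ} (hL : 0 < L) (hγ : 0 < γ) (hγT : γ ≤ 3 * L * T)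
    (hT : 4 ≤ T) (hu2 : 0 ≤ u2) (hσ : 0 ≤ σ2)
    (hc : c = 9 * u2 + 9 / γ ^ 2 * (T * ((T + 3) * L ^ 2 * u2 + σ2)))
    (hf : f = (1 + T) * (2 * γ ^ 2 * c + 2 * L ^ 2 * (T + 1) ^ 2 * u2) + (T + 1) ^ 2 * σ2) :
    2 * (3 * (γ ^ 2 / 9 * u2 + T * f)) + 2 * (γ ^ 2 / 9) * (T + 1) ^ 2 * c
      ≤ 2600 * T ^ 4 * (L ^ 2 * u2 + σ2 / T) := by
  have hT0 : 0 < T := by linarith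
  set a := L ^ 2 * u2 with ha
  set v := σ2 / T with hv
  have hσv : σ2 = v * T := by rw [hv, div_mul_cancel₀ _ hT0.ne']
  have ha0 : 0 ≤ a := by positivity
  have hv0 : 0 ≤ v := by positivity
  have h1 : γ ^ 2 * u2 ≤ 9 * T ^ 2 * a := by
    have : γ ^ 2 ≤ (3 * L * T) ^ 2 := pow_le_pow_left₀ hγ.le hγT 2
    rw [ha]; nlinarith
  have h2 : γ ^ 2 * c = 9 * (γ ^ 2 * u2) + 9 * (T * ((T + 3) * a + v * T)) := by
    rw [hc, ← hσv, ha]; field_simp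
  have hY : 0 ≤ a + v := by positivity
  have h3 : γ ^ 2 * c ≤ 99 * T ^ 2 * (a + v) := by
    rw [h2]
    nlinarith [mul_nonneg (mul_nonneg hT0.le ha0) (by linarith : 0 ≤ T - 3),
      mul_nonneg (sq_nonneg T) hv0]
  have h4 : f ≤ 416 * T ^ 3 * (a + v) := by
    have h5 : 2 * γ ^ 2 * c + 2 * L ^ 2 * (T + 1) ^ 2 * u2
        ≤ 206 * T ^ 2 * (a + v) := by
      have : 2 * L ^ 2 * (T + 1) ^ 2 * u2 = 2 * (T + 1) ^ 2 * a := by rw [ha]; ring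
      have h6 : 2 * (T + 1) ^ 2 * a ≤ 2 * (2 * T) ^ 2 * (a + v) := by
        gcongr <;> linarith
      rw [this]; nlinarith
    have h7 : (1 + T) * (2 * γ ^ 2 * c + 2 * L ^ 2 * (T + 1) ^ 2 * u2)
        ≤ (2 * T) * (206 * T ^ 2 * (a + v)) :=
      (mul_le_mul_of_nonneg_left h5 (by linarith)).trans
        (mul_le_mul_of_nonneg_right (by linarith) (by positivity))
    have h8 : (T + 1) ^ 2 * σ2 ≤ (2 * T) ^ 2 * ((a + v) * T) := by
      rw [hσv]; gcongr <;> linarith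
    rw [hf]; nlinarith
  have h9 : T * f ≤ T * (416 * T ^ 3 * (a + v)) := mul_le_mul_of_nonneg_left h4 hT0.le
  have h10 : (γ ^ 2 * c) * (T + 1) ^ 2 ≤ (99 * T ^ 2 * (a + v)) * (2 * T) ^ 2 := by
    gcongr; linarith
  have h11 : T ^ 2 * a ≤ T ^ 4 * (a + v) := by
    gcongr <;> linarith
  have h12 : 0 ≤ T ^ 4 * (a + v) := by positivity
  nlinarith

/-- The mean-square distance of the SPG output to the exact gradient step. -/
theorem meanSqLE_spg_sub [IsProbabilityMeasure P]
    (hF : IsStageFiltration P (pξ.prod pς) F x s)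
    (ho : IsStochOracle g h pξ pς gS hS dh G) (hp : Measurable p) (hμ : 0 < μ) (hL : 0 < L)
    (hγ : 3 * L ≤ γ) (hg : IsLSmooth L g) (hu2 : 0 ≤ u2)
    (hu : MeanSqLE P (fun ω => (μ⁻¹ + γ)⁻¹ • proxResidual g h μ p (x ω)) u2) {T : ℕ}
    (hT : 4 ≤ T) (hγT : γ ≤ 3 * L * T) :
    MeanSqLE P (fun ω => spg μ γ T (fun t y => gradient (gS (s t ω).1) y
        - (dh (x ω) (s t ω).2 + μ⁻¹ • p (x ω))) (x ω)
        - (x ω - (μ⁻¹ + γ)⁻¹ • proxResidual g h μ p (x ω)))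
      (10400 * (L ^ 2 * u2 + 4 * G ^ 2 / T) / (μ⁻¹ + γ) ^ 2) := by
  have hγ0 : 0 < γ := by linarith
  have hμ' : 0 < μ⁻¹ := inv_pos.mpr hμ
  have hT' : (4 : ℝ) ≤ T := by exact_mod_cast hT
  have hu' : MeanSqLE P (spgErr g h gS dh μ γ p x s 1) u2 := by
    rw [show spgErr g h gS dh μ γ p x s 1
      = fun ω => (μ⁻¹ + γ)⁻¹ • proxResidual g h μ p (x ω) from funext spgErr_one]
    exact hu
  set c := 9 * u2 + 9 / γ ^ 2 * (T * ((T + 3) * L ^ 2 * u2 + 4 * G ^ 2)) with hc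
  set f := (1 + (T : ℝ)) * (2 * γ ^ 2 * c + 2 * L ^ 2 * (T + 1) ^ 2 * u2)
      + (T + 1) ^ 2 * (4 * G ^ 2) with hf
  have hc0 : 0 ≤ c := by positivity
  have hf0 : 0 ≤ f := by positivity
  have hQ : MeanSqLE P (spgPotential g h gS dh μ γ p x s T)
      (3 * (γ ^ 2 / 9 * u2 + T * f)) :=
    (meanSqLE_spgPotential hF ho hp hμ hL hγ hg hu2 hu' (by omega) hc hf T le_rfl).mono
      (mul_le_mul_of_nonneg_right (one_add_inv_pow_le_three (by omega) le_rfl) (by positivity))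
  have hE := meanSqLE_spgErr hF ho hp hμ hL hγ hg hu2 hu' T T le_rfl
  rw [← hc] at hE
  set W := ∑ t ∈ Finset.Icc 2 (T + 1), (t : ℝ) with hW
  have hWge : (T : ℝ) ^ 2 / 2 ≤ W := sum_Icc_two_ge T
  have hW0 : 0 < W := lt_of_lt_of_le (by positivity) hWge
  have hm : 0 < (μ⁻¹ + γ) * W := by positivity
  refine (MeanSqLE.of_le_add (a := 2 / ((μ⁻¹ + γ) * W) ^ 2)
    (b := 2 * (γ / 3 * (T + 1) ^ 2) ^ 2 / ((μ⁻¹ + γ) * W) ^ 2) (by positivity) (by positivity)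
    (by positivity) (by positivity)
    ((hF.measurable_spgPotential ho hp T).mono (hF.le _) le_rfl) hQ hE fun ω => ?_).mono ?_
  · have h1 := spg_sub_eq (g := g) (h := h) (gS := gS) (dh := dh) (μ := μ) (γ := γ) (p := p)
      (x := x) (s := s) (show 1 ≤ T by omega) ω
    have h2 := norm_sub_le (spgPotential g h gS dh μ γ p x s T ω)
      ((γ / 3 * (T + 1) ^ 2) • spgErr g h gS dh μ γ p x s (T + 1) ω)
    rw [← h1, norm_smul, Real.norm_of_nonneg hm.le, norm_smul,
      Real.norm_of_nonneg (by positivity)] at h2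
    have h3 := pow_le_pow_left₀ (by positivity) h2 2
    rw [div_mul_eq_mul_div, div_mul_eq_mul_div, ← add_div, le_div_iff₀ (by positivity)]
    nlinarith [sq_nonneg (‖spgPotential g h gS dh μ γ p x s T ω‖
      - γ / 3 * (T + 1) ^ 2 * ‖spgErr g h gS dh μ γ p x s (T + 1) ω‖)]
  · have h1 := spg_error_constants hL hγ0 hγT hT' hu2 (show 0 ≤ 4 * G ^ 2 by positivity) hc hf
    have h2 : 2 * (γ / 3 * ((T : ℝ) + 1) ^ 2) ^ 2 * (c / (T + 3) ^ 2)
        ≤ 2 * (γ ^ 2 / 9) * (T + 1) ^ 2 * c := by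
      have h3 : ((T : ℝ) + 1) ^ 2 / (T + 3) ^ 2 ≤ 1 := by
        rw [div_le_one (by positivity)]; gcongr; norm_num
      have h4 : 2 * (γ / 3 * ((T : ℝ) + 1) ^ 2) ^ 2 * (c / (T + 3) ^ 2)
          = (((T : ℝ) + 1) ^ 2 / (T + 3) ^ 2) * (2 * (γ ^ 2 / 9) * (T + 1) ^ 2 * c) := by ring
      rw [h4]
      exact mul_le_of_le_one_left (by positivity) h3
    set Y := L ^ 2 * u2 + 4 * G ^ 2 / T with hY
    have hY0 : 0 ≤ Y := by positivity
    -- The total weight W is at least T²/2, so dividing by W² cancels the T⁴ of the numerator and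
    -- turns 2600 into 10400.
    have h5 : (T : ℝ) ^ 4 / 4 ≤ W ^ 2 := by
      have := pow_le_pow_left₀ (by positivity) hWge 2
      calc (T : ℝ) ^ 4 / 4 = ((T : ℝ) ^ 2 / 2) ^ 2 := by ring
        _ ≤ W ^ 2 := this
    have h6 : 2600 * (T : ℝ) ^ 4 * Y ≤ 10400 * Y * W ^ 2 := by nlinarith
    have h7 := (add_le_add_right h2 (2 * (3 * (γ ^ 2 / 9 * u2 + T * f)))).trans (h1.trans h6)
    have h8 : ∀ N A B a b : ℝ, A / N * a + B / N * b = (A * a + B * b) / N := fun _ _ _ _ _ => by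
      ring
    rw [h8]
    refine (div_le_div_of_nonneg_right h7 (sq_nonneg ((μ⁻¹ + γ) * W))).trans_eq ?_
    field_simp

end Stage

/-! ## Power sums -/

/-- Bernoulli's inequality bounds each increment of j^(α+1) by (α+1)j^α; the next lemma uses the
reverse inequality for exponents at most 1. -/
theorem rpow_le_mul_sum_rpow {α : ℝ} (hα : 0 ≤ α) (K : ℕ) :
    (K : ℝ) ^ (α + 1) ≤ (α + 1) * ∑ j ∈ Finset.Icc 1 K, (j : ℝ) ^ α := by
  induction K with
  | zero => simp [Real.zero_rpow (by linarith : α + 1 ≠ 0)]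
  | succ K ih =>
    rw [Finset.sum_Icc_succ_top (by omega), mul_add]
    have hK : (0 : ℝ) < (K + 1 : ℕ) := by positivity
    have h1 := one_add_mul_self_le_rpow_one_add (s := -(1 / ((K + 1 : ℕ) : ℝ))) (p := α + 1)
      (by rw [neg_le_neg_iff, div_le_one hK]; simp) (by linarith)
    have h2 : 1 + -(1 / ((K + 1 : ℕ) : ℝ)) = K / ((K + 1 : ℕ) : ℝ) := by
      rw [eq_div_iff hK.ne']; push_cast; field_simp; ring
    rw [h2, Real.div_rpow (by positivity) hK.le, le_div_iff₀ (by positivity)] at h1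
    have h3 : (((K + 1 : ℕ) : ℝ)) ^ (α + 1) = ((K + 1 : ℕ) : ℝ) ^ α * ((K + 1 : ℕ) : ℝ) := by
      rw [Real.rpow_add hK, Real.rpow_one]
    have h4 : (1 + (α + 1) * -(1 / ((K + 1 : ℕ) : ℝ))) * ((K + 1 : ℕ) : ℝ) ^ (α + 1)
        = ((K + 1 : ℕ) : ℝ) ^ (α + 1) - (α + 1) * ((K + 1 : ℕ) : ℝ) ^ α := by
      rw [h3]; field_simp; ring
    linarith

theorem sum_rpow_sub_one_le {β : ℝ} (hβ : 0 < β) (hβ1 : β ≤ 1) (K : ℕ) :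
    β * ∑ j ∈ Finset.Icc 1 K, (j : ℝ) ^ (β - 1) ≤ (K : ℝ) ^ β := by
  induction K with
  | zero => simp [Real.zero_rpow hβ.ne']
  | succ K ih =>
    rw [Finset.sum_Icc_succ_top (by omega), mul_add]
    have hK : (0 : ℝ) < (K + 1 : ℕ) := by positivity
    have h1 := rpow_one_add_le_one_add_mul_self (s := -(1 / ((K + 1 : ℕ) : ℝ))) (p := β)
      (by rw [neg_le_neg_iff, div_le_one hK]; simp) hβ.le hβ1
    have h2 : 1 + -(1 / ((K + 1 : ℕ) : ℝ)) = K / ((K + 1 : ℕ) : ℝ) := by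
      rw [eq_div_iff hK.ne']; push_cast; field_simp; ring
    rw [h2, Real.div_rpow (by positivity) hK.le, div_le_iff₀ (by positivity)] at h1
    have h3 : ((K + 1 : ℕ) : ℝ) ^ β = ((K + 1 : ℕ) : ℝ) ^ (β - 1) * ((K + 1 : ℕ) : ℝ) := by
      rw [← Real.rpow_add_one hK.ne', sub_add_cancel]
    have h4 : (1 + β * -(1 / ((K + 1 : ℕ) : ℝ))) * ((K + 1 : ℕ) : ℝ) ^ β
        = ((K + 1 : ℕ) : ℝ) ^ β - β * ((K + 1 : ℕ) : ℝ) ^ (β - 1) := by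
      rw [h3]; field_simp; ring
    linarith

/-- The telescoping is done in `ENNReal` and at every k ≤ K, so it yields both a uniform bound on
the expected gap and a bound on the summed squared residuals. -/
theorem sum_descent_le {a u err : ℕ → ENNReal} {κ : ENNReal} {K : ℕ}
    (h : ∀ k ∈ Finset.Icc 1 K, a (k + 1) + κ * u k ≤ a k + err k) (k : ℕ) (hk : k ≤ K) :
    a (k + 1) + κ * ∑ j ∈ Finset.Icc 1 k, u j ≤ a 1 + ∑ j ∈ Finset.Icc 1 k, err j := by
  induction k with
  | zero => simp
  | succ k ih =>
    rw [Finset.sum_Icc_succ_top (by omega), Finset.sum_Icc_succ_top (by omega), mul_add]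
    calc a (k + 1 + 1) + (κ * ∑ j ∈ Finset.Icc 1 k, u j + κ * u (k + 1))
        = (a (k + 1 + 1) + κ * u (k + 1)) + κ * ∑ j ∈ Finset.Icc 1 k, u j := by ring
      _ ≤ (a (k + 1) + err (k + 1)) + κ * ∑ j ∈ Finset.Icc 1 k, u j :=
          add_le_add_left (h _ (Finset.mem_Icc.mpr ⟨by omega, hk⟩)) _
      _ = (a (k + 1) + κ * ∑ j ∈ Finset.Icc 1 k, u j) + err (k + 1) := by ring
      _ ≤ (a 1 + ∑ j ∈ Finset.Icc 1 k, err j) + err (k + 1) := add_le_add_left (ih (by omega)) _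
      _ = _ := by ring

/-! ## The random stage -/

section RandomStage

variable {Ω S ι : Type*} [MeasurableSpace Ω] [MeasurableSpace S] {P : Measure Ω}
    {q : Measure S} {s : ι → Ω → S} {K : ℕ} {α : ℝ} {τ : Ω → ℕ}

/-- Each weight is at most K^α, while the normalizing sum is at least K^(α+1)/(α+1). Thus τ is
uniform up to the factor α + 1. -/
theorem IsRandomRun.stage_prob_le (hrun : IsRandomRun P q s K α τ) (hα : 0 ≤ α) {k : ℕ}
    (hk : k ∈ Finset.Icc 1 K) : P {ω | τ ω = k} ≤ ENNReal.ofReal ((α + 1) / K) := by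
  obtain ⟨hk1, hkK⟩ := Finset.mem_Icc.mp hk
  have hK : (0 : ℝ) < K := by exact_mod_cast (by omega : 0 < K)
  rw [hrun.law_stage k hk]
  refine ENNReal.ofReal_le_ofReal ?_
  have h1 := rpow_le_mul_sum_rpow hα K
  have hpos : 0 < ∑ j ∈ Finset.Icc 1 K, (j : ℝ) ^ α :=
    Finset.sum_pos (fun j hj => by
      have : (0 : ℝ) < j := by exact_mod_cast (Finset.mem_Icc.mp hj).1
      positivity) ⟨k, hk⟩
  rw [div_le_div_iff₀ hpos hK]
  have h2 : (k : ℝ) ^ α ≤ (K : ℝ) ^ α :=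
    Real.rpow_le_rpow (by positivity) (by exact_mod_cast hkK) hα
  rw [Real.rpow_add hK, Real.rpow_one] at h1
  nlinarith

theorem IsRandomRun.sum_stage_prob (hrun : IsRandomRun P q s K α τ) (hK : 1 ≤ K) :
    ∑ k ∈ Finset.Icc 1 K, P {ω | τ ω = k} = 1 := by
  have hpos : 0 < ∑ j ∈ Finset.Icc 1 K, (j : ℝ) ^ α :=
    Finset.sum_pos (fun j hj => by
      have : (0 : ℝ) < j := by exact_mod_cast (Finset.mem_Icc.mp hj).1
      positivity) ⟨1, Finset.mem_Icc.mpr ⟨le_rfl, hK⟩⟩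
  rw [Finset.sum_congr rfl hrun.law_stage, ← ENNReal.ofReal_sum_of_nonneg
    fun k _ => by positivity, ← Finset.sum_div, div_self hpos.ne', ENNReal.ofReal_one]

theorem IsRandomRun.ae_mem (hrun : IsRandomRun P q s K α τ) (hK : 1 ≤ K) :
    ∀ᵐ ω ∂P, τ ω ∈ Finset.Icc 1 K := by
  have := hrun.prob
  have hms : MeasurableSet {ω | τ ω ∈ Finset.Icc 1 K} :=
    hrun.meas_stage (Finset.Icc 1 K).measurableSet
  have h1 : P {ω | τ ω ∈ Finset.Icc 1 K} = 1 := by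
    rw [← hrun.sum_stage_prob hK, ← measure_biUnion_finset]
    · congr 1; ext ω; simp
    · intro i _ j _ hij
      exact Set.disjoint_left.mpr fun ω hi hj => hij (Eq.trans (Eq.symm hi) hj)
    · exact fun k _ => hrun.meas_stage (measurableSet_singleton k)
  exact (prob_compl_eq_zero_iff hms).mpr h1

/-- The stage iterates are functions of the samples alone, hence independent of τ, so the
expectation at the random stage factors over the values of τ. -/
theorem IsRandomRun.lintegral_stage (hrun : IsRandomRun P q s K α τ) (hK : 1 ≤ K)
    {f : ℕ → (ι → S) → ENNReal} (hf : ∀ k, Measurable (f k)) :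
    ∫⁻ ω, f (τ ω) (fun i => s i ω) ∂P
      = ∑ k ∈ Finset.Icc 1 K, P {ω | τ ω = k} * ∫⁻ ω, f k (fun i => s i ω) ∂P := by
  have hS : Measurable fun ω i => s i ω := measurable_pi_lambda _ hrun.meas
  have h1 : ∫⁻ ω, f (τ ω) (fun i => s i ω) ∂P = ∫⁻ ω, ∑ k ∈ Finset.Icc 1 K,
      (({k} : Set ℕ).indicator 1 (τ ω) * f k (fun i => s i ω)) ∂P := by
    refine lintegral_congr_ae ?_
    filter_upwards [hrun.ae_mem hK] with ω hω
    rw [Finset.sum_eq_single (τ ω)]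
    · simp
    · intro k _ hk
      rw [Set.indicator_of_notMem (by simpa using hk.symm), zero_mul]
    · exact fun h => absurd hω h
  have hi : ∀ k : ℕ, Measurable fun ω => (({k} : Set ℕ).indicator (1 : ℕ → ENNReal) (τ ω)) :=
    fun k => (measurable_of_countable (({k} : Set ℕ).indicator (1 : ℕ → ENNReal))).comp
      hrun.meas_stage
  have hfS : ∀ k, Measurable fun ω => f k (fun i => s i ω) := fun k => (hf k).comp hS
  refine h1.trans ((lintegral_finsetSum _ fun k _ => (hi k).mul (hfS k)).trans ?_)
  refine Finset.sum_congr rfl fun k _ => ?_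
  have h2 : IndepFun (fun ω => (({k} : Set ℕ).indicator (1 : ℕ → ENNReal) (τ ω)))
      (fun ω => f k (fun i => s i ω)) P :=
    hrun.indep_stage.comp
      (measurable_of_countable (({k} : Set ℕ).indicator (1 : ℕ → ENNReal))) (hf k)
  have h3 := lintegral_mul_eq_lintegral_mul_lintegral_of_indepFun (hi k) (hfS k) h2
  refine h3.trans (congrArg (· * _) ?_)
  have h4 : (fun ω => (({k} : Set ℕ).indicator (1 : ℕ → ENNReal) (τ ω)))
      = {ω | τ ω = k}.indicator 1 := by
    ext ω; simp [Set.indicator_apply]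
  rw [h4]
  exact lintegral_indicator_one (hrun.meas_stage (measurableSet_singleton k))

theorem IsRandomRun.measurable_output {E : Type*} [MeasurableSpace E]
    (hrun : IsRandomRun P q s K α τ) {X : ℕ → (ι → S) → E} (hX : ∀ k, Measurable (X k)) :
    Measurable fun ω => X (τ ω) (fun i => s i ω) := by
  have h1 : Measurable fun w : ℕ × (ι → S) => X w.1 w.2 :=
    measurable_from_prod_countable_right hX
  exact h1.comp (hrun.meas_stage.prodMk (measurable_pi_lambda _ hrun.meas))

theorem IsRandomRun.lintegral_output_le {E : Type*} [MeasurableSpace E]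
    (hrun : IsRandomRun P q s K α τ) (hK : 1 ≤ K) (hα : 0 ≤ α)
    {X : ℕ → (ι → S) → E} (hX : ∀ k, Measurable (X k)) {a b : E → ENNReal}
    (ha : Measurable a) (hb : Measurable b) {A₀ B : ENNReal}
    (hA : ∀ k ∈ Finset.Icc 1 K, ∫⁻ ω, a (X k fun i => s i ω) ∂P ≤ A₀)
    (hB : ∑ k ∈ Finset.Icc 1 K, ∫⁻ ω, b (X k fun i => s i ω) ∂P ≤ B) (c₀ c₁ c₂ : ENNReal) :
    ∫⁻ ω, (c₀ + c₁ * a (X (τ ω) fun i => s i ω) + c₂ * b (X (τ ω) fun i => s i ω)) ∂P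
      ≤ c₀ + c₁ * A₀ + c₂ * (ENNReal.ofReal ((α + 1) / K) * B) := by
  have := hrun.prob
  have hS : Measurable fun ω i => s i ω := measurable_pi_lambda _ hrun.meas
  rw [hrun.lintegral_stage hK (f := fun k S => c₀ + c₁ * a (X k S) + c₂ * b (X k S))
    fun k => (measurable_const.add ((ha.comp (hX k)).const_mul _)).add
      ((hb.comp (hX k)).const_mul _)]
  calc _ ≤ ∑ k ∈ Finset.Icc 1 K, (P {ω | τ ω = k} * (c₀ + c₁ * A₀)
        + c₂ * (ENNReal.ofReal ((α + 1) / K) * ∫⁻ ω, b (X k fun i => s i ω) ∂P)) := by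
        refine Finset.sum_le_sum fun k hk => ?_
        have ham : Measurable fun ω => a (X k fun i => s i ω) := (ha.comp (hX k)).comp hS
        have hbm : Measurable fun ω => b (X k fun i => s i ω) := (hb.comp (hX k)).comp hS
        rw [lintegral_add_right _ (hbm.const_mul _), lintegral_add_left measurable_const,
          lintegral_const_mul _ ham, lintegral_const_mul _ hbm, lintegral_const, measure_univ,
          mul_one, mul_add]
        refine add_le_add (by gcongr; exact hA k hk) ?_
        calc _ = c₂ * (P {ω | τ ω = k} * ∫⁻ ω, b (X k fun i => s i ω) ∂P) := by ring
          _ ≤ _ := by gcongr; exact hrun.stage_prob_le hα hk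
    _ = c₀ + c₁ * A₀ + c₂ * (ENNReal.ofReal ((α + 1) / K)
          * ∑ k ∈ Finset.Icc 1 K, ∫⁻ ω, b (X k fun i => s i ω) ∂P) := by
        rw [Finset.sum_add_distrib, ← Finset.sum_mul, hrun.sum_stage_prob hK, one_mul,
          ← Finset.mul_sum, ← Finset.mul_sum]
    _ ≤ _ := by gcongr

end RandomStage

/-! ## Near criticality of the output -/

/-- This replaces fractional powers by affine functions of squares, so that only expectations of the
gap and of squared residuals need to be controlled, and Jensen's inequality for the power ν is
avoided. -/
theorem rpow_le_mul_one_add_sq {t ε ν : ℝ} (ht : 0 ≤ t) (hε : 0 < ε) (hν : 0 < ν) (hν1 : ν ≤ 1) :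
    t ^ ν ≤ ε ^ ν * (1 + t ^ 2 / ε ^ 2) := by
  have h1 : t ^ ν = ε ^ ν * (t / ε) ^ ν := by
    rw [← Real.mul_rpow hε.le (by positivity), mul_div_cancel₀ _ hε.ne']
  have h2 : (t / ε) ^ ν ≤ 1 + (t / ε) ^ 2 := by
    have h0 : 0 ≤ t / ε := by positivity
    rcases le_total (t / ε) 1 with h | h
    · linarith [Real.rpow_le_one h0 h hν.le, sq_nonneg (t / ε)]
    · have := Real.rpow_le_rpow_of_exponent_le h (show ν ≤ 2 by linarith)
      rw [Real.rpow_two] at this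
      linarith
  rw [h1, ← div_pow]
  gcongr

theorem upperExp_le_lintegral {Ω : Type*} [MeasurableSpace Ω] (P : Measure Ω)
    {f φ : Ω → ENNReal} (hφ : Measurable φ) (h : ∀ ω, f ω ≤ φ ω) :
    upperExp P f ≤ ∫⁻ ω, φ ω ∂P :=
  iInf_le_of_le φ (iInf_le_of_le hφ (iInf_le_of_le h le_rfl))

theorem isNearlyCritical_of_bounds {d : ℕ} {Ω S ι : Type*} [MeasurableSpace Ω]
    [MeasurableSpace S] {P : Measure Ω} {q : Measure S} {s : ι → Ω → S} {K : ℕ} {α : ℝ}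
    {τ : Ω → ℕ} (hrun : IsRandomRun P q s K α τ) (hK : 1 ≤ K) (hα : 0 ≤ α)
    {g h : RVec d → ℝ} {r : RVec d → EReal} {p : RVec d → RVec d} {L ν μ ε cw A₀ B CU C : ℝ}
    (hL : 0 < L) (hν : 0 < ν) (hν1 : ν ≤ 1) (hμ : 0 < μ) (hε : 0 < ε) (hε1 : ε ≤ 1)
    (hcw0 : 0 ≤ cw) (hA0 : 0 ≤ A₀) (hCU : 0 ≤ CU)
    (hg : IsLSmooth L g) (hh : HasHolderGradient L ν h) (hr : IsProperLSC r)
    (hp : IsProxSelection r μ p) {X : ℕ → (ι → S) → RVec d} (hX : ∀ k, Measurable (X k))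
    {gap : RVec d → ℝ} (hgap : Measurable gap) (hgap0 : ∀ x, 0 ≤ gap x)
    (hcw : ∀ x, ‖x - p x‖ ^ 2 ≤ cw * ε ^ 2 * (gap x + 1))
    (hA : ∀ k ∈ Finset.Icc 1 K,
      ∫⁻ ω, ENNReal.ofReal (gap (X k fun i => s i ω)) ∂P ≤ ENNReal.ofReal A₀)
    (hB : ∑ k ∈ Finset.Icc 1 K,
      ∫⁻ ω, ‖proxResidual g h μ p (X k fun i => s i ω)‖ₑ ^ 2 ∂P ≤ ENNReal.ofReal B)
    (hBK : (α + 1) / K * B ≤ CU * ε ^ (2 * ν))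
    (hC : (1 + 2 * L) * (1 + cw * (A₀ + 1)) + CU ≤ C) :
    IsNearlyCritical P g h r p ν C ε (fun ω => X (τ ω) (fun i => s i ω)) := by
  have hout := hrun.measurable_output hX
  have ha : Measurable fun x => ENNReal.ofReal (gap x) := hgap.ennreal_ofReal
  have hb : Measurable fun x => ‖proxResidual g h μ p x‖ₑ ^ 2 :=
    (hp.measurable_proxResidual g h).enorm.pow_const 2
  have hbound : ∀ c₀ c₁ c₂ : ℝ, 0 ≤ c₀ → 0 ≤ c₁ → 0 ≤ c₂ → ∀ φ : RVec d → RVec d,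
      (∀ x, ‖φ x‖ ≤ c₀ + c₁ * gap x + c₂ * ‖proxResidual g h μ p x‖ ^ 2) →
      ∫⁻ ω, ‖φ (X (τ ω) (fun i => s i ω))‖ₑ ∂P
        ≤ ENNReal.ofReal (c₀ + c₁ * A₀ + c₂ * (CU * ε ^ (2 * ν))) := by
    intro c₀ c₁ c₂ h0 h1 h2 φ hφ
    refine (lintegral_mono fun ω => ?_).trans ((hrun.lintegral_output_le hK hα hX ha hb hA hB
      (ENNReal.ofReal c₀) (ENNReal.ofReal c₁) (ENNReal.ofReal c₂)).trans ?_)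
    · have hgx := hgap0 (X (τ ω) (fun i => s i ω))
      rw [enorm_sq_eq_ofReal, ← ENNReal.ofReal_mul h1, ← ENNReal.ofReal_mul h2,
        ← ENNReal.ofReal_add h0 (by positivity), ← ENNReal.ofReal_add (by positivity)
        (by positivity), ← ofReal_norm]
      exact ENNReal.ofReal_le_ofReal (hφ _)
    · rw [← ENNReal.ofReal_mul (by positivity : 0 ≤ (α + 1) / K), ← ENNReal.ofReal_mul h1,
        ← ENNReal.ofReal_add h0 (by positivity)]
      have h3 : ENNReal.ofReal ((α + 1) / K * B) ≤ ENNReal.ofReal (CU * ε ^ (2 * ν)) :=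
        ENNReal.ofReal_le_ofReal hBK
      calc _ ≤ ENNReal.ofReal (c₀ + c₁ * A₀)
            + ENNReal.ofReal c₂ * ENNReal.ofReal (CU * ε ^ (2 * ν)) := by gcongr
        _ = _ := by
          rw [← ENNReal.ofReal_mul h2, ← ENNReal.ofReal_add (by positivity) (by positivity)]
  have hdist : ∀ (x : RVec d) (η : ℝ), 0 < η → η ≤ 1 →
      ‖x - p x‖ ^ η ≤ ε ^ η * (1 + cw * (gap x + 1)) := by
    intro x η hη hη1
    refine (rpow_le_mul_one_add_sq (norm_nonneg _) hε hη hη1).trans ?_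
    gcongr
    rw [div_le_iff₀ (by positivity)]
    linarith [hcw x]
  have hdist1 : ∀ x, ‖x - p x‖ ≤ ε * (1 + cw * (gap x + 1)) := by
    intro x
    simpa using hdist x 1 one_pos le_rfl
  have hY : 0 ≤ 1 + cw * (A₀ + 1) := by positivity
  constructor
  · have hm : Measurable fun ω => ‖X (τ ω) (fun i => s i ω) - p (X (τ ω) (fun i => s i ω))‖ₑ :=
      (hout.sub (hp.1.comp hout)).enorm
    refine (upperExp_le_lintegral P hm fun _ => le_rfl).trans
      ((hbound (ε * (1 + cw)) (ε * cw) 0 (by positivity) (by positivity) le_rfl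
        (fun x => x - p x) fun x => ?_).trans (ENNReal.ofReal_le_ofReal ?_))
    · have := hdist1 x; linarith
    · nlinarith [mul_nonneg hε.le (mul_nonneg hL.le hY), mul_nonneg hε.le hCU]
  · have hm : Measurable fun ω => ‖proxDefect g h μ p (X (τ ω) (fun i => s i ω))‖ₑ :=
      ((hp.measurable_proxDefect g h).comp hout).enorm
    have hεν : 0 < ε ^ ν := by positivity
    have hsq : (ε ^ ν) ^ 2 = ε ^ (2 * ν) := by
      rw [← Real.rpow_natCast, ← Real.rpow_mul hε.le]; congr 1; push_cast; ring
    have hle : ε ≤ ε ^ ν := by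
      simpa using Real.rpow_le_rpow_of_exponent_ge hε hε1 hν1
    -- The criticality distance is majorized by the norm of the defect, which is measurable. The
    -- residual itself is linearized at scale ε^ν, which produces the weight ε^ν/ε^(2ν) on its
    -- square.
    refine (upperExp_le_lintegral P hm fun ω => hr.critDist_le hp hμ g h _).trans
      ((hbound (ε ^ ν * (1 + 2 * L * (1 + cw))) (ε ^ ν * (2 * L * cw)) (ε ^ ν / ε ^ (2 * ν))
        (by positivity) (by positivity) (by positivity) (proxDefect g h μ p) fun x => ?_).trans
        (ENNReal.ofReal_le_ofReal ?_))
    · have h1 := norm_proxDefect_le (μ := μ) (p := p) hg hh x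
      have h2 := rpow_le_mul_one_add_sq (norm_nonneg (proxResidual g h μ p x)) hεν one_pos le_rfl
      rw [Real.rpow_one, Real.rpow_one, hsq] at h2
      have h3 := mul_le_mul_of_nonneg_left (hdist x ν hν hν1) hL.le
      have h4 : ‖x - p x‖ ≤ ε ^ ν * (1 + cw * (gap x + 1)) :=
        (hdist1 x).trans (mul_le_mul_of_nonneg_right hle
          (by have := hgap0 x; positivity))
      have h5 := mul_le_mul_of_nonneg_left h4 hL.le
      have h6 : ε ^ ν * (1 + ‖proxResidual g h μ p x‖ ^ 2 / ε ^ (2 * ν))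
          = ε ^ ν + ε ^ ν / ε ^ (2 * ν) * ‖proxResidual g h μ p x‖ ^ 2 := by ring
      rw [h6] at h2
      nlinarith
    · have h7 : ε ^ ν / ε ^ (2 * ν) * (CU * ε ^ (2 * ν)) = ε ^ ν * CU := by
        field_simp
      rw [h7]
      have h8 : ε ^ ν * ((1 + 2 * L) * (1 + cw * (A₀ + 1)) + CU) ≤ ε ^ ν * C := by gcongr
      nlinarith [mul_nonneg hεν.le (mul_nonneg hcw0 (by linarith : 0 ≤ A₀ + 1))]

/-! ## The gap of the smoothed objective -/

/-- The excess of the smoothed objective at `x` over its lower bound `F_μ(x₁) - Δ`. -/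
noncomputable def smoothGap {d : ℕ} (g h : RVec d → ℝ) (r : RVec d → EReal) (μ : ℝ)
    (p : RVec d → RVec d) (x₁ : RVec d) (Δ : ℝ) (x : RVec d) : ℝ :=
  smoothVal g h r μ p x - smoothVal g h r μ p x₁ + Δ

section Gap

variable {d : ℕ} {g h : RVec d → ℝ} {r : RVec d → EReal} {μ L Δ : ℝ} {p : RVec d → RVec d}
  {x₁ : RVec d}

theorem IsProperLSC.smoothGap_nonneg (hr : IsProperLSC r) (hp : IsProxSelection r μ p)
    (hΔ : ∀ x, smoothedObj g h r μ x₁ ≤ smoothedObj g h r μ x + (Δ : EReal)) (x : RVec d) :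
    0 ≤ smoothGap g h r μ p x₁ Δ x := by
  have h1 := hΔ x
  rw [hr.smoothedObj_eq hp, hr.smoothedObj_eq hp] at h1
  have h2 : smoothVal g h r μ p x₁ ≤ smoothVal g h r μ p x + Δ := by exact_mod_cast h1
  unfold smoothGap
  linarith

theorem IsProperLSC.smoothGap_descent (hr : IsProperLSC r) (hp : IsProxSelection r μ p)
    (hμ : 0 < μ) (hg : IsLSmooth L g) (hh : ConvexOn ℝ Set.univ h) (hd : Differentiable ℝ h)
    {m : ℝ} (hm : 16 * L ≤ μ⁻¹) (hmμ : μ⁻¹ ≤ m) (x y : RVec d) :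
    smoothGap g h r μ p x₁ Δ y + 1 / (4 * m) * ‖proxResidual g h μ p x‖ ^ 2
      ≤ smoothGap g h r μ p x₁ Δ x + m * ‖y - (x - m⁻¹ • proxResidual g h μ p x)‖ ^ 2 := by
  have hμ' : 0 < μ⁻¹ := inv_pos.mpr hμ
  refine descent_step (M := L + μ⁻¹ / 2) (by linarith) (by linarith) x y _ ?_
  have := hr.smoothVal_le_quadratic hp hg hh hd x y
  unfold smoothGap
  linarith

/-- Under a lower bound on `r`, the proximal displacement is controlled by the gap. -/
theorem IsProperLSC.exists_norm_sub_prox_sq_le (hr : IsProperLSC r) (hb : RegBddBelow r)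
    {μbar : ℝ} (hμbar : 0 < μbar)
    (hΔ : ∀ μ : ℝ, 0 < μ → μ ≤ μbar → ∀ x,
      smoothedObj g h r μ x₁ ≤ smoothedObj g h r μ x + (Δ : EReal)) :
    ∃ c : ℝ, 0 ≤ c ∧ ∀ μ, 0 < μ → μ ≤ μbar / 2 → ∀ p, IsProxSelection r μ p → ∀ x,
      ‖x - p x‖ ^ 2 ≤ c * μ * (smoothGap g h r μ p x₁ Δ x + 1) := by
  obtain ⟨b, hb⟩ := hb
  obtain ⟨x₀, hx₀⟩ := hr.2.2
  set B₀ := g x₁ - h x₁ + b - Δ with hB₀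
  set B₁ := g x₀ - h x₀ + (r x₀).toReal + Δ with hB₁
  refine ⟨4 * max 1 (B₁ - Δ - B₀), by positivity, fun μ hμ hμ2 p hp x => ?_⟩
  have hgap := hr.smoothGap_nonneg hp (hΔ μ hμ (by linarith))
  -- The lower bound on F at the fixed parameter μbar, tested with p x, controls g − h + r(p x) up
  -- to a quadratic whose coefficient does not depend on μ. No lower bound on g − h is required.
  have h1 : B₀ ≤ g x - h x + 1 / (2 * μbar) * ‖p x - x‖ ^ 2 + (r (p x)).toReal := by
    have h2 : ((g x₁ - h x₁ + b : ℝ) : EReal) ≤ smoothedObj g h r μbar x₁ := by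
      rw [smoothedObj, EReal.coe_add]
      refine add_le_add le_rfl (le_iInf fun y => ?_)
      calc (b : EReal) = ((0 : ℝ) : EReal) + (b : EReal) := by simp
        _ ≤ _ := add_le_add (EReal.coe_le_coe_iff.mpr (by positivity)) (hb y)
    have h3 : smoothedObj g h r μbar x
        ≤ ((g x - h x + (1 / (2 * μbar) * ‖p x - x‖ ^ 2 + (r (p x)).toReal) : ℝ) : EReal) := by
      rw [smoothedObj, EReal.coe_add, EReal.coe_add _ (r (p x)).toReal, hr.coe_prox hp]
      exact add_le_add le_rfl (iInf_le _ (p x))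
    have h4 := h2.trans ((hΔ μbar hμbar le_rfl x).trans (add_le_add h3 le_rfl))
    rw [← EReal.coe_add, EReal.coe_le_coe_iff] at h4
    linarith
  -- F_μ(x₁) ≤ F_μ(x₀) + Δ, and F_μ(x₀) is bounded independently of μ because r(x₀) is finite.
  have h5 : smoothVal g h r μ p x₁ ≤ B₁ := by
    have h6 := hgap x₀
    have h7 := hr.proxVal_le_toReal hp x₀ x₀ hx₀
    rw [sub_self, norm_zero] at h7
    simp only [smoothGap, smoothVal] at h6 ⊢
    rw [hB₁]
    linarith
  have h8 : smoothVal g h r μ p x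
      = g x - h x + (1 / (2 * μ) * ‖p x - x‖ ^ 2 + (r (p x)).toReal) := rfl
  -- For μ ≤ μbar/2 half of the proximal quadratic pays for the one at μbar, and the other half, of
  -- coefficient 1/(4μ), survives.
  have h9 : 1 / (2 * μbar) ≤ 1 / (4 * μ) :=
    one_div_le_one_div_of_le (by positivity) (by linarith)
  have h10 : 1 / (2 * μ) = 1 / (4 * μ) + 1 / (4 * μ) := by field_simp; norm_num
  have h11 : 1 / (4 * μ) * ‖p x - x‖ ^ 2
      ≤ smoothGap g h r μ p x₁ Δ x + (B₁ - Δ - B₀) := by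
    have h12 := mul_le_mul_of_nonneg_right h9 (sq_nonneg ‖p x - x‖)
    rw [h10] at h8
    unfold smoothGap
    nlinarith
  rw [div_mul_eq_mul_div, one_mul, div_le_iff₀ (by positivity)] at h11
  rw [norm_sub_rev]
  refine h11.trans ?_
  have h13 := le_max_left 1 (B₁ - Δ - B₀)
  have h14 := le_max_right 1 (B₁ - Δ - B₀)
  have h15 : smoothGap g h r μ p x₁ Δ x + (B₁ - Δ - B₀)
      ≤ max 1 (B₁ - Δ - B₀) * (smoothGap g h r μ p x₁ Δ x + 1) := by
    nlinarith [hgap x]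
  nlinarith

end Gap

/-! ## Parameters -/

section Parameters

variable {ε A e : ℝ} {K : ℕ}

theorem stageCount_bounds (hε : 0 < ε) (hε1 : ε ≤ 1) (hA : 0 < A) (he : 0 ≤ e)
    (hK : K = ⌈A / ε ^ e⌉₊) : 1 ≤ K ∧ A / ε ^ e ≤ K ∧ (K : ℝ) ≤ (A + 1) / ε ^ e := by
  have hpos : 0 < A / ε ^ e := by positivity
  refine ⟨hK ▸ Nat.one_le_iff_ne_zero.mpr (Nat.ceil_pos.mpr hpos).ne', hK ▸ Nat.le_ceil _, ?_⟩
  have h1 := Nat.ceil_lt_add_one hpos.le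
  rw [← hK] at h1
  have h2 : 1 ≤ 1 / ε ^ e := by
    rw [le_div_iff₀ (by positivity), one_mul]
    exact Real.rpow_le_one hε.le hε1 he
  rw [add_div]
  linarith

/-- As K is of order ε^(−e), this keeps both μγ_k and the accumulated SPG noise bounded whenever βe
≤ m. -/
theorem stageCount_rpow_le (hε : 0 < ε) (hε1 : ε ≤ 1) (hA : 0 < A) (he : 0 ≤ e)
    (hK : K = ⌈A / ε ^ e⌉₊) {β : ℝ} (hβ : 0 ≤ β) {m : ℕ} (hm : β * e ≤ m) :
    (K : ℝ) ^ β * ε ^ m ≤ (A + 1) ^ β := by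
  have h1 := (stageCount_bounds hε hε1 hA he hK).2.2
  have h2 := Real.rpow_le_rpow (by positivity) h1 hβ
  rw [Real.div_rpow (by positivity) (by positivity), ← Real.rpow_mul hε.le] at h2
  have h3 : ε ^ m ≤ ε ^ (e * β) := by
    rw [← Real.rpow_natCast]
    exact Real.rpow_le_rpow_of_exponent_ge hε hε1 (by linarith)
  calc (K : ℝ) ^ β * ε ^ m ≤ (A + 1) ^ β / ε ^ (e * β) * ε ^ (e * β) := by gcongr
    _ = (A + 1) ^ β := div_mul_cancel₀ _ (by positivity)

end Parameters

/-- Near criticality from descent of the expected gap in every stage. -/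
theorem isNearlyCritical_of_descent {d : ℕ} {Ω S ι : Type*} [MeasurableSpace Ω]
    [MeasurableSpace S] {P : Measure Ω} {q : Measure S} {s : ι → Ω → S} {K : ℕ} {α : ℝ}
    {τ : Ω → ℕ} (hrun : IsRandomRun P q s K α τ) (hα : 0 ≤ α)
    {g h : RVec d → ℝ} {r : RVec d → EReal} {p : RVec d → RVec d} {L ν μ ε cw C : ℝ}
    (hL : 0 < L) (hν : 0 < ν) (hν1 : ν ≤ 1) (hε : 0 < ε) (hε1 : ε ≤ 1)
    {m : ℕ} (hμ : μ = ε ^ m) {A e β c : ℝ} (hA : 0 < A) (he : 0 ≤ e) (hβ : 0 ≤ β) (hc : 0 < c)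
    (hm : β * e ≤ m) (hme : 2 * ν + m ≤ e) (hK : K = ⌈A / ε ^ e⌉₊)
    {γ : ℕ → ℝ} (hγ : ∀ k, γ k = c * (k : ℝ) ^ β)
    (hcw0 : 0 ≤ cw) (hg : IsLSmooth L g) (hh : HasHolderGradient L ν h) (hr : IsProperLSC r)
    (hp : IsProxSelection r μ p) {x₁ : RVec d} {Δ Err : ℝ}
    (hΔ : ∀ x, smoothedObj g h r μ x₁ ≤ smoothedObj g h r μ x + (Δ : EReal))
    (hcw : ∀ x, ‖x - p x‖ ^ 2 ≤ cw * ε ^ 2 * (smoothGap g h r μ p x₁ Δ x + 1))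
    {X : ℕ → (ι → S) → RVec d} (hX : ∀ k, Measurable (X k)) (hX1 : ∀ S, X 1 S = x₁)
    {err : ℕ → ℝ} (herr : ∀ k ∈ Finset.Icc 1 K, 0 ≤ err k)
    (hErr : ∑ k ∈ Finset.Icc 1 K, err k ≤ Err)
    (hstage : ∀ k ∈ Finset.Icc 1 K,
      ∫⁻ ω, ENNReal.ofReal (smoothGap g h r μ p x₁ Δ (X (k + 1) fun i => s i ω)) ∂P
        + ENNReal.ofReal (1 / (8 * (μ⁻¹ + γ k)))
          * ∫⁻ ω, ‖proxResidual g h μ p (X k fun i => s i ω)‖ₑ ^ 2 ∂P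
      ≤ ∫⁻ ω, ENNReal.ofReal (smoothGap g h r μ p x₁ Δ (X k fun i => s i ω)) ∂P
        + ENNReal.ofReal (err k))
    (hC : (1 + 2 * L) * (1 + cw * (Δ + Err + 1))
      + 8 * (α + 1) * (1 + c * (A + 1) ^ β) * (Δ + Err) / A ≤ C) :
    IsNearlyCritical P g h r p ν C ε (fun ω => X (τ ω) (fun i => s i ω)) := by
  have := hrun.prob
  obtain ⟨hK1, hKge, -⟩ := stageCount_bounds hε hε1 hA he hK
  have hμ0 : 0 < μ := by rw [hμ]; positivity
  have hKpos : (0 : ℝ) < K := by exact_mod_cast hK1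
  have hgap0 := hr.smoothGap_nonneg hp hΔ
  have hΔ0 : 0 ≤ Δ := by
    have := hgap0 x₁; unfold smoothGap at this; linarith
  have hErr0 : 0 ≤ Err := (Finset.sum_nonneg herr).trans hErr
  set Cm := c * (A + 1) ^ β with hCm
  have hCm0 : 0 ≤ Cm := by positivity
  -- Since μγ_k is bounded, all the stage coefficients 1/(8(μ⁻¹ + γ_k)) are bounded below by one
  -- multiple κ of μ.
  have hγC : ∀ k ∈ Finset.Icc 1 K, μ / (8 * (1 + Cm)) ≤ 1 / (8 * (μ⁻¹ + γ k)) := by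
    intro k hk
    have hγk : 0 ≤ γ k := by rw [hγ]; positivity
    have h1 : γ k * μ ≤ Cm := by
      rw [hγ, hμ, hCm, mul_assoc]
      refine mul_le_mul_of_nonneg_left (le_trans ?_ (stageCount_rpow_le hε hε1 hA he hK hβ hm))
        hc.le
      have : (k : ℝ) ≤ K := by exact_mod_cast (Finset.mem_Icc.mp hk).2
      gcongr
    have hμ' : 0 < μ⁻¹ := inv_pos.mpr hμ0
    rw [div_le_div_iff₀ (by positivity) (by positivity)]
    have : μ * μ⁻¹ = 1 := mul_inv_cancel₀ hμ0.ne'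
    nlinarith
  set κ := μ / (8 * (1 + Cm)) with hκ
  have hκ0 : 0 < κ := by positivity
  have hsum := sum_descent_le (K := K)
    (a := fun k => ∫⁻ ω, ENNReal.ofReal (smoothGap g h r μ p x₁ Δ (X k fun i => s i ω)) ∂P)
    (u := fun k => ∫⁻ ω, ‖proxResidual g h μ p (X k fun i => s i ω)‖ₑ ^ 2 ∂P)
    (err := fun k => ENNReal.ofReal (err k)) (κ := ENNReal.ofReal κ)
    (fun k hk => le_trans (by gcongr; exact hγC k hk) (hstage k hk))
  have hinit : ∫⁻ ω, ENNReal.ofReal (smoothGap g h r μ p x₁ Δ (X 1 fun i => s i ω)) ∂P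
      = ENNReal.ofReal Δ := by
    simp [hX1, smoothGap]
  have htot : ∀ k ≤ K, ENNReal.ofReal Δ + ∑ j ∈ Finset.Icc 1 k, ENNReal.ofReal (err j)
      ≤ ENNReal.ofReal (Δ + Err) := by
    intro k hk
    have hsub : Finset.Icc 1 k ⊆ Finset.Icc 1 K := Finset.Icc_subset_Icc_right hk
    rw [ENNReal.ofReal_add hΔ0 hErr0,
      ← ENNReal.ofReal_sum_of_nonneg fun j hj => herr j (hsub hj)]
    gcongr
    exact (Finset.sum_le_sum_of_subset_of_nonneg hsub fun j hj _ => herr j hj).trans hErr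
  refine isNearlyCritical_of_bounds hrun hK1 hα (A₀ := Δ + Err) (B := (Δ + Err) / κ)
    (CU := 8 * (α + 1) * (1 + Cm) * (Δ + Err) / A) hL hν hν1 hμ0 hε hε1 hcw0 (by linarith)
    (by positivity) hg hh hr hp hX
    (((hr.measurable_smoothVal hp hg.1.continuous hh.1.continuous).sub_const _).add_const _)
    hgap0 hcw ?_ ?_ ?_ hC
  · intro k hk
    obtain ⟨hk1, hkK⟩ := Finset.mem_Icc.mp hk
    obtain ⟨j, rfl⟩ : ∃ j, k = j + 1 := ⟨k - 1, by omega⟩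
    have h1 := hsum j (by omega)
    rw [hinit] at h1
    exact le_self_add.trans (h1.trans (htot j (by omega)))
  · have h1 := hsum K le_rfl
    rw [hinit] at h1
    have h2 := le_add_self.trans (h1.trans (htot K le_rfl))
    rw [ENNReal.ofReal_div_of_pos hκ0, ENNReal.le_div_iff_mul_le
      (Or.inl (ENNReal.ofReal_pos.mpr hκ0).ne') (Or.inl ENNReal.ofReal_ne_top), mul_comm]
    exact h2
  · have h1 : (α + 1) / K * ((Δ + Err) / κ)
        = 8 * (α + 1) * (1 + Cm) * (Δ + Err) * (1 / (K * μ)) := by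
      rw [hκ]; field_simp
    -- The condition 2ν + m ≤ e enters here: Kμ ≥ A ε^(m−e) ≥ A ε^(−2ν).
    have h2 : 1 / (K * μ) ≤ ε ^ (2 * ν) / A := by
      rw [div_le_div_iff₀ (by positivity) hA, one_mul]
      have h3 : A ≤ K * ε ^ e := by rwa [div_le_iff₀ (by positivity)] at hKge
      have h4 : ε ^ e ≤ ε ^ (2 * ν) * μ := by
        rw [hμ, ← Real.rpow_natCast, ← Real.rpow_add hε]
        exact Real.rpow_le_rpow_of_exponent_ge hε hε1 hme
      nlinarith
    rw [h1]
    calc _ ≤ 8 * (α + 1) * (1 + Cm) * (Δ + Err) * (ε ^ (2 * ν) / A) := by gcongr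
      _ = _ := by ring

/-! ## Expected descent in one stage -/

section Descent

variable {d : ℕ} {Ω : Type*} {mΩ : MeasurableSpace Ω} {P : Measure Ω}

theorem lintegral_descent {gap : RVec d → ℝ} (hgap0 : ∀ x, 0 ≤ gap x) (hgap : Measurable gap)
    {U : RVec d → RVec d} {Y Y' E : Ω → RVec d} (hY : Measurable Y) (hY' : Measurable Y')
    {a m v : ℝ} (ha : 0 ≤ a) (hm : 0 ≤ m) (hE : MeanSqLE P E v)
    (h : ∀ ω, gap (Y' ω) + a * ‖U (Y ω)‖ ^ 2 ≤ gap (Y ω) + m * ‖E ω‖ ^ 2) :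
    ∫⁻ ω, ENNReal.ofReal (gap (Y' ω)) ∂P + ENNReal.ofReal a * ∫⁻ ω, ‖U (Y ω)‖ₑ ^ 2 ∂P
      ≤ ∫⁻ ω, ENNReal.ofReal (gap (Y ω)) ∂P + ENNReal.ofReal (m * v) := by
  have h1 : Measurable fun ω => ENNReal.ofReal (gap (Y' ω)) := (hgap.comp hY').ennreal_ofReal
  have h2 : Measurable fun ω => ENNReal.ofReal (gap (Y ω)) := (hgap.comp hY).ennreal_ofReal
  rw [← lintegral_const_mul' _ _ ENNReal.ofReal_ne_top, ← lintegral_add_left h1]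
  calc _ ≤ ∫⁻ ω, (ENNReal.ofReal (gap (Y ω)) + ENNReal.ofReal m * ‖E ω‖ₑ ^ 2) ∂P := by
        refine lintegral_mono fun ω => ?_
        simp only [enorm_sq_eq_ofReal]
        rw [← ENNReal.ofReal_mul ha, ← ENNReal.ofReal_mul hm,
          ← ENNReal.ofReal_add (hgap0 _) (by positivity),
          ← ENNReal.ofReal_add (hgap0 _) (by positivity)]
        exact ENNReal.ofReal_le_ofReal (h ω)
    _ ≤ _ := by
        rw [lintegral_add_left h2, lintegral_const_mul' _ _ ENNReal.ofReal_ne_top,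
          ENNReal.ofReal_mul hm]
        gcongr
        exact hE

end Descent

/-! ## SSDC with SPG -/

section SPG

variable {d : ℕ} {Ω Ξ Z : Type*} [MeasurableSpace Ξ] [MeasurableSpace Z]
    {g h : RVec d → ℝ} {r : RVec d → EReal} {pξ : Measure Ξ} {pς : Measure Z}
    {gS : Ξ → RVec d → ℝ} {hS : Z → RVec d → ℝ} {dh : RVec d → Z → RVec d} {G L μ Δ : ℝ}
    {γ : ℕ → ℝ} {T : ℕ → ℕ} {p : RVec d → RVec d} {x₁ : RVec d}

theorem measurable_ssdcSPG {m : MeasurableSpace Ω}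
    (hg : Measurable (fun q : RVec d × Ξ => gradient (gS q.2) q.1))
    (hh : Measurable (fun q : RVec d × Z => dh q.1 q.2)) (hp : Measurable p)
    {s : ℕ × ℕ → Ω → Ξ × Z} (k : ℕ) (hs : ∀ q : ℕ × ℕ, q.1 < k → Measurable (s q)) :
    Measurable fun ω => ssdcSPG gS dh μ p γ T x₁ (fun q => s q ω) k := by
  induction k with
  | zero => exact measurable_const
  | succ k ih =>
    match k, ih, hs with
    | 0, _, _ => exact measurable_const
    | k + 1, ih, hs =>
      have hx := ih fun q hq => hs q (by omega)
      have hpath : ∀ t, Measurable (spgPath gS dh μ (γ (k + 1)) p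
          (fun ω => ssdcSPG gS dh μ p γ T x₁ (fun q => s q ω) (k + 1))
          (fun t => s (k + 1, t)) t) :=
        fun t => measurable_spgPath hg hh hp hx t fun j _ => hs _ (Nat.lt_succ_self _)
      have hsum : Measurable fun ω => ∑ t ∈ Finset.Icc 2 (T (k + 1) + 1),
          (t : ℝ) • spgPath gS dh μ (γ (k + 1)) p
            (fun ω => ssdcSPG gS dh μ p γ T x₁ (fun q => s q ω) (k + 1))
            (fun t => s (k + 1, t)) t ω :=
        Finset.measurable_fun_sum _ fun t _ => (hpath t).const_smul (t : ℝ)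
      exact hsum.const_smul (∑ t ∈ Finset.Icc 2 (T (k + 1) + 1), (t : ℝ))⁻¹

/-- The information available before iteration `t` of stage `k`. -/
abbrev stagePast (s : ℕ × ℕ → Ω → Ξ × Z) (k t : ℕ) : MeasurableSpace Ω :=
  ⨆ q ∈ {q : ℕ × ℕ | q.1 < k ∨ (q.1 = k ∧ q.2 < t)}, MeasurableSpace.comap (s q) inferInstance

theorem measurable_stagePast {s : ℕ × ℕ → Ω → Ξ × Z} {k t : ℕ} {q : ℕ × ℕ}
    (hq : q.1 < k ∨ (q.1 = k ∧ q.2 < t)) : Measurable[stagePast s k t] (s q) :=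
  measurable_iff_comap_le.mpr
    (le_iSup₂_of_le (f := fun (q : ℕ × ℕ)
      (_ : q ∈ {q : ℕ × ℕ | q.1 < k ∨ (q.1 = k ∧ q.2 < t)}) =>
        MeasurableSpace.comap (s q) inferInstance) q hq le_rfl)

theorem isStageFiltration_stagePast {mΩ : MeasurableSpace Ω} {P : Measure Ω} {q : Measure (Ξ × Z)}
    {s : ℕ × ℕ → Ω → Ξ × Z} (hmeas : ∀ i, Measurable (s i)) (hlaw : ∀ i, P.map (s i) = q)
    (hindep : iIndepFun s P) {k : ℕ} {x : Ω → RVec d} (hx : Measurable[stagePast s k 1] x) :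
    IsStageFiltration P q (stagePast s k) x (fun t => s (k, t)) where
  le t := iSup₂_le fun i _ => (hmeas i).comap_le
  mono t t' htt' := biSup_mono fun i hi => hi.imp_right fun h => ⟨h.1, h.2.trans_le htt'⟩
  meas_start := hx
  meas_sample t := measurable_stagePast (Or.inr ⟨rfl, Nat.lt_succ_self t⟩)
  law t := hlaw _
  indep t := by
    have h1 := indep_iSup_of_disjoint (fun i => (hmeas i).comap_le) hindep
      (S := {q : ℕ × ℕ | q.1 < k ∨ (q.1 = k ∧ q.2 < t)}) (T := {(k, t)})
      (Set.disjoint_singleton_right.mpr (by simp))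
    rw [iSup_singleton] at h1
    exact h1

/-- Half of the decrease ‖U‖²/(4m) absorbs the part of the solver error proportional to E‖U‖², and
only the noise part remains as an error term. -/
theorem spg_stage_descent {mΩ : MeasurableSpace Ω} {P : Measure Ω} [IsProbabilityMeasure P]
    {s : ℕ × ℕ → Ω → Ξ × Z} (hmeas : ∀ i, Measurable (s i))
    (hlaw : ∀ i, P.map (s i) = pξ.prod pς) (hindep : iIndepFun s P)
    (ho : IsStochOracle g h pξ pς gS hS dh G) (hL : 0 < L) (hμ : 0 < μ)
    (hμL : 300 * L ≤ μ⁻¹) (hg : IsLSmooth L g) (hh : ConvexOn ℝ Set.univ h)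
    (hd : Differentiable ℝ h) (hr : IsProperLSC r) (hp : IsProxSelection r μ p)
    (hΔ : ∀ x, smoothedObj g h r μ x₁ ≤ smoothedObj g h r μ x + (Δ : EReal))
    {k : ℕ} (hk : 1 ≤ k) (hγ : 3 * L ≤ γ k) (hT : 4 ≤ T k) (hγT : γ k ≤ 3 * L * T k) :
    ∫⁻ ω, ENNReal.ofReal (smoothGap g h r μ p x₁ Δ
        (ssdcSPG gS dh μ p γ T x₁ (fun q => s q ω) (k + 1))) ∂P
      + ENNReal.ofReal (1 / (8 * (μ⁻¹ + γ k)))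
        * ∫⁻ ω, ‖proxResidual g h μ p (ssdcSPG gS dh μ p γ T x₁ (fun q => s q ω) k)‖ₑ ^ 2 ∂P
    ≤ ∫⁻ ω, ENNReal.ofReal (smoothGap g h r μ p x₁ Δ
        (ssdcSPG gS dh μ p γ T x₁ (fun q => s q ω) k)) ∂P
      + ENNReal.ofReal (41600 * G ^ 2 * μ / T k) := by
  obtain ⟨j, rfl⟩ : ∃ j, k = j + 1 := ⟨k - 1, by omega⟩
  set Y : Ω → RVec d := fun ω => ssdcSPG gS dh μ p γ T x₁ (fun q => s q ω) (j + 1) with hYdef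
  set Y' : Ω → RVec d := fun ω => ssdcSPG gS dh μ p γ T x₁ (fun q => s q ω) (j + 1 + 1)
    with hYdef'
  set m := μ⁻¹ + γ (j + 1) with hm
  have hγ0 : 0 < γ (j + 1) := by linarith
  have hμ' : 0 < μ⁻¹ := inv_pos.mpr hμ
  have hm0 : 0 < m := by positivity
  have hmμ : μ⁻¹ ≤ m := by linarith
  have hT0 : (0 : ℝ) < T (j + 1) := by exact_mod_cast (by omega : 0 < T (j + 1))
  have hgap0 := hr.smoothGap_nonneg hp hΔ
  have hgapm : Measurable (smoothGap g h r μ p x₁ Δ) :=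
    ((hr.measurable_smoothVal hp hg.1.continuous hd.continuous).sub_const _).add_const _
  have hdesc : ∀ x y, _ := fun x y =>
    hr.smoothGap_descent (x₁ := x₁) (Δ := Δ) hp hμ hg hh hd (by linarith) hmμ x y
  have hYm : Measurable Y := measurable_ssdcSPG ho.meas_g ho.meas_h hp.1 _ fun q _ => hmeas q
  have hYm' : Measurable Y' := measurable_ssdcSPG ho.meas_g ho.meas_h hp.1 _ fun q _ => hmeas q
  have hF := isStageFiltration_stagePast hmeas hlaw hindep (k := j + 1) (x := Y)
    (measurable_ssdcSPG ho.meas_g ho.meas_h hp.1 _ fun q hq => measurable_stagePast (Or.inl hq))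
  by_cases hfin : ∫⁻ ω, ENNReal.ofReal (smoothGap g h r μ p x₁ Δ (Y ω)) ∂P = ⊤
  · rw [hfin, top_add]; exact le_top
  set w := ∫⁻ ω, ‖proxResidual g h μ p (Y ω)‖ₑ ^ 2 ∂P with hw
  -- At the exact gradient step the gap is still nonnegative, so ‖U‖²/(4m) is at most the gap, which
  -- has finite expectation in this case.
  have hwfin : w ≠ ⊤ := by
    have h1 : ENNReal.ofReal (1 / (4 * m)) * w
        ≤ ∫⁻ ω, ENNReal.ofReal (smoothGap g h r μ p x₁ Δ (Y ω)) ∂P := by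
      rw [hw, ← lintegral_const_mul' _ _ ENNReal.ofReal_ne_top]
      refine lintegral_mono fun ω => ?_
      simp only [enorm_sq_eq_ofReal]
      rw [← ENNReal.ofReal_mul (by positivity)]
      refine ENNReal.ofReal_le_ofReal ?_
      have h2 := hdesc (Y ω) (Y ω - m⁻¹ • proxResidual g h μ p (Y ω))
      rw [sub_self, norm_zero] at h2
      have h3 := hgap0 (Y ω - m⁻¹ • proxResidual g h μ p (Y ω))
      linarith
    intro htop
    rw [htop, ENNReal.mul_top (ENNReal.ofReal_pos.mpr (by positivity)).ne', top_le_iff] at h1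
    exact hfin h1
  have hU : MeanSqLE P (fun ω => proxResidual g h μ p (Y ω)) w.toReal :=
    (ENNReal.ofReal_toReal hwfin).ge
  have hU2 : MeanSqLE P (fun ω => m⁻¹ • proxResidual g h μ p (Y ω)) ((m⁻¹) ^ 2 * w.toReal) :=
    hU.of_le_mul (by positivity) fun ω => by
      rw [norm_smul, mul_pow, Real.norm_eq_abs, sq_abs]
  have hE := meanSqLE_spg_sub hF ho hp.1 hμ hL hγ hg (by positivity) hU2 hT hγT
  have hfinal := lintegral_descent hgap0 hgapm hYm hYm' (show 0 ≤ 1 / (4 * m) by positivity)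
    hm0.le hE fun ω => hdesc (Y ω) (Y' ω)
  rw [← hm, ← hw] at hfinal
  set t := w.toReal with ht
  have ht0 : 0 ≤ t := ENNReal.toReal_nonneg
  have hwt : w = ENNReal.ofReal t := (ENNReal.ofReal_toReal hwfin).symm
  have hbound : m * (10400 * (L ^ 2 * ((m⁻¹) ^ 2 * t) + 4 * G ^ 2 / T (j + 1)) / m ^ 2)
      ≤ 1 / (8 * m) * t + 41600 * G ^ 2 * μ / T (j + 1) := by
    have h1 : m * (10400 * (L ^ 2 * ((m⁻¹) ^ 2 * t) + 4 * G ^ 2 / T (j + 1)) / m ^ 2)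
        = 83200 * L ^ 2 / m ^ 2 * (1 / (8 * m) * t) + 41600 * G ^ 2 * m⁻¹ / T (j + 1) := by
      field_simp; ring
    -- 83200 = 8 · 10400 is below 300², and m ≥ 300L; this fixes the constant 300.
    have h2 : 83200 * L ^ 2 / m ^ 2 ≤ 1 := by
      rw [div_le_one (by positivity)]; nlinarith
    have h3 : m⁻¹ ≤ μ := inv_le_of_inv_le₀ hμ hmμ
    rw [h1]
    have h4 : 0 ≤ 1 / (8 * m) * t := by positivity
    refine add_le_add (mul_le_of_le_one_left h4 h2) ?_
    gcongr
  have h8 : ENNReal.ofReal (1 / (4 * m)) * w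
      = ENNReal.ofReal (1 / (8 * m)) * w + ENNReal.ofReal (1 / (8 * m) * t) := by
    rw [hwt, ← ENNReal.ofReal_mul (by positivity), ← ENNReal.ofReal_mul (by positivity),
      ← ENNReal.ofReal_add (by positivity) (by positivity)]
    congr 1; field_simp; ring
  rw [h8, ← add_assoc] at hfinal
  have h9 := hfinal.trans (add_le_add_right (ENNReal.ofReal_le_ofReal hbound) _)
  rw [ENNReal.ofReal_add (by positivity) (by positivity),
    add_comm (ENNReal.ofReal (1 / (8 * m) * t)) (ENNReal.ofReal (41600 * G ^ 2 * μ / _)),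
    ← add_assoc] at h9
  exact (ENNReal.add_le_add_iff_right ENNReal.ofReal_ne_top).mp h9

end SPG

/-! ## SSDC with SVRG -/

section SVRG

variable {d n : ℕ} {Ω : Type*} {g h : RVec d → ℝ} {r : RVec d → EReal}
  {gc : Fin n → RVec d → ℝ} {L μ Δ η : ℝ} {γ : ℕ → ℝ} {T S : ℕ → ℕ} {p : RVec d → RVec d}
  {x₁ : RVec d}

theorem measurable_ssdcSVRG {m : MeasurableSpace Ω} (hp : Measurable p)
    {i : ℕ × ℕ × ℕ → Ω → Fin n} (hi : ∀ q, Measurable (i q)) (k : ℕ) :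
    Measurable fun ω => ssdcSVRG g h gc μ p γ η T S x₁ (fun q => i q ω) k := by
  have hgc : ∀ {I : Ω → Fin n} {y : Ω → RVec d}, Measurable I → Measurable y →
      Measurable fun ω => gradient (gc (I ω)) (y ω) := by
    intro I y hI hy
    have h1 : Measurable fun w : Fin n × RVec d => gradient (gc w.1) w.2 :=
      measurable_from_prod_countable_right fun i => measurable_gradient (gc i)
    exact h1.comp (hI.prodMk hy)
  have hinner : ∀ (k s : ℕ) {x y v : Ω → RVec d}, Measurable x → Measurable y → Measurable v →
      ∀ t, Measurable fun ω => svrgInner gc μ (γ k) η (x ω) (y ω) (v ω)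
        (fun t => i (k, s, t) ω) t := by
    intro k s x y v hx hy hv t
    induction t with
    | zero => exact hy
    | succ t ih =>
      exact (((hx.const_smul (γ k)).add (ih.const_smul η⁻¹)).sub
        (((hgc (hi _) ih).sub (hgc (hi _) hy)).add hv)).const_smul (μ⁻¹ + γ k + η⁻¹)⁻¹
  have houter : ∀ (k : ℕ) {x q : Ω → RVec d}, Measurable x → Measurable q →
      ∀ s, Measurable fun ω => svrg g gc μ (γ k) η (T k) (q ω) (x ω)
        (fun s t => i (k, s, t) ω) s := by
    intro k x q hx hq s
    induction s with
    | zero => exact hx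
    | succ s ih =>
      have hsum := Finset.measurable_fun_sum (Finset.Icc 1 (T k)) fun t _ =>
        hinner k (s + 1) hx ih (((measurable_gradient g).comp ih).sub hq) t
      exact hsum.const_smul (T k : ℝ)⁻¹
  induction k with
  | zero => exact measurable_const
  | succ k ih =>
    match k, ih with
    | 0, _ => exact measurable_const
    | k + 1, ih =>
      exact houter (k + 1) ih (((measurable_gradient h).comp ih).add
        ((hp.comp ih).const_smul μ⁻¹)) (S (k + 1))

/-- The solver error is at most (24L/m)‖U/m‖ for every sample, so half of the decrease absorbs it
entirely and descent is pathwise. At least one outer loop is needed. -/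
theorem svrg_stage_descent (hL : 0 < L) (hμ : 0 < μ) (hμL : 300 * L ≤ μ⁻¹)
    (hg : IsLSmooth L g) (hgc : ∀ i, IsLSmooth L (gc i)) (hh : ConvexOn ℝ Set.univ h)
    (hd : Differentiable ℝ h) (hr : IsProperLSC r) (hp : IsProxSelection r μ p)
    {k : ℕ} (hk : 1 ≤ k) (hγ : 0 < γ k) (hT : 0 < T k) (hS : 0 < S k) (i : ℕ × ℕ × ℕ → Fin n) :
    smoothGap g h r μ p x₁ Δ (ssdcSVRG g h gc μ p γ (0.05 / L) T S x₁ i (k + 1))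
      + 1 / (8 * (μ⁻¹ + γ k))
        * ‖proxResidual g h μ p (ssdcSVRG g h gc μ p γ (0.05 / L) T S x₁ i k)‖ ^ 2
      ≤ smoothGap g h r μ p x₁ Δ (ssdcSVRG g h gc μ p γ (0.05 / L) T S x₁ i k) := by
  obtain ⟨j, rfl⟩ : ∃ j, k = j + 1 := ⟨k - 1, by omega⟩
  obtain ⟨l, hl⟩ : ∃ l, S (j + 1) = l + 1 := ⟨S (j + 1) - 1, by omega⟩
  have hstep : ssdcSVRG g h gc μ p γ (0.05 / L) T S x₁ i (j + 1 + 1)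
      = svrg g gc μ (γ (j + 1)) (0.05 / L) (T (j + 1))
        (gradient h (ssdcSVRG g h gc μ p γ (0.05 / L) T S x₁ i (j + 1))
          + μ⁻¹ • p (ssdcSVRG g h gc μ p γ (0.05 / L) T S x₁ i (j + 1)))
        (ssdcSVRG g h gc μ p γ (0.05 / L) T S x₁ i (j + 1))
        (fun s t => i (j + 1, s, t)) (l + 1) := by
    rw [← hl]; rfl
  rw [hstep]
  set x := ssdcSVRG g h gc μ p γ (0.05 / L) T S x₁ i (j + 1)
  set m := μ⁻¹ + γ (j + 1) with hm
  have hμ' : 0 < μ⁻¹ := inv_pos.mpr hμ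
  have hm0 : 0 < m := by positivity
  have hmμ : μ⁻¹ ≤ m := by linarith
  have hxz : ‖x - (x - m⁻¹ • proxResidual g h μ p x)‖ = m⁻¹ * ‖proxResidual g h μ p x‖ := by
    rw [sub_sub_cancel, norm_smul, Real.norm_of_nonneg (by positivity)]
  have h1 := (norm_svrg_sub_le hL hμ hγ (by linarith) hg hgc
    (smul_gradient_step hμ hγ p x) hxz.le hT (fun s t => i (j + 1, s, t)) l).2
  rw [← hm] at h1
  set y := svrg g gc μ (γ (j + 1)) (0.05 / L) (T (j + 1)) (gradient h x + μ⁻¹ • p x) x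
    (fun s t => i (j + 1, s, t)) (l + 1)
  have h2 := hr.smoothGap_descent (x₁ := x₁) (Δ := Δ) hp hμ hg hh hd (by linarith) hmμ x y
  have h3 := pow_le_pow_left₀ (norm_nonneg _) h1 2
  have h4 : m * ‖y - (x - m⁻¹ • proxResidual g h μ p x)‖ ^ 2
      ≤ 1 / (8 * m) * ‖proxResidual g h μ p x‖ ^ 2 := by
    refine (mul_le_mul_of_nonneg_left h3 hm0.le).trans ?_
    have h5 : m * (24 * L / m * (m⁻¹ * ‖proxResidual g h μ p x‖)) ^ 2
        = 4608 * L ^ 2 / m ^ 2 * (1 / (8 * m) * ‖proxResidual g h μ p x‖ ^ 2) := by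
      field_simp; ring
    rw [h5]
    refine mul_le_of_le_one_left (by positivity) ?_
    rw [div_le_one (by positivity)]; nlinarith
  have h6 : 1 / (4 * m) = 1 / (8 * m) + 1 / (8 * m) := by field_simp; norm_num
  rw [h6, add_mul] at h2
  linarith

end SVRG

/-! ## The guarantees -/

/-- The proximal displacement is controlled by the gap, uniformly in small `ε`. -/
def ProxDistBound {d : ℕ} (g h : RVec d → ℝ) (r : RVec d → EReal) (x₁ : RVec d) (Δ : ℝ) (m : ℕ)
    (cw ε₁ : ℝ) : Prop :=
  0 ≤ cw ∧ 0 < ε₁ ∧ ∀ ε, 0 < ε → ε ≤ ε₁ → ∀ p, IsProxSelection r (ε ^ m) p → ∀ x,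
    ‖x - p x‖ ^ 2 ≤ cw * ε ^ 2 * (smoothGap g h r (ε ^ m) p x₁ Δ x + 1)

section SPGCount

variable {L β : ℝ}

theorem spgT_eq (hL : 0 < L) {γ : ℕ → ℝ} (hγ : ∀ k, γ k = 3 * L * (k : ℝ) ^ β) {k : ℕ}
    (hk : 1 ≤ k) : spgT L γ k = ⌈(k : ℝ) ^ (1 - β) + 3⌉₊ := by
  have hk0 : (0 : ℝ) < k := by exact_mod_cast hk
  rw [spgT, hγ, Real.rpow_sub hk0, Real.rpow_one, mul_div_mul_left _ _ (by positivity)]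

theorem spgT_bounds (hL : 0 < L) (hβ1 : β ≤ 1) {γ : ℕ → ℝ}
    (hγ : ∀ k, γ k = 3 * L * (k : ℝ) ^ β) {k : ℕ} (hk : 1 ≤ k) :
    4 ≤ spgT L γ k ∧ (k : ℝ) ^ (1 - β) ≤ spgT L γ k ∧
      (spgT L γ k : ℝ) ≤ 5 * (k : ℝ) ^ (1 - β) := by
  have hk1 : (1 : ℝ) ≤ (k : ℝ) ^ (1 - β) :=
    Real.one_le_rpow (by exact_mod_cast hk) (by linarith)
  rw [spgT_eq hL hγ hk]
  have h1 := Nat.le_ceil ((k : ℝ) ^ (1 - β) + 3)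
  have h2 := Nat.ceil_lt_add_one (show 0 ≤ (k : ℝ) ^ (1 - β) + 3 by positivity)
  refine ⟨?_, by linarith, by linarith⟩
  have : (4 : ℝ) ≤ ⌈(k : ℝ) ^ (1 - β) + 3⌉₊ := by linarith
  exact_mod_cast this

theorem sum_spgT_le (hL : 0 < L) (hβ1 : β ≤ 1) {γ : ℕ → ℝ}
    (hγ : ∀ k, γ k = 3 * L * (k : ℝ) ^ β) {T : ℕ → ℕ} (hT : ∀ k, T k = spgT L γ k) {K : ℕ}
    (hK : 1 ≤ K) :
    ((∑ k ∈ Finset.Icc 1 K, T k : ℕ) : ℝ) ≤ 5 * (K : ℝ) ^ (2 - β) := by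
  have hK0 : (0 : ℝ) < K := by exact_mod_cast hK
  rw [Nat.cast_sum]
  calc ∑ k ∈ Finset.Icc 1 K, (T k : ℝ) ≤ ∑ k ∈ Finset.Icc 1 K, 5 * (K : ℝ) ^ (1 - β) := by
        refine Finset.sum_le_sum fun k hk => ?_
        obtain ⟨hk1, hkK⟩ := Finset.mem_Icc.mp hk
        rw [hT]
        refine (spgT_bounds hL hβ1 hγ hk1).2.2.trans ?_
        have : (k : ℝ) ≤ K := by exact_mod_cast hkK
        gcongr
    _ = 5 * (K : ℝ) ^ (2 - β) := by
        rw [Finset.sum_const, Nat.card_Icc, Nat.add_sub_cancel, nsmul_eq_mul,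
          show 2 - β = (1 - β) + 1 by ring, Real.rpow_add_one hK0.ne']
        ring

end SPGCount

theorem spgGuarantee_of_proxDistBound {d : ℕ} {g h : RVec d → ℝ} {r : RVec d → EReal}
    {L ν : ℝ} (hL : 0 < L) (hν : 0 < ν) (hν1 : ν ≤ 1) (hg : IsLSmooth L g)
    (hh : ConvexOn ℝ Set.univ h) (hhg : HasHolderGradient L ν h) (hr : IsProperLSC r)
    {x₁ : RVec d} {Δ μbar : ℝ} (hμbar : 0 < μbar) (hΔ0 : 0 ≤ Δ)
    (hΔ : ∀ μ : ℝ, 0 < μ → μ ≤ μbar → ∀ x,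
      smoothedObj g h r μ x₁ ≤ smoothedObj g h r μ x + (Δ : EReal))
    {α : ℝ} (hα : 0 ≤ α) {A : ℝ} (hA : 0 < A) (G : ℝ) {β e ebar cw ε₁ : ℝ} {m : ℕ} (hm1 : 1 ≤ m)
    (hβ : 0 < β) (hβ1 : β ≤ 1 / 2) (he : 0 ≤ e) (hm : β * e ≤ m) (hme : 2 * ν + m ≤ e)
    (hebar : ebar = e * (2 - β)) (hcw : ProxDistBound g h r x₁ Δ m cw ε₁) :
    SPGGuarantee.{u₁, u₂, u₃} g h r L ν G α A x₁ β m e ebar := by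
  obtain ⟨hcw0, hε₁, hcw⟩ := hcw
  set Err := 41600 * G ^ 2 * ((A + 1) ^ β / β) with hErrdef
  have hErr0 : 0 ≤ Err := by positivity
  set C₁ := (1 + 2 * L) * (1 + cw * (Δ + Err + 1))
      + 8 * (α + 1) * (1 + 3 * L * (A + 1) ^ β) * (Δ + Err) / A with hC₁
  have hC₁0 : 0 ≤ C₁ := by positivity
  -- The thresholds ensure ε ≤ 1, validity of the displacement bound, μ ≤ μbar, and 300L ≤ μ⁻¹; the
  -- last two use μ ≤ ε.
  refine ⟨C₁ + 5 + 5 * (A + 1) ^ (2 - β), min (min 1 ε₁) (min μbar (1 / (300 * L))),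
    by positivity, by positivity, ?_⟩
  intro Ξ Z _ _ pξ pς gS hS dh ho ε hε hε0 μ γ T K hμ hγ hT hK
  have hε1 : ε ≤ 1 := hε0.trans ((min_le_left _ _).trans (min_le_left _ _))
  have hεε₁ : ε ≤ ε₁ := hε0.trans ((min_le_left _ _).trans (min_le_right _ _))
  have hεμ : ε ≤ μbar := hε0.trans ((min_le_right _ _).trans (min_le_left _ _))
  have hεL : ε ≤ 1 / (300 * L) := hε0.trans ((min_le_right _ _).trans (min_le_right _ _))
  have hμε : μ ≤ ε := by
    rw [hμ]; exact pow_le_of_le_one hε.le hε1 (by omega)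
  have hμ0 : 0 < μ := by rw [hμ]; positivity
  obtain ⟨hK1, -, hKle⟩ := stageCount_bounds hε hε1 hA he hK
  have hsum := sum_spgT_le hL (by linarith) hγ hT hK1
  refine ⟨fun p hp Ω _ P s τ hrun => ?_, ?_, ?_⟩
  · have := hrun.prob
    have hμL : 300 * L ≤ μ⁻¹ := by
      rw [le_inv_comm₀ (by positivity) hμ0, ← one_div]
      exact hμε.trans hεL
    have hΔμ := hΔ μ hμ0 (hμε.trans hεμ)
    refine isNearlyCritical_of_descent hrun hα hL hν hν1 hε hε1 hμ hA he hβ.le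
      (c := 3 * L) (by positivity) hm hme hK hγ hcw0 hg hhg hr hp hΔμ
      (fun x => by
        rw [hμ] at hp ⊢
        exact hcw ε hε hεε₁ p hp x)
      (X := fun k S => ssdcSPG gS dh μ p γ T x₁ S k)
      (fun k => measurable_ssdcSPG ho.meas_g ho.meas_h hp.1 k fun q _ => measurable_pi_apply q)
      (fun _ => rfl) (err := fun k => 41600 * G ^ 2 * μ / T k) (fun _ _ => by positivity)
      (Err := Err) ?_ (fun k hk => ?_) (C := C₁ + 5 + 5 * (A + 1) ^ (2 - β)) ?_
    · calc ∑ k ∈ Finset.Icc 1 K, 41600 * G ^ 2 * μ / T k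
          ≤ ∑ k ∈ Finset.Icc 1 K, 41600 * G ^ 2 * μ * (k : ℝ) ^ (β - 1) := by
            refine Finset.sum_le_sum fun k hk => ?_
            have hk1 := (Finset.mem_Icc.mp hk).1
            have hk0 : (0 : ℝ) < k := by exact_mod_cast hk1
            rw [hT, div_eq_mul_inv]
            refine mul_le_mul_of_nonneg_left ?_ (by positivity)
            rw [show β - 1 = -(1 - β) by ring, Real.rpow_neg hk0.le]
            exact inv_anti₀ (by positivity) (spgT_bounds hL (by linarith) hγ hk1).2.1
        _ = 41600 * G ^ 2 * (μ * ∑ k ∈ Finset.Icc 1 K, (k : ℝ) ^ (β - 1)) := by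
            rw [← Finset.mul_sum]; ring
        _ ≤ Err := by
            rw [hErrdef]
            refine mul_le_mul_of_nonneg_left ?_ (by positivity)
            rw [le_div_iff₀ hβ]
            have h1 := sum_rpow_sub_one_le hβ (by linarith) K
            have h2 := stageCount_rpow_le hε hε1 hA he hK hβ.le hm
            rw [← hμ] at h2
            nlinarith
    · have hk1 := (Finset.mem_Icc.mp hk).1
      have hk1' : (1 : ℝ) ≤ k := by exact_mod_cast hk1
      obtain ⟨hT4, hTge, -⟩ := spgT_bounds hL (by linarith) hγ hk1
      rw [← hT] at hT4 hTge
      refine spg_stage_descent hrun.meas hrun.law hrun.indep ho hL hμ0 hμL hg hh hhg.1 hr hp hΔμ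
        hk1 ?_ hT4 ?_
      · rw [hγ]
        exact le_mul_of_one_le_right (by positivity) (Real.one_le_rpow hk1' hβ.le)
      -- γ_k ≤ 3L T_k reduces to k^β ≤ k^(1−β), which is where β ≤ 1/2 is used.
      · rw [hγ]
        refine mul_le_mul_of_nonneg_left (le_trans ?_ hTge) (by positivity)
        exact Real.rpow_le_rpow_of_exponent_le hk1' (by linarith)
    · have : 0 ≤ 5 + 5 * (A + 1) ^ (2 - β) := by positivity
      linarith
  · refine hsum.trans (mul_le_mul_of_nonneg_right ?_ (by positivity))
    have : 0 ≤ 5 * (A + 1) ^ (2 - β) := by positivity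
    linarith
  · have h1 := Real.rpow_le_rpow (by positivity) hKle (show 0 ≤ 2 - β by linarith)
    rw [Real.div_rpow (by positivity) (by positivity), ← Real.rpow_mul hε.le, ← hebar] at h1
    have h2 : 5 * ((A + 1) ^ (2 - β) / ε ^ ebar)
        ≤ (C₁ + 5 + 5 * (A + 1) ^ (2 - β)) / ε ^ ebar := by
      rw [← mul_div_assoc]
      gcongr
      linarith
    linarith

section SVRGCount

theorem svrgS_one : svrgS 1 = 0 := by simp [svrgS]

theorem svrgS_pos {k : ℕ} (hk : 2 ≤ k) : 0 < svrgS k :=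
  Nat.ceil_pos.mpr (Real.logb_pos one_lt_two (by exact_mod_cast hk))

theorem svrgGradCount_le {L c β A e ε : ℝ} (hL : 0 < L) (hc : 0 < c) (hβ : 0 ≤ β) (hA : 0 < A)
    (he : 0 ≤ e) (hε : 0 < ε) (hε1 : ε ≤ 1) {n K : ℕ} (hn : 1 ≤ n) (hK : K = ⌈A / ε ^ e⌉₊)
    {γ : ℕ → ℝ} (hγ : ∀ k, γ k = c * (k : ℝ) ^ β) {T : ℕ → ℕ}
    (hT : ∀ k ∈ Finset.Icc 1 K, T k = ⌈max 2 (200 * L / γ k)⌉₊) :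
    (svrgGradCount n T svrgS K : ℝ) ≤
      ((A + 1) * (4 + 200 * L / c) * (1 + (Real.log (A + 1) + e) / Real.log 2)) * n / ε ^ e
        * (1 + Real.log (1 / ε)) := by
  obtain ⟨hK1, -, hKle⟩ := stageCount_bounds hε hε1 hA he hK
  have hK0 : (0 : ℝ) < K := by exact_mod_cast hK1
  have hn' : (1 : ℝ) ≤ n := by exact_mod_cast hn
  have hlog2 : 0 < Real.log 2 := Real.log_pos one_lt_two
  have hlogA : 0 ≤ Real.log (A + 1) := Real.log_nonneg (by linarith)
  have hlogε : 0 ≤ Real.log (1 / ε) := Real.log_nonneg (by rw [le_div_iff₀ hε]; linarith)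
  set D := 1 + (Real.log (A + 1) + e) / Real.log 2 with hD
  -- Since K ≤ (A+1)ε^(−e), log K is affine in log(1/ε).
  have hS : Real.logb 2 K + 1 ≤ D * (1 + Real.log (1 / ε)) := by
    have h1 : Real.log K ≤ Real.log (A + 1) + e * Real.log (1 / ε) := by
      refine (Real.log_le_log hK0 hKle).trans_eq ?_
      rw [Real.log_div (by positivity) (by positivity), Real.log_rpow hε, one_div, Real.log_inv]
      ring
    have h2 : Real.logb 2 K ≤ (Real.log (A + 1) + e * Real.log (1 / ε)) / Real.log 2 := by
      rw [Real.logb]; gcongr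
    have h3 : D * (1 + Real.log (1 / ε))
        = (Real.log (A + 1) + e * Real.log (1 / ε)) / Real.log 2 + 1 + Real.log (1 / ε)
          + Real.log (A + 1) / Real.log 2 * Real.log (1 / ε) + e / Real.log 2 := by
      rw [hD]; ring
    have h4 : 0 ≤ Real.log (A + 1) / Real.log 2 * Real.log (1 / ε) := by positivity
    have h5 : 0 ≤ e / Real.log 2 := by positivity
    linarith
  have hterm : ∀ k ∈ Finset.Icc 1 K, (((n + T k) * svrgS k : ℕ) : ℝ)
      ≤ n * (4 + 200 * L / c) * (D * (1 + Real.log (1 / ε))) := by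
    intro k hk
    obtain ⟨hk1, hkK⟩ := Finset.mem_Icc.mp hk
    have hk1' : (1 : ℝ) ≤ k := by exact_mod_cast hk1
    have h1 : (svrgS k : ℝ) ≤ D * (1 + Real.log (1 / ε)) := by
      have h2 : 0 ≤ Real.logb 2 k := Real.logb_nonneg one_lt_two hk1'
      have h3 := Nat.ceil_lt_add_one h2
      have h4 : Real.logb 2 k ≤ Real.logb 2 K :=
        Real.logb_le_logb_of_le one_lt_two (by linarith) (by exact_mod_cast hkK)
      rw [svrgS]; linarith
    have h5 : (T k : ℝ) ≤ 3 + 200 * L / c := by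
      rw [hT k hk]
      have h6 : 200 * L / γ k ≤ 200 * L / c := by
        rw [hγ]
        gcongr
        exact le_mul_of_one_le_right hc.le (Real.one_le_rpow hk1' hβ)
      have h7 : max 2 (200 * L / γ k) ≤ 2 + 200 * L / c :=
        max_le (by have : 0 ≤ 200 * L / c := by positivity
                   linarith) (by linarith)
      have h8 := Nat.ceil_lt_add_one
        (show 0 ≤ max 2 (200 * L / γ k) from le_max_of_le_left (by norm_num))
      linarith
    have h9 : (n : ℝ) + T k ≤ n * (4 + 200 * L / c) := by
      have : 0 ≤ 200 * L / c := by positivity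
      nlinarith
    push_cast
    gcongr
  rw [svrgGradCount, Nat.cast_sum]
  have hX : 0 ≤ n * (4 + 200 * L / c) * (D * (1 + Real.log (1 / ε))) := by positivity
  calc _ ≤ ∑ k ∈ Finset.Icc 1 K, n * (4 + 200 * L / c) * (D * (1 + Real.log (1 / ε))) :=
        Finset.sum_le_sum hterm
    _ = K * (n * (4 + 200 * L / c) * (D * (1 + Real.log (1 / ε)))) := by simp
    _ ≤ (A + 1) / ε ^ e * (n * (4 + 200 * L / c) * (D * (1 + Real.log (1 / ε)))) := by gcongr
    _ = _ := by ring

end SVRGCount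

theorem svrgGuarantee_of_proxDistBound {d : ℕ} {g h : RVec d → ℝ} {r : RVec d → EReal}
    {L ν : ℝ} (hL : 0 < L) (hν : 0 < ν) (hν1 : ν ≤ 1)
    (hh : ConvexOn ℝ Set.univ h) (hhg : HasHolderGradient L ν h) (hr : IsProperLSC r)
    {x₁ : RVec d} {Δ μbar : ℝ} (hμbar : 0 < μbar) (hΔ0 : 0 ≤ Δ)
    (hΔ : ∀ μ : ℝ, 0 < μ → μ ≤ μbar → ∀ x,
      smoothedObj g h r μ x₁ ≤ smoothedObj g h r μ x + (Δ : EReal))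
    {α : ℝ} (hα : 0 ≤ α) {A : ℝ} (hA : 0 < A) {c : ℝ} (hc : 0 < c) {β e cw ε₁ : ℝ} {m : ℕ}
    (hm1 : 1 ≤ m) (hβ : 0 ≤ β) (he : 0 ≤ e) (hm : β * e ≤ m) (hme : 2 * ν + m ≤ e)
    (hcw : ProxDistBound g h r x₁ Δ m cw ε₁) :
    SVRGGuarantee.{u₄} g h r L ν α c A x₁ β m e := by
  obtain ⟨hcw0, hε₁, hcw⟩ := hcw
  set C₁ := (1 + 2 * L) * (1 + cw * (Δ + Δ + 1))
      + 8 * (α + 1) * (1 + c * (A + 1) ^ β) * (Δ + Δ) / A with hC₁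
  have hC₁0 : 0 < C₁ := by positivity
  set C₂ := (A + 1) * (4 + 200 * L / c) * (1 + (Real.log (A + 1) + e) / Real.log 2) with hC₂
  have hC₂0 : 0 ≤ C₂ := by
    have : 0 ≤ Real.log (A + 1) := Real.log_nonneg (by linarith)
    have : 0 < Real.log 2 := Real.log_pos one_lt_two
    positivity
  refine ⟨C₁ + C₂, min (min 1 ε₁) (min μbar (1 / (300 * L))), by positivity, by positivity, ?_⟩
  intro n₁ n₂ gc hc' hn₁ hn₂ hgavg _ hgc ε hε hε0 μ γ T K hμ hγ hT hK
  have hg : IsLSmooth L g := IsLSmooth.average hn₁ hgavg hgc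
  have hε1 : ε ≤ 1 := hε0.trans ((min_le_left _ _).trans (min_le_left _ _))
  have hεε₁ : ε ≤ ε₁ := hε0.trans ((min_le_left _ _).trans (min_le_right _ _))
  have hεμ : ε ≤ μbar := hε0.trans ((min_le_right _ _).trans (min_le_left _ _))
  have hεL : ε ≤ 1 / (300 * L) := hε0.trans ((min_le_right _ _).trans (min_le_right _ _))
  have hμε : μ ≤ ε := by
    rw [hμ]; exact pow_le_of_le_one hε.le hε1 (by omega)
  have hμ0 : 0 < μ := by rw [hμ]; positivity
  have hμ' : 0 < μ⁻¹ := inv_pos.mpr hμ0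
  obtain ⟨hK1, -, -⟩ := stageCount_bounds hε hε1 hA he hK
  refine ⟨fun p hp Ω _ P i τ hrun => ?_, fun hTmin => ?_⟩
  · have := hrun.prob
    have hμL : 300 * L ≤ μ⁻¹ := by
      rw [le_inv_comm₀ (by positivity) hμ0, ← one_div]
      exact hμε.trans hεL
    have hΔμ := hΔ μ hμ0 (hμε.trans hεμ)
    have hgap0 := hr.smoothGap_nonneg hp hΔμ
    have hgapm : Measurable (smoothGap g h r μ p x₁ Δ) :=
      ((hr.measurable_smoothVal hp hg.1.continuous hhg.1.continuous).sub_const _).add_const _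
    have hXm : ∀ k, Measurable fun ω =>
        ssdcSVRG g h gc μ p γ (0.05 / L) T svrgS x₁ (fun q => i q ω) k :=
      fun k => measurable_ssdcSVRG hp.1 hrun.meas k
    refine isNearlyCritical_of_descent hrun hα hL hν hν1 hε hε1 hμ hA he hβ hc hm hme hK hγ
      hcw0 hg hhg hr hp hΔμ
      (fun x => by
        rw [hμ] at hp ⊢
        exact hcw ε hε hεε₁ p hp x)
      (X := fun k S => ssdcSVRG g h gc μ p γ (0.05 / L) T svrgS x₁ S k)
      (fun k => measurable_ssdcSVRG hp.1 measurable_pi_apply k)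
      -- Because ⌈log₂ 1⌉ = 0, stage 1 runs no outer loop and x₂ = x₁. Its missing decrease is
      -- charged to a single error term Δ.
      (fun _ => rfl) (err := fun k => if k = 1 then Δ else 0)
      (fun k _ => by split_ifs <;> simp [hΔ0]) (Err := Δ) ?_ (fun k hk => ?_)
      (C := C₁ + C₂) (by linarith)
    · rw [Finset.sum_ite_eq' (Finset.Icc 1 K) 1 (fun _ => Δ)]
      split_ifs <;> simp [hΔ0]
    · obtain ⟨hk1, -⟩ := Finset.mem_Icc.mp hk
      have hk0 : (0 : ℝ) < k := by exact_mod_cast hk1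
      have hγ0 : 0 < γ k := by rw [hγ]; positivity
      have hT2 : 0 < T k := by
        have : (2 : ℝ) ≤ T k := (le_max_left _ _).trans (hT k hk)
        have : 2 ≤ T k := by exact_mod_cast this
        omega
      rcases Nat.lt_or_ge 1 k with hk2 | hk2
      · have h1 := lintegral_descent (P := P) hgap0 hgapm (hXm k) (hXm (k + 1))
          (show 0 ≤ 1 / (8 * (μ⁻¹ + γ k)) by positivity) (m := 0) (v := 0) (E := fun _ => 0)
          (U := proxResidual g h μ p) le_rfl (by simp [MeanSqLE]) fun ω => by
            have := svrg_stage_descent (x₁ := x₁) (Δ := Δ) hL hμ0 hμL hg hgc hh hhg.1 hr hp hk1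
              hγ0 hT2 (svrgS_pos hk2) (fun q => i q ω)
            linarith
        rwa [mul_zero, ← if_neg (c := k = 1) (t := Δ) (e := (0 : ℝ)) (by omega)] at h1
      · obtain rfl : k = 1 := by omega
        have hX2 : ∀ S : ℕ × ℕ × ℕ → Fin n₁,
            ssdcSVRG g h gc μ p γ (0.05 / L) T svrgS x₁ S (1 + 1) = x₁ := by
          intro S
          change svrg g gc μ (γ 1) (0.05 / L) (T 1) (gradient h x₁ + μ⁻¹ • p x₁) x₁
            (fun s t => S (1, s, t)) (svrgS 1) = x₁
          rw [svrgS_one]; rfl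
        have hX1 : ∀ S : ℕ × ℕ × ℕ → Fin n₁,
            ssdcSVRG g h gc μ p γ (0.05 / L) T svrgS x₁ S 1 = x₁ := fun _ => rfl
        simp only [hX1, hX2, lintegral_const, measure_univ, mul_one, if_true]
        gcongr
        rw [enorm_sq_eq_ofReal, ← ENNReal.ofReal_mul (by positivity)]
        refine ENNReal.ofReal_le_ofReal ?_
        set M := μ⁻¹ + γ 1
        have hM0 : 0 < M := by positivity
        -- The residual at x₁ is bounded by a virtual gradient step: ‖U(x₁)‖²/(4M) is at most the
        -- gap at x₁, which equals Δ.
        have h2 := hr.smoothGap_descent (x₁ := x₁) (Δ := Δ) (L := L) (m := M) hp hμ0 hg hh hhg.1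
          (by linarith) (by simp only [M]; linarith) x₁ (x₁ - M⁻¹ • proxResidual g h μ p x₁)
        rw [sub_self, norm_zero] at h2
        have h3 := hgap0 (x₁ - M⁻¹ • proxResidual g h μ p x₁)
        have h4 : smoothGap g h r μ p x₁ Δ x₁ = Δ := by simp [smoothGap]
        have h5 : 1 / (4 * M) = 1 / (8 * M) + 1 / (8 * M) := by field_simp; norm_num
        have h6 : 0 ≤ 1 / (8 * M) * ‖proxResidual g h μ p x₁‖ ^ 2 := by positivity
        rw [h5, h4, add_mul] at h2
        linarith
  · refine (svrgGradCount_le hL hc hβ hA he hε hε1 (n := n₁ + n₂) (by omega) hK hγ hTmin).trans ?_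
    have hlogε : 0 ≤ Real.log (1 / ε) := Real.log_nonneg (by rw [le_div_iff₀ hε]; linarith)
    have : C₂ ≤ C₁ + C₂ := by linarith
    gcongr

theorem proxDistBound_of_lipschitz {d : ℕ} {g h : RVec d → ℝ} {r : RVec d → EReal}
    (hr : IsProperLSC r) (hlip : RegLipschitz r) {x₁ : RVec d} {Δ μbar : ℝ} (hμbar : 0 < μbar)
    (hΔ : ∀ μ : ℝ, 0 < μ → μ ≤ μbar → ∀ x,
      smoothedObj g h r μ x₁ ≤ smoothedObj g h r μ x + (Δ : EReal)) :
    ∃ cw ε₁, ProxDistBound g h r x₁ Δ 1 cw ε₁ := by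
  obtain ⟨ρ, M, hρ, hrρ⟩ := hlip
  refine ⟨4 * M ^ 2, μbar, by positivity, hμbar, fun ε hε hε₁ p hp x => ?_⟩
  rw [pow_one] at hp ⊢
  have h1 := hr.norm_sub_prox_le_of_lipschitz hp hε hρ hrρ x
  have h2 := hr.smoothGap_nonneg hp (hΔ ε hε hε₁) x
  have h3 := pow_le_pow_left₀ (norm_nonneg _) h1 2
  have h4 : 0 ≤ 4 * (M : ℝ) ^ 2 * ε ^ 2 * smoothGap g h r ε p x₁ Δ x := by positivity
  nlinarith

theorem proxDistBound_of_bddBelow {d : ℕ} {g h : RVec d → ℝ} {r : RVec d → EReal}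
    (hr : IsProperLSC r) (hb : RegBddBelow r) {x₁ : RVec d} {Δ μbar : ℝ} (hμbar : 0 < μbar)
    (hΔ : ∀ μ : ℝ, 0 < μ → μ ≤ μbar → ∀ x,
      smoothedObj g h r μ x₁ ≤ smoothedObj g h r μ x + (Δ : EReal)) :
    ∃ cw ε₁, ProxDistBound g h r x₁ Δ 2 cw ε₁ := by
  obtain ⟨c, hc0, hc⟩ := hr.exists_norm_sub_prox_sq_le hb hμbar hΔ
  refine ⟨c, min 1 (μbar / 2), hc0, by positivity, fun ε hε hε₁ p hp x =>
    hc (ε ^ 2) (by positivity) ?_ p hp x⟩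
  have h1 : ε ≤ 1 := hε₁.trans (min_le_left _ _)
  exact (pow_le_of_le_one hε.le h1 (by norm_num)).trans (hε₁.trans (min_le_right _ _))

theorem mainTheorem11 {d : ℕ} (g h : RVec d → ℝ) (r : RVec d → EReal)
    (L ν : ℝ) (hL : 0 < L) (hν : 0 < ν) (hν1 : ν ≤ 1)
    (hg : ConvexOn ℝ Set.univ g) (hh : ConvexOn ℝ Set.univ h)
    (hh_grad : HasHolderGradient L ν h) (hr : IsProperLSC r)
    (x₁ : RVec d) (Δ μbar : ℝ) (hμbar : 0 < μbar)
    (hΔ : ∀ μ : ℝ, 0 < μ → μ ≤ μbar → ∀ x,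
      smoothedObj g h r μ x₁ ≤ smoothedObj g h r μ x + (Δ : EReal))
    (α : ℝ) (hα : 1 ≤ α) (A : ℝ) (hA : 0 < A) :
    (∀ G : ℝ, 0 < G → IsLSmooth L g → RegLipschitz r →
      SPGGuarantee.{u₁, u₂, u₃} g h r L ν G α A x₁ (1 / 3) 1
        (3 * (1 + ν) / 2) (5 * (1 + ν) / 2)) ∧
    (∀ G : ℝ, 0 < G → IsLSmooth L g → RegFinite r →
      SPGGuarantee.{u₁, u₂, u₃} g h r L ν G α A x₁ (1 / 2) 2
        (4 * (2 + ν) / 3) (2 * (2 + ν))) ∧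
    (∀ c : ℝ, 0 < c → RegLipschitz r →
      SVRGGuarantee.{u₄} g h r L ν α c A x₁ (1 / 3) 1 (3 * (1 + ν) / 2)) ∧
    (∀ c : ℝ, 0 < c → (RegFinite r ∨ RegLevelBdd g h r) →
      SVRGGuarantee.{u₄} g h r L ν α c A x₁ (1 / 2) 2 (4 * (2 + ν) / 3)) := by
  -- Taking x = x₁ gives Δ ≥ 0 only where F_μ(x₁) is finite, so Δ is replaced by max Δ 0.
  obtain ⟨Δ', hΔ'0, hΔ'⟩ : ∃ Δ' : ℝ, 0 ≤ Δ' ∧ ∀ μ : ℝ, 0 < μ → μ ≤ μbar → ∀ x,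
      smoothedObj g h r μ x₁ ≤ smoothedObj g h r μ x + (Δ' : EReal) :=
    ⟨max Δ 0, le_max_right _ _, fun μ hμ hμ' x => (hΔ μ hμ hμ' x).trans
      (add_le_add le_rfl (EReal.coe_le_coe_iff.mpr (le_max_left _ _)))⟩
  have hα0 : 0 ≤ α := by linarith
  refine ⟨fun G _ hgs hlip => ?_, fun G _ hgs hfin => ?_, fun c hc hlip => ?_,
    fun c hc hreg => ?_⟩
  -- For μ = ε the exponent conditions are (1+ν)/2 ≤ 1 and 2ν + 1 ≤ 3(1+ν)/2; for μ = ε² they are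
  -- 2(2+ν)/3 ≤ 2 and 2ν + 2 ≤ 4(2+ν)/3. All of them amount to ν ≤ 1.
  · obtain ⟨cw, ε₁, hcw⟩ := proxDistBound_of_lipschitz hr hlip hμbar hΔ'
    exact spgGuarantee_of_proxDistBound hL hν hν1 hgs hh hh_grad hr hμbar hΔ'0 hΔ' hα0 hA G
      le_rfl (by norm_num) (by norm_num) (by positivity) (by push_cast; linarith)
      (by push_cast; linarith) (by ring) hcw
  · obtain ⟨cw, ε₁, hcw⟩ := proxDistBound_of_bddBelow hr hfin.1 hμbar hΔ'
    exact spgGuarantee_of_proxDistBound hL hν hν1 hgs hh hh_grad hr hμbar hΔ'0 hΔ' hα0 hA G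
      one_le_two (by norm_num) le_rfl (by positivity) (by push_cast; linarith)
      (by push_cast; linarith) (by ring) hcw
  · obtain ⟨cw, ε₁, hcw⟩ := proxDistBound_of_lipschitz hr hlip hμbar hΔ'
    exact svrgGuarantee_of_proxDistBound hL hν hν1 hh hh_grad hr hμbar hΔ'0 hΔ' hα0 hA hc
      le_rfl (by norm_num) (by positivity) (by push_cast; linarith) (by push_cast; linarith) hcw
  · have hb : RegBddBelow r := hreg.elim (fun h => h.1) (fun h => h.2.2)
    obtain ⟨cw, ε₁, hcw⟩ := proxDistBound_of_bddBelow hr hb hμbar hΔ'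
    exact svrgGuarantee_of_proxDistBound hL hν hν1 hh hh_grad hr hμbar hΔ'0 hΔ' hα0 hA hc
      one_le_two (by norm_num) (by positivity) (by push_cast; linarith)
      (by push_cast; linarith) hcw
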